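/- \textbf{Setting.} Let $n>1$ and let $M$ be a smooth $(n+1)$-dimensional manifold with boundary $\mathcal I$, with a boundary defining function $\rho$ ($\rho>0$ in the interior, $\rho|_{\mathcal I}=0$, $d\rho|_{\mathcal I}\neq0$). Let $\hat g$ be a smooth Lorentzian metric on the interior of $M$, let $\nu_0\neq 0$ be a real constant and $h$ a metric on $\mathcal I$; either $\nu_0<0$ and $h$ has Euclidean signature (time-like infinity), or $\nu_0>0$ and $h$ has Lorentzian signature (space-like infinity). A \emph{Beig--Schmidt chart} is a smooth chart $(\rho_1,y^\alpha)$ of $M$ with $\rho_1=\rho+O(\rho^2)$ at the boundary in which, locally uniformly near boundary points and with smooth $\sigma(y)$ and $k_{\alpha\beta}(y)$, $$\rho_1^{2}\,\hat g=\rho_1^{-2}\nu_0^{-1}\bigl(1+2\rho_1\sigma+\rho_1^2\sigma^2+O(\rho_1^3\ln\rho_1)\bigr)d\rho_1^2+\bigl(h_{\alpha\beta}+\rho_1(k_{\alpha\beta}-2\sigma h_{\alpha\beta})+O(\rho_1^2\ln\rho_1)\bigr)dy^\alpha dy^\beta ,$$ the components of $\rho_1^2\hat g$ along $d\rho_1\,dy^\alpha$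 vanishing up to $O(\rho_1^2\ln\rho_1)$. Assume that every point of $\mathcal I$ lies in the domain of a Beig--Schmidt chart. Let $\mathrm{Ti}/\mathrm{Spi}\to\mathcal I$ be the bundle whose fibre at $x\in\mathcal I$ consists of the $2$-jets $j^2_x\rho+u\,j^2_x\rho^2$, $u\in\mathbb R$. It is a principal $\mathbb R$-bundle under $j\mapsto j+t\,j^2_x\rho^2$; let $n^a$ be the vector field generating this action, and denote the pullback of $h$ to $\mathrm{Ti}/\mathrm{Spi}$ by $h_{ab}$. A smooth chart $(u,y^\alpha)$ of $\mathrm{Ti}/\mathrm{Spi}$ and a Beig--Schmidt chart $(\rho_1,y^\alpha)$ are \emph{associated} if they induce the same coordinates $y^\alpha$ on $\mathcal I$ and the point with coordinates $(u,y)$, lying over $x\in\mathcal I$, is the $2$-jet $j^2_x(\rho_1+u\rho_1^2)$. \textbf{Proposition.} There is a smooth torsion-free connection $\nabla$ on $\mathrm{Ti}/\mathrm{Spi}$ with $\nabla_ch_{ab}=0$ and $\nabla_cn^a=0$ (a Carrollian connection) such that for every chart $(u,y^\alpha)$ of $\mathrm{Ti}/\mathrm{Spi}$ and every associated Beig--Schmidt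 chart, with corresponding $k_{\alpha\beta}$, the connection coefficients of $\nabla$ in the coordinates $(u,y^\alpha)$ are $$(\Gamma_c)^a{}_b=\begin{pmatrix}0&-\tfrac12C_{\gamma\beta}\,dy^\gamma\\[2pt]0&\Gamma^\alpha_{\gamma\beta}\,dy^\gamma\end{pmatrix},\qquad -\tfrac12C_{\alpha\beta}=\nu_0\bigl(\tfrac12k_{\alpha\beta}+u\,h_{\alpha\beta}\bigr),$$ where $\Gamma^\alpha_{\gamma\beta}$ are the Christoffel symbols of $h_{\alpha\beta}$. In particular $\nabla$ does not depend on the coordinates chosen, and it is the only connection with these coefficients in all such coordinate systems. -/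

import Mathlib

open Set Filter Topology Manifold Asymptotics
open scoped ContDiff

noncomputable section

/-! ### Two-jets of functions on a manifold with boundary -/

/-- Germs of smooth real functions at `x`, represented by functions smooth at `x`. -/
abbrev SmoothFunAt {n : ℕ} {M : Type*} [TopologicalSpace M]
    [ChartedSpace (EuclideanHalfSpace (n + 1)) M] (x : M) : Type _ :=
  {f : M → ℝ // ContMDiffAt (𝓡∂ (n + 1)) 𝓘(ℝ, ℝ) ∞ f x}

/-- Two smooth functions have the same 2-jet at `x` when their difference vanishes to order
higher than two at `x`, measured in a chart. -/
def twoJetSetoid {n : ℕ} {M : Type*} [TopologicalSpace M]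
    [ChartedSpace (EuclideanHalfSpace (n + 1)) M] (x : M) :
    Setoid (SmoothFunAt (n := n) x) where
  r f g := (fun p => f.1 p - g.1 p) =o[𝓝 x]
    fun p => ‖extChartAt (𝓡∂ (n + 1)) x p - extChartAt (𝓡∂ (n + 1)) x x‖ ^ 2
  iseqv :=
    { refl := fun f => by simp
      symm := fun {f g} h => by simpa using h.neg_left
      trans := fun {f g k} h₁ h₂ => by simpa using h₁.add h₂ }

/-- The space `J²ₓM` of 2-jets at `x` of smooth real functions. -/
def TwoJet (n : ℕ) {M : Type*} [TopologicalSpace M]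
    [ChartedSpace (EuclideanHalfSpace (n + 1)) M] (x : M) : Type _ :=
  Quotient (twoJetSetoid (n := n) x)

/-- `j` is the 2-jet at `x` of the function `f`. -/
def IsTwoJetOf {n : ℕ} {M : Type*} [TopologicalSpace M]
    [ChartedSpace (EuclideanHalfSpace (n + 1)) M] {x : M} (j : TwoJet n x) (f : M → ℝ) : Prop :=
  ∃ hf : ContMDiffAt (𝓡∂ (n + 1)) 𝓘(ℝ, ℝ) ∞ f x, j = Quotient.mk (twoJetSetoid x) ⟨f, hf⟩

/-- A bilinear form of signature `(-, +, …, +)`. -/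
def IsLorentzianForm {V : Type*} [AddCommGroup V] [Module ℝ V] [TopologicalSpace V]
    (g : V →L[ℝ] V →L[ℝ] ℝ) : Prop :=
  (∀ v w, g v w = g w v) ∧ ∃ v, g v v < 0 ∧ ∀ w, g v w = 0 → w ≠ 0 → 0 < g w w

/-- A bilinear form of signature `(+, …, +)`. -/
def IsEuclideanForm {V : Type*} [AddCommGroup V] [Module ℝ V] [TopologicalSpace V]
    (g : V →L[ℝ] V →L[ℝ] ℝ) : Prop :=
  (∀ v w, g v w = g w v) ∧ ∀ w, w ≠ 0 → 0 < g w w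

/-! ### Spacetimes with a boundary at time-like or space-like infinity -/

/-- The data of a spacetime `(M̂, ĝ)` realised as the interior of an `(n+1)`-dimensional manifold
`M` with boundary `B`, together with a boundary defining function `ρ`, the constant `ν₀` and the
metric `h` on the boundary. Time-like infinity has `ν₀ < 0` and Euclidean `h`, space-like infinity
has `0 < ν₀` and Lorentzian `h`. -/
structure InfinityData (n : ℕ) (M B : Type*)
    [TopologicalSpace M] [ChartedSpace (EuclideanHalfSpace (n + 1)) M]
    [IsManifold (𝓡∂ (n + 1)) ∞ M]
    [TopologicalSpace B] [ChartedSpace (EuclideanSpace ℝ (Fin n)) B]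
    [IsManifold (𝓡 n) ∞ B] where
  /-- the inclusion of the boundary -/
  ι : B → M
  isSmoothEmbedding_ι : IsSmoothEmbedding (𝓡 n) (𝓡∂ (n + 1)) ∞ ι
  range_ι : range ι = (𝓡∂ (n + 1)).boundary M
  /-- a boundary defining function -/
  ρ : M → ℝ
  contMDiff_ρ : ContMDiff (𝓡∂ (n + 1)) 𝓘(ℝ, ℝ) ∞ ρ
  ρ_pos : ∀ p ∈ (𝓡∂ (n + 1)).interior M, 0 < ρ p
  ρ_eq_zero : ∀ x, ρ (ι x) = 0
  mfderiv_ρ_ne_zero : ∀ x, mfderiv (𝓡∂ (n + 1)) 𝓘(ℝ, ℝ) ρ (ι x) ≠ 0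
  /-- the physical metric; only its values on the interior matter -/
  metric : ∀ p : M, TangentSpace (𝓡∂ (n + 1)) p →L[ℝ] TangentSpace (𝓡∂ (n + 1)) p →L[ℝ] ℝ
  contMDiffOn_metric : ContMDiffOn (𝓡∂ (n + 1))
    ((𝓡∂ (n + 1)).prod 𝓘(ℝ, EuclideanSpace ℝ (Fin (n + 1)) →L[ℝ]
      EuclideanSpace ℝ (Fin (n + 1)) →L[ℝ] ℝ)) ∞
    (fun p => Bundle.TotalSpace.mk' (EuclideanSpace ℝ (Fin (n + 1)) →L[ℝ]
      EuclideanSpace ℝ (Fin (n + 1)) →L[ℝ] ℝ)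
      (E := fun p : M =>
        TangentSpace (𝓡∂ (n + 1)) p →L[ℝ] TangentSpace (𝓡∂ (n + 1)) p →L[ℝ] ℝ) p (metric p))
    ((𝓡∂ (n + 1)).interior M)
  isLorentzianForm_metric : ∀ p ∈ (𝓡∂ (n + 1)).interior M, IsLorentzianForm (metric p)
  ν₀ : ℝ
  /-- the metric on the boundary -/
  h : ∀ x : B, TangentSpace (𝓡 n) x →L[ℝ] TangentSpace (𝓡 n) x →L[ℝ] ℝ
  signature : (ν₀ < 0 ∧ ∀ x, IsEuclideanForm (h x)) ∨ (0 < ν₀ ∧ ∀ x, IsLorentzianForm (h x))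

namespace InfinityData

variable {n : ℕ} {M B : Type*}
    [TopologicalSpace M] [ChartedSpace (EuclideanHalfSpace (n + 1)) M]
    [IsManifold (𝓡∂ (n + 1)) ∞ M]
    [TopologicalSpace B] [ChartedSpace (EuclideanSpace ℝ (Fin n)) B]
    [IsManifold (𝓡 n) ∞ B]

/-! #### Coordinates `(ρ, y)` on `M` -/

/-- The coordinate `ρ` of a chart of `M`: its zeroth coordinate. -/
def rhoCoord (e : OpenPartialHomeomorph M (EuclideanHalfSpace (n + 1))) (p : M) : ℝ :=
  (e p).1 0

/-- The coordinates `y` of a chart of `M`: all coordinates but the zeroth one. -/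
def yCoord (e : OpenPartialHomeomorph M (EuclideanHalfSpace (n + 1))) (p : M) :
    EuclideanSpace ℝ (Fin n) :=
  WithLp.toLp 2 fun α => (e p).1 α.succ

/-- The coordinate vector fields `∂₀ = ∂_ρ`, `∂_{α+1} = ∂/∂y^α` of a chart of `M`. -/
def coordVec (e : OpenPartialHomeomorph M (EuclideanHalfSpace (n + 1))) (i : Fin (n + 1)) (p : M) :
    TangentSpace (𝓡∂ (n + 1)) p :=
  (mfderiv (𝓡∂ (n + 1)) 𝓘(ℝ, EuclideanSpace ℝ (Fin (n + 1)))
    (e.extend (𝓡∂ (n + 1))) p).inverse (EuclideanSpace.single i (1 : ℝ))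

variable (S : InfinityData n M B)

/-- The components of the physical metric in a chart. -/
def metricComp (e : OpenPartialHomeomorph M (EuclideanHalfSpace (n + 1))) (i j : Fin (n + 1))
    (p : M) : ℝ :=
  S.metric p (coordVec e i p) (coordVec e j p)

/-- The coordinate vector fields `∂/∂y^α` on the boundary. -/
def bdryCoordVec (e : OpenPartialHomeomorph M (EuclideanHalfSpace (n + 1))) (α : Fin n) (x : B) :
    TangentSpace (𝓡 n) x :=
  (mfderiv (𝓡 n) 𝓘(ℝ, EuclideanSpace ℝ (Fin n)) (fun z => yCoord e (S.ι z)) x).inverse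
    (EuclideanSpace.single α (1 : ℝ))

/-- The range of the coordinates `y` of a chart on the boundary. -/
def bdryTarget (e : OpenPartialHomeomorph M (EuclideanHalfSpace (n + 1))) :
    Set (EuclideanSpace ℝ (Fin n)) :=
  (fun x => yCoord e (S.ι x)) '' (S.ι ⁻¹' e.source)

/-- The 2-jet at the boundary point `x` of `ρ + u ρ²`. -/
def jetRho (x : B) (u : ℝ) : TwoJet n (S.ι x) :=
  Quotient.mk (twoJetSetoid (S.ι x)) ⟨fun p => S.ρ p + u * S.ρ p ^ 2,
    ((S.contMDiff_ρ).add (contMDiff_const.mul (S.contMDiff_ρ.pow 2))) (S.ι x)⟩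

/-- A Beig–Schmidt chart `(ρ, y)`: a smooth chart of the manifold with boundary `M`, whose
coordinate `ρ` agrees with the given boundary defining function up to `O(ρ²)`, and in which
`ρ² ĝ = ρ⁻² ν₀⁻¹ (1 + 2ρσ + ρ²σ² + O(ρ³ log ρ)) dρ²
  + (h_{αβ} + ρ (k_{αβ} - 2σ h_{αβ}) + O(ρ² log ρ)) dy^α dy^β`.
The components along `dρ dy^α` are only required to vanish up to `O(ρ² log ρ)`. -/
structure BeigSchmidtChart where
  toChart : OpenPartialHomeomorph M (EuclideanHalfSpace (n + 1))
  mem_maximalAtlas : toChart ∈ IsManifold.maximalAtlas (𝓡∂ (n + 1)) ∞ M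
  admissible : ∀ x, S.ι x ∈ toChart.source → ∃ u, IsTwoJetOf (S.jetRho x u) (rhoCoord toChart)
  /-- the components of the boundary metric -/
  h : EuclideanSpace ℝ (Fin n) → Matrix (Fin n) (Fin n) ℝ
  k : EuclideanSpace ℝ (Fin n) → Matrix (Fin n) (Fin n) ℝ
  σ : EuclideanSpace ℝ (Fin n) → ℝ
  contDiffOn_h : ∀ α β, ContDiffOn ℝ ∞ (fun y => h y α β) (S.bdryTarget toChart)
  contDiffOn_k : ∀ α β, ContDiffOn ℝ ∞ (fun y => k y α β) (S.bdryTarget toChart)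
  contDiffOn_σ : ContDiffOn ℝ ∞ σ (S.bdryTarget toChart)
  h_eq : ∀ x, S.ι x ∈ toChart.source → ∀ α β, h (yCoord toChart (S.ι x)) α β =
    S.h x (S.bdryCoordVec toChart α x) (S.bdryCoordVec toChart β x)
  expansion_rho_rho : ∀ x, S.ι x ∈ toChart.source →
    (fun p => S.ν₀ * rhoCoord toChart p ^ 4 * S.metricComp toChart 0 0 p
      - (1 + 2 * rhoCoord toChart p * σ (yCoord toChart p)
          + rhoCoord toChart p ^ 2 * σ (yCoord toChart p) ^ 2))
      =O[𝓝[(𝓡∂ (n + 1)).interior M] S.ι x]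
    fun p => rhoCoord toChart p ^ 3 * Real.log (rhoCoord toChart p)
  expansion_rho_y : ∀ x, S.ι x ∈ toChart.source → ∀ α : Fin n,
    (fun p => rhoCoord toChart p ^ 2 * S.metricComp toChart 0 α.succ p)
      =O[𝓝[(𝓡∂ (n + 1)).interior M] S.ι x]
    fun p => rhoCoord toChart p ^ 2 * Real.log (rhoCoord toChart p)
  expansion_y_y : ∀ x, S.ι x ∈ toChart.source → ∀ α β : Fin n,
    (fun p => rhoCoord toChart p ^ 2 * S.metricComp toChart α.succ β.succ p
      - (h (yCoord toChart p) α β + rhoCoord toChart p *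
          (k (yCoord toChart p) α β - 2 * σ (yCoord toChart p) * h (yCoord toChart p) α β)))
      =O[𝓝[(𝓡∂ (n + 1)).interior M] S.ι x]
    fun p => rhoCoord toChart p ^ 2 * Real.log (rhoCoord toChart p)

/-- Asymptotic flatness: every boundary point lies in the domain of a Beig–Schmidt chart. -/
def IsAsymptoticallyFlat : Prop :=
  ∀ x, ∃ E : S.BeigSchmidtChart, S.ι x ∈ E.toChart.source

/-! ### The extended boundary `Ti`/`Spi` -/

/-- `Ti` or `Spi`: pairs of a boundary point `x` and a 2-jet at `x` of the form
`j²ρ + u j²ρ²`, that is, the fibre over `j²ρ mod j²ρ²` of `J²M → J²M / j²ρ²`. -/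
def Spi : Type _ :=
  {q : Σ x : B, TwoJet n (S.ι x) // ∃ u, q.2 = S.jetRho q.1 u}

variable {S}

/-- The projection `Spi → B`. -/
def Spi.base (p : S.Spi) : B := p.1.1

/-- The 2-jet carried by a point of `Spi`. -/
def Spi.jet (p : S.Spi) : TwoJet n (S.ι p.base) := p.1.2

variable (S)

theorem jetRho_injective (x : B) : Function.Injective (S.jetRho x) := by
  intro u v huv
  by_contra hne
  have h1 := Quotient.exact huv
  change (fun p => (S.ρ p + u * S.ρ p ^ 2) - (S.ρ p + v * S.ρ p ^ 2)) =o[𝓝 (S.ι x)]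
    fun p => ‖extChartAt (𝓡∂ (n + 1)) (S.ι x) p
      - extChartAt (𝓡∂ (n + 1)) (S.ι x) (S.ι x)‖ ^ 2 at h1
  have h2 : (fun p => S.ρ p ^ 2) =o[𝓝 (S.ι x)]
      fun p => ‖extChartAt (𝓡∂ (n + 1)) (S.ι x) p
        - extChartAt (𝓡∂ (n + 1)) (S.ι x) (S.ι x)‖ ^ 2 := by
    refine (isLittleO_const_mul_left_iff (sub_ne_zero.2 hne)).1 (h1.congr_left fun p => ?_)
    ring
  have h3 := IsLittleO.of_pow (n := 2) h2 two_ne_zero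
  apply S.mfderiv_ρ_ne_zero x
  have h4 : HasFDerivWithinAt (writtenInExtChartAt (𝓡∂ (n + 1)) 𝓘(ℝ, ℝ) (S.ι x) S.ρ)
      (0 : EuclideanSpace ℝ (Fin (n + 1)) →L[ℝ] ℝ) (range (𝓡∂ (n + 1)))
      (extChartAt (𝓡∂ (n + 1)) (S.ι x) (S.ι x)) := by
    rw [hasFDerivWithinAt_iff_isLittleO]
    have h5 := h3.comp_tendsto (map_extChartAt_symm_nhdsWithin_range
      (I := 𝓡∂ (n + 1)) (S.ι x)).le
    refine (h5.congr' ?_ ?_).of_norm_right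
    · refine Eventually.of_forall fun z => ?_
      change S.ρ _ = S.ρ ((extChartAt (𝓡∂ (n + 1)) (S.ι x)).symm z)
        - S.ρ ((extChartAt (𝓡∂ (n + 1)) (S.ι x)).symm (extChartAt (𝓡∂ (n + 1)) (S.ι x) (S.ι x))) - 0
      rw [extChartAt_to_inv, S.ρ_eq_zero, sub_zero, sub_zero]
    · filter_upwards [extChartAt_target_mem_nhdsWithin (I := 𝓡∂ (n + 1)) (S.ι x)] with z hz
      simp only [Function.comp_apply, (extChartAt (𝓡∂ (n + 1)) (S.ι x)).right_inv hz]
  have h6 : HasMFDerivAt (𝓡∂ (n + 1)) 𝓘(ℝ, ℝ) S.ρ (S.ι x) 0 :=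
    ⟨S.contMDiff_ρ.continuous.continuousAt, h4⟩
  exact h6.mfderiv

/-- The global trivialisation `(u, x)` of `Spi` given by the boundary defining function. -/
def spiEquiv : S.Spi ≃ ℝ × B where
  toFun p := (p.2.choose, p.base)
  invFun q := ⟨⟨q.2, S.jetRho q.2 q.1⟩, q.1, rfl⟩
  left_inv p := by
    apply Subtype.ext
    exact Sigma.ext rfl (heq_of_eq p.2.choose_spec.symm)
  right_inv q := by
    refine Prod.ext ?_ rfl
    exact (S.jetRho_injective q.2 (Exists.choose_spec (p := fun u => S.jetRho q.2 q.1 =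
      S.jetRho q.2 u) ⟨q.1, rfl⟩)).symm

instance : TopologicalSpace S.Spi := TopologicalSpace.induced S.spiEquiv inferInstance

/-- The trivialisation as a homeomorphism. -/
def spiHomeomorph : S.Spi ≃ₜ ℝ × B :=
  S.spiEquiv.toHomeomorphOfIsInducing ⟨rfl⟩

/-- `Spi` carries the smooth structure of `ℝ × B`. -/
instance : ChartedSpace (ℝ × EuclideanSpace ℝ (Fin n)) S.Spi where
  atlas := {c | ∃ φ ∈ atlas (EuclideanSpace ℝ (Fin n)) B, c =
    S.spiHomeomorph.toOpenPartialHomeomorph.trans ((OpenPartialHomeomorph.refl ℝ).prod φ)}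
  chartAt p := S.spiHomeomorph.toOpenPartialHomeomorph.trans
    ((OpenPartialHomeomorph.refl ℝ).prod (chartAt (EuclideanSpace ℝ (Fin n)) p.base))
  mem_chart_source p := by
    simp only [mfld_simps]
    exact mem_chart_source (EuclideanSpace ℝ (Fin n)) p.base
  chart_mem_atlas p := ⟨_, chart_mem_atlas _ _, rfl⟩

instance : IsManifold 𝓘(ℝ, ℝ × EuclideanSpace ℝ (Fin n)) ∞ S.Spi := by
  apply isManifold_of_contDiffOn
  rintro _ _ ⟨φ, hφ, rfl⟩ ⟨ψ, hψ, rfl⟩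
  have h := (contDiffGroupoid ∞ (𝓡 n)).compatible hφ hψ
  rw [contDiffGroupoid, mem_groupoid_of_pregroupoid] at h
  have h1 : ContDiffOn ℝ ∞ (φ.symm.trans ψ) (φ.symm.trans ψ).source := by
    simpa [contDiffPregroupoid] using h.1
  have h2 : ContDiffOn ℝ ∞ (fun q : ℝ × EuclideanSpace ℝ (Fin n) => (q.1, (φ.symm.trans ψ) q.2))
      (univ ×ˢ (φ.symm.trans ψ).source) :=
    contDiff_fst.contDiffOn.prodMk (h1.comp contDiff_snd.contDiffOn fun q hq => hq.2)
  refine (h2.congr ?_).mono ?_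
  · rintro q -
    simp
  · rintro q hq
    simpa using hq

/-- The `ℝ`-action `j ↦ j + t j²ρ²` on `Spi`. -/
def spiShift (t : ℝ) (p : S.Spi) : S.Spi :=
  S.spiEquiv.symm ((S.spiEquiv p).1 + t, p.base)

/-- The vector field `n` on `Spi` generating the `ℝ`-action: the velocity at `t = 0` of
`t ↦ spiShift t p`, which is at `p` for `t = 0`. -/
def spiN (p : S.Spi) : TangentSpace 𝓘(ℝ, ℝ × EuclideanSpace ℝ (Fin n)) p :=
  (mfderiv 𝓘(ℝ, ℝ) 𝓘(ℝ, ℝ × EuclideanSpace ℝ (Fin n)) (fun t : ℝ => S.spiShift t p) 0 :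
    ℝ →L[ℝ] ℝ × EuclideanSpace ℝ (Fin n)) 1

/-- The degenerate metric on `Spi`: the pullback of `h` along the projection. -/
def spiH (p : S.Spi) (v w : TangentSpace 𝓘(ℝ, ℝ × EuclideanSpace ℝ (Fin n)) p) : ℝ :=
  S.h p.base (mfderiv 𝓘(ℝ, ℝ × EuclideanSpace ℝ (Fin n)) (𝓡 n) Spi.base p v)
    (mfderiv 𝓘(ℝ, ℝ × EuclideanSpace ℝ (Fin n)) (𝓡 n) Spi.base p w)

/-! ### Carrollian connections -/

/-- Affine connections on `Spi`. -/
abbrev SpiConnection : Type _ :=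
  CovariantDerivative 𝓘(ℝ, ℝ × EuclideanSpace ℝ (Fin n)) (ℝ × EuclideanSpace ℝ (Fin n))
    (TangentSpace 𝓘(ℝ, ℝ × EuclideanSpace ℝ (Fin n)) : S.Spi → Type _)

/-- The vector field `Y` on `Spi` is differentiable at `p`. -/
def VecDiffAt (Y : ∀ q : S.Spi, TangentSpace 𝓘(ℝ, ℝ × EuclideanSpace ℝ (Fin n)) q)
    (p : S.Spi) : Prop :=
  MDifferentiableAt 𝓘(ℝ, ℝ × EuclideanSpace ℝ (Fin n))
    𝓘(ℝ, ℝ × EuclideanSpace ℝ (Fin n)).tangent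
    (fun q => (⟨q, Y q⟩ : TangentBundle 𝓘(ℝ, ℝ × EuclideanSpace ℝ (Fin n)) S.Spi)) p

/-- A Carrollian connection on `Spi`: a smooth torsion-free connection with `∇h = 0` and
`∇n = 0`. -/
structure IsCarrollian (D : S.SpiConnection) : Prop where
  smooth : CovariantDerivative.ContMDiffCovariantDerivative D ∞
  torsion_eq_zero : D.torsion = 0
  /-- `X(h(Y, Z)) = h(∇_X Y, Z) + h(Y, ∇_X Z)` -/
  metric : ∀ (p : S.Spi) (X : TangentSpace 𝓘(ℝ, ℝ × EuclideanSpace ℝ (Fin n)) p)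
    (Y Z : ∀ q : S.Spi, TangentSpace 𝓘(ℝ, ℝ × EuclideanSpace ℝ (Fin n)) q),
    S.VecDiffAt Y p → S.VecDiffAt Z p →
    mvfderiv 𝓘(ℝ, ℝ × EuclideanSpace ℝ (Fin n)) (fun q => S.spiH q (Y q) (Z q)) p X =
      S.spiH p (D Y p X) (Z p) + S.spiH p (Y p) (D Z p X)
  vectorField : ∀ p, D S.spiN p = 0

variable {S} in
/-- The connection `D` has the connection coefficients `Γ` in the chart `c` of `Spi`: in this chart
`(∇_X Y)^a = X(Y^a) + Γ^a_{cb} X^c Y^b`. -/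
def HasCoefficients (D : S.SpiConnection)
    (c : OpenPartialHomeomorph S.Spi (ℝ × EuclideanSpace ℝ (Fin n)))
    (Γ : ℝ × EuclideanSpace ℝ (Fin n) → ℝ × EuclideanSpace ℝ (Fin n) →
      ℝ × EuclideanSpace ℝ (Fin n) → ℝ × EuclideanSpace ℝ (Fin n)) : Prop :=
  ∀ p ∈ c.source, ∀ (X : TangentSpace 𝓘(ℝ, ℝ × EuclideanSpace ℝ (Fin n)) p)
    (Y : ∀ q : S.Spi, TangentSpace 𝓘(ℝ, ℝ × EuclideanSpace ℝ (Fin n)) q), S.VecDiffAt Y p →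
    mvfderiv 𝓘(ℝ, ℝ × EuclideanSpace ℝ (Fin n)) c p (D Y p X) =
      mvfderiv 𝓘(ℝ, ℝ × EuclideanSpace ℝ (Fin n))
          (fun q => mvfderiv 𝓘(ℝ, ℝ × EuclideanSpace ℝ (Fin n)) c q (Y q)) p X
        + Γ (c p) (mvfderiv 𝓘(ℝ, ℝ × EuclideanSpace ℝ (Fin n)) c p X)
            (mvfderiv 𝓘(ℝ, ℝ × EuclideanSpace ℝ (Fin n)) c p (Y p))

/-- `Γ^α_{γβ} = ½ h^{αδ} (∂_γ h_{δβ} + ∂_β h_{δγ} - ∂_δ h_{γβ})` -/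
def christoffel (h : EuclideanSpace ℝ (Fin n) → Matrix (Fin n) (Fin n) ℝ)
    (y : EuclideanSpace ℝ (Fin n)) (α γ β : Fin n) : ℝ :=
  (1 / 2) * ∑ δ, (h y)⁻¹ α δ *
    (fderiv ℝ (fun z => h z δ β) y (EuclideanSpace.single γ 1)
      + fderiv ℝ (fun z => h z δ γ) y (EuclideanSpace.single β 1)
      - fderiv ℝ (fun z => h z γ β) y (EuclideanSpace.single δ 1))

/-- The coefficients of the general Carrollian connection in coordinates `(u, y)`: the only nonzero
ones are `Γ^u_{γβ} = -½ C_{γβ}(u, y)` and the Christoffel symbols `Γ^α_{γβ}(y)` of `h`. -/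
def carrollCoefficients (h : EuclideanSpace ℝ (Fin n) → Matrix (Fin n) (Fin n) ℝ)
    (C : ℝ → EuclideanSpace ℝ (Fin n) → Matrix (Fin n) (Fin n) ℝ)
    (a X Y : ℝ × EuclideanSpace ℝ (Fin n)) : ℝ × EuclideanSpace ℝ (Fin n) :=
  (∑ γ, ∑ β, -(1 / 2) * C a.1 a.2 γ β * X.2 γ * Y.2 β,
    WithLp.toLp 2 fun α => ∑ γ, ∑ β, christoffel h a.2 α γ β * X.2 γ * Y.2 β)

variable {S}

/-- The tensor `C` with `-½ C_{αβ} = ν₀ (½ k_{αβ} + u h_{αβ})`. -/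
def BeigSchmidtChart.C (E : S.BeigSchmidtChart) (u : ℝ) (y : EuclideanSpace ℝ (Fin n)) :
    Matrix (Fin n) (Fin n) ℝ :=
  (-2 * S.ν₀) • ((1 / 2 : ℝ) • E.k y + u • E.h y)

/-- The chart `c = (u, y)` of `Spi` and the Beig–Schmidt chart `E = (ρ, y)` are associated: they
have the same coordinates `y` on the boundary, and the point of `Spi` over `x` with fibre
coordinate `u` is the 2-jet at `x` of `ρ + u ρ²`; in particular the section `u = 0` is `j²ρ`. -/
structure IsAssociated (c : OpenPartialHomeomorph S.Spi (ℝ × EuclideanSpace ℝ (Fin n)))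
    (E : S.BeigSchmidtChart) : Prop where
  mem_maximalAtlas : c ∈ IsManifold.maximalAtlas 𝓘(ℝ, ℝ × EuclideanSpace ℝ (Fin n)) ∞ S.Spi
  mem_source : ∀ p ∈ c.source, S.ι p.base ∈ E.toChart.source
  y_eq : ∀ p ∈ c.source, (c p).2 = yCoord E.toChart (S.ι p.base)
  jet_eq : ∀ p ∈ c.source, IsTwoJetOf p.jet
    fun z => rhoCoord E.toChart z + (c p).1 * rhoCoord E.toChart z ^ 2

end InfinityData

end

open Set Filter Topology Manifold Asymptotics
open scoped ContDiff

noncomputable section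

set_option linter.unusedSectionVars false

/-! ### Calculus up to the boundary of a half-space -/

section HalfSpaceCalculus

variable {E F : Type*} [NormedAddCommGroup E] [NormedSpace ℝ E]
  [NormedAddCommGroup F] [NormedSpace ℝ F]

/-! Let `(ρ, y)` and `(ρ', y')` be two Beig–Schmidt charts around the same boundary point.
Smoothness and the condition on 2-jets give `ρ' = ρ + κ(y) ρ² + o(ρ²)` and `y' = Y(y) + ρ η(y) +
o(ρ)`, and the associated coordinates of Ti/Spi are related by `u' = u - κ(y)`, `y' = Y(y)`. The
stated coefficients come from one connection exactly when they obey the inhomogeneous transformation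
law under this map. Its `y`-part is the usual law for the Christoffel symbols of `h`. Its `u`-part
asks for `ν₀(½k' + u'h') = ν₀(½k + uh) + ∇dκ`, with `∇` the Levi-Civita connection of `h`, that is,
`k' = k + 2κh + 2ν₀⁻¹∇dκ` after pulling back by `Y`.

This law for `k` is read off from the metric: its components in the first chart are expressed
through those in the second along a line `y = const`, and the limit `ρ → 0` is taken. The `ρρ`
component gives `σ' = σ` (`σ_eq`). The mixed components, which vanish to the relevant order in both
charts, force `η` to be the gradient of `-ν₀⁻¹κ` (`hForm_bdryShear`). The first order of the
tangential components gives `k - 2σh = -2κh + k' - 2σ'h' + L_η h'`, and the Lie derivative along a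
gradient is a Hessian, `L_η h' = -2ν₀⁻¹∇dκ` (`lieDerivative_gradient`). Together these give
`kForm_transform`, hence `compatible_connForm`. The logarithmic remainders are `o(ρ)` and do not
enter.

The covariant derivatives of the charts therefore glue (`ChartConnection.Atlas.connection`). Torsion
vanishes because the coefficients are symmetric. The metric is parallel because the base
coefficients are those of Levi-Civita. The field `n = ∂_u` is parallel because no coefficient has a
lower index `u`. Uniqueness holds because every point of Ti/Spi lies in an associated chart
(`isAssociated_spiChart`), where the coefficients determine the covariant derivative. -/

/-- The half-space `{(t, y) | 0 ≤ t}`. -/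
def halfProd (E : Type*) : Set (ℝ × E) := Ici 0 ×ˢ univ

/-- The derivative of `f` in the direction `v` within the half-space. -/
def halfDeriv (v : ℝ × E) (f : ℝ × E → F) (z : ℝ × E) : F :=
  fderivWithin ℝ f (halfProd E) z v

theorem mem_halfProd {z : ℝ × E} : z ∈ halfProd E ↔ 0 ≤ z.1 := by simp [halfProd]

theorem convex_halfProd : Convex ℝ (halfProd E) := (convex_Ici 0).prod convex_univ

theorem interior_halfProd : interior (halfProd E) = Ioi 0 ×ˢ univ := by
  rw [halfProd, interior_prod_eq, interior_Ici, interior_univ]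

theorem uniqueDiffOn_halfProd : UniqueDiffOn ℝ (halfProd E) :=
  uniqueDiffOn_convex convex_halfProd
    (by rw [interior_halfProd]; exact ⟨(1, 0), by simp⟩)

theorem mem_closure_interior_halfProd {z : ℝ × E} (hz : z ∈ halfProd E) :
    z ∈ closure (interior (halfProd E)) := by
  rw [interior_halfProd, closure_prod_eq, closure_Ioi, closure_univ]
  exact hz

variable {f g : ℝ × E → F} {U : Set (ℝ × E)} {z v w : ℝ × E}

theorem fderivWithin_inter_halfProd (hU : IsOpen U) (hz : z ∈ U) :
    fderivWithin ℝ f (halfProd E ∩ U) z = fderivWithin ℝ f (halfProd E) z :=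
  fderivWithin_inter (hU.mem_nhds hz)

theorem ContDiffOn.halfDeriv (hU : IsOpen U) (hf : ContDiffOn ℝ ∞ f (halfProd E ∩ U))
    (v : ℝ × E) : ContDiffOn ℝ ∞ (halfDeriv v f) (halfProd E ∩ U) := by
  have h := (hf.fderivWithin (uniqueDiffOn_halfProd.inter hU) (m := ∞) (by simp)).clm_apply
    (contDiffOn_const (c := v))
  refine h.congr fun z hz => ?_
  rw [fderivWithin_inter_halfProd hU hz.2]
  rfl

theorem hasFDerivWithinAt_halfProd (hU : IsOpen U) (hf : ContDiffOn ℝ ∞ f (halfProd E ∩ U))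
    (hz : z ∈ halfProd E ∩ U) :
    HasFDerivWithinAt f (fderivWithin ℝ f (halfProd E) z) (halfProd E) z := by
  have h := (hf.differentiableOn (by simp) z hz).hasFDerivWithinAt
  rw [fderivWithin_inter_halfProd hU hz.2] at h
  exact (hasFDerivWithinAt_inter (hU.mem_nhds hz.2)).1 h

theorem halfDeriv_congr (hU : IsOpen U) (hfg : EqOn f g (halfProd E ∩ U))
    (hz : z ∈ halfProd E ∩ U) (v : ℝ × E) : halfDeriv v f z = halfDeriv v g z := by
  rw [halfDeriv, halfDeriv, ← fderivWithin_inter_halfProd hU hz.2,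
    ← fderivWithin_inter_halfProd hU hz.2, fderivWithin_congr hfg (hfg hz)]

/-- Symmetry of the second derivative persists on the boundary, since every point of the half-space
is a limit of interior points. -/
theorem halfDeriv_comm (hU : IsOpen U) (hf : ContDiffOn ℝ ∞ f (halfProd E ∩ U))
    (hz : z ∈ halfProd E ∩ U) (v w : ℝ × E) :
    halfDeriv v (halfDeriv w f) z = halfDeriv w (halfDeriv v f) z := by
  have h1 : ContDiffWithinAt ℝ ∞ f (halfProd E) z :=
    (contDiffWithinAt_inter (hU.mem_nhds hz.2)).1 (hf z hz)
  have h2 := h1.isSymmSndFDerivWithinAt (by simpa using! (WithTop.coe_le_coe.2 (le_top : (2 : ℕ∞) ≤ ⊤)))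
    uniqueDiffOn_halfProd (mem_closure_interior_halfProd hz.1) hz.1
  have h3 : DifferentiableWithinAt ℝ (fderivWithin ℝ f (halfProd E)) (halfProd E) z :=
    (h1.fderivWithin_right (m := 1) uniqueDiffOn_halfProd
      (WithTop.coe_le_coe.2 (le_top : (2 : ℕ∞) ≤ ⊤)) hz.1).differentiableWithinAt (by simp)
  have h4 : ∀ v w, halfDeriv v (halfDeriv w f) z
      = fderivWithin ℝ (fderivWithin ℝ f (halfProd E)) (halfProd E) z v w := by
    intro v w
    have := (h3.hasFDerivWithinAt.clm_apply (hasFDerivWithinAt_const w z _)).fderivWithin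
      (uniqueDiffOn_halfProd z hz.1)
    rw [halfDeriv]
    change (fderivWithin ℝ (fun z => fderivWithin ℝ f (halfProd E) z w) (halfProd E) z) v = _
    rw [this]
    simp
  rw [h4, h4, h2.eq]

theorem hasDerivWithinAt_halfDeriv (hU : IsOpen U) (hf : ContDiffOn ℝ ∞ f (halfProd E ∩ U))
    {t : ℝ} {y : E} (ht : 0 ≤ t) (hz : (t, y) ∈ U) :
    HasDerivWithinAt (fun s => f (s, y)) (halfDeriv (1, 0) f (t, y)) (Ici 0) t := by
  have h1 := hasFDerivWithinAt_halfProd hU hf (z := (t, y)) ⟨mem_halfProd.2 ht, hz⟩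
  have h2 : HasDerivWithinAt (fun s : ℝ => (s, y)) ((1 : ℝ), (0 : E)) (Ici 0) t :=
    (hasDerivWithinAt_id t _).prodMk (hasDerivWithinAt_const _ _ _)
  exact h1.comp_hasDerivWithinAt t h2 (fun s hs => mem_halfProd.2 hs)

/-- A derivative within the half-space restricts to an unrestricted derivative on the slice `t = 0`,
because that slice is a full vector space inside the half-space. -/
theorem hasFDerivAt_boundarySlice (hU : IsOpen U) (hf : ContDiffOn ℝ ∞ f (halfProd E ∩ U))
    {y : E} (hz : ((0 : ℝ), y) ∈ U) :
    HasFDerivAt (fun y => f (0, y))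
      ((fderivWithin ℝ f (halfProd E) (0, y)).comp (ContinuousLinearMap.inr ℝ ℝ E)) y := by
  have h1 := hasFDerivWithinAt_halfProd hU hf (z := (0, y)) ⟨mem_halfProd.2 le_rfl, hz⟩
  have h2 : HasFDerivAt (fun y : E => ((0 : ℝ), y)) (ContinuousLinearMap.inr ℝ ℝ E) y :=
    (ContinuousLinearMap.inr ℝ ℝ E).hasFDerivAt
  rw [← hasFDerivWithinAt_univ] at h2 ⊢
  exact h1.comp y h2 (fun s _ => mem_halfProd.2 le_rfl)

theorem fderiv_boundarySlice (hU : IsOpen U) (hf : ContDiffOn ℝ ∞ f (halfProd E ∩ U))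
    {y : E} (hz : ((0 : ℝ), y) ∈ U) (v : E) :
    fderiv ℝ (fun y => f (0, y)) y v = halfDeriv (0, v) f (0, y) := by
  rw [(hasFDerivAt_boundarySlice hU hf hz).fderiv]
  rfl

theorem contDiffOn_boundarySlice (hf : ContDiffOn ℝ ∞ f (halfProd E ∩ U)) :
    ContDiffOn ℝ ∞ (fun y => f (0, y)) {y | ((0 : ℝ), y) ∈ U} :=
  hf.comp (contDiff_prodMk_right (0 : ℝ)).contDiffOn
    (fun _ hy => ⟨mem_halfProd.2 le_rfl, hy⟩)

theorem isOpen_boundarySlice (hU : IsOpen U) : IsOpen {y : E | ((0 : ℝ), y) ∈ U} :=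
  hU.preimage (by fun_prop)

theorem eventually_mem_of_boundarySlice (hU : IsOpen U) {y : E} (hz : ((0 : ℝ), y) ∈ U) :
    ∀ᶠ t in 𝓝 (0 : ℝ), (t, y) ∈ U :=
  (Continuous.prodMk_left y).continuousAt.preimage_mem_nhds (hU.mem_nhds hz)

theorem continuousWithinAt_slice (hU : IsOpen U) (hf : ContDiffOn ℝ ∞ f (halfProd E ∩ U))
    {y : E} (hz : ((0 : ℝ), y) ∈ U) :
    ContinuousWithinAt (fun s => f (s, y)) (Ioi 0) 0 :=
  (hasDerivWithinAt_halfDeriv hU hf le_rfl hz).continuousWithinAt.mono Ioi_subset_Ici_self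

end HalfSpaceCalculus

/-- Second order Taylor expansion at an end point. -/
theorem tendsto_div_sq_of_hasDerivAt {f g : ℝ → ℝ} {c : ℝ}
    (hf : ∀ᶠ t in 𝓝[>] (0 : ℝ), HasDerivAt f (g t) t) (hf0 : Tendsto f (𝓝[>] 0) (𝓝 0))
    (hg0 : g 0 = 0) (hg : HasDerivWithinAt g c (Ioi 0) 0) :
    Tendsto (fun t => f t / t ^ 2) (𝓝[>] 0) (𝓝 (c / 2)) := by
  -- L'Hôpital once: `f / t²` is compared with `g / (2t)`, and the limit of `g / t` is the one-sided
  -- derivative of `g` at `0`.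
  refine HasDerivAt.lhopital_zero_nhdsGT (f' := g) (g' := fun t => 2 * t) hf
    (Eventually.of_forall fun t => by simpa using hasDerivAt_pow 2 t) ?_ hf0 ?_ ?_
  · filter_upwards [self_mem_nhdsWithin] with t ht
    exact mul_ne_zero two_ne_zero (ne_of_gt ht)
  · exact (Continuous.tendsto' (by fun_prop) 0 0 (by simp)).mono_left nhdsWithin_le_nhds
  · rw [hasDerivWithinAt_iff_tendsto_slope' self_notMem_Ioi] at hg
    refine (hg.div_const 2).congr fun t => ?_
    rw [slope_def_field, hg0]
    simp only [sub_zero]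
    rw [div_div, mul_comm]

/-! ### Transverse Taylor coefficients of a boundary defining function. -/

section DefiningFunction

variable {E : Type*} [NormedAddCommGroup E] [NormedSpace ℝ E]

section Taylor

variable {U : Set (ℝ × E)} {f : ℝ × E → ℝ}

theorem tendsto_slice_taylor (hU : IsOpen U) (hf : ContDiffOn ℝ ∞ f (halfProd E ∩ U)) {y : E}
    (hy : ((0 : ℝ), y) ∈ U) (h0 : f (0, y) = 0) :
    Tendsto (fun t => (f (t, y) - t * halfDeriv (1, 0) f (0, y)) / t ^ 2) (𝓝[>] 0)
      (𝓝 (halfDeriv (1, 0) (halfDeriv (1, 0) f) (0, y) / 2)) := by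
  have hD := hf.halfDeriv hU (1, 0)
  refine tendsto_div_sq_of_hasDerivAt
    (g := fun t => halfDeriv (1, 0) f (t, y) - halfDeriv (1, 0) f (0, y)) ?_ ?_ (by simp) ?_
  · filter_upwards [self_mem_nhdsWithin, nhdsWithin_le_nhds (eventually_mem_of_boundarySlice hU hy)]
      with t ht hz
    have h1 := (hasDerivWithinAt_halfDeriv hU hf (le_of_lt ht) hz).hasDerivAt (Ici_mem_nhds ht)
    have h2 := (hasDerivAt_id t).mul_const (halfDeriv (1, 0) f (0, y))
    rw [one_mul] at h2
    exact h1.sub h2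
  · have h1 := (continuousWithinAt_slice hU hf hy).tendsto.sub
      ((continuous_id.mul_const (halfDeriv (1, 0) f (0, y))).continuousWithinAt (s := Ioi 0)
        (x := (0 : ℝ))).tendsto
    simpa [h0] using h1
  · exact ((hasDerivWithinAt_halfDeriv hU hD le_rfl hy).mono Ioi_subset_Ici_self).sub_const _

variable {κ : E → ℝ}

theorem tendsto_slice_div (hU : IsOpen U) (hf : ContDiffOn ℝ ∞ f (halfProd E ∩ U)) {y : E}
    (hy : ((0 : ℝ), y) ∈ U) (h0 : f (0, y) = 0) :
    Tendsto (fun t => f (t, y) / t) (𝓝[>] 0) (𝓝 (halfDeriv (1, 0) f (0, y))) := by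
  have h := (hasDerivWithinAt_halfDeriv hU hf le_rfl hy).mono Ioi_subset_Ici_self
  rw [hasDerivWithinAt_iff_tendsto_slope' self_notMem_Ioi] at h
  refine h.congr fun t => ?_
  rw [slope_def_field, h0, sub_zero, sub_zero]

/-- The hypothesis on `κ` is a pointwise limit on each line separately; uniqueness of limits
identifies it with Taylor coefficients of the smooth function `f`, the first of which is computed
here. -/
theorem halfDeriv_eq_one (hU : IsOpen U) (hf : ContDiffOn ℝ ∞ f (halfProd E ∩ U))
    (h0 : ∀ y, ((0 : ℝ), y) ∈ U → f (0, y) = 0)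
    (hκ : ∀ y, ((0 : ℝ), y) ∈ U →
      Tendsto (fun t => (f (t, y) - t) / t ^ 2) (𝓝[>] 0) (𝓝 (κ y)))
    {y : E} (hy : ((0 : ℝ), y) ∈ U) : halfDeriv (1, 0) f (0, y) = 1 := by
  have h1 := tendsto_slice_div hU hf hy (h0 y hy)
  have h2 : Tendsto (fun t : ℝ => (f (t, y) - t) / t ^ 2 * t + 1) (𝓝[>] 0) (𝓝 (κ y * 0 + 1)) :=
    ((hκ y hy).mul (tendsto_id.mono_left nhdsWithin_le_nhds)).add_const 1
  rw [mul_zero, zero_add] at h2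
  refine tendsto_nhds_unique h1 (h2.congr' ?_)
  filter_upwards [self_mem_nhdsWithin] with t ht
  have : t ≠ 0 := ne_of_gt ht
  field_simp
  ring

theorem halfDeriv_halfDeriv_eq (hU : IsOpen U) (hf : ContDiffOn ℝ ∞ f (halfProd E ∩ U))
    (h0 : ∀ y, ((0 : ℝ), y) ∈ U → f (0, y) = 0)
    (hκ : ∀ y, ((0 : ℝ), y) ∈ U →
      Tendsto (fun t => (f (t, y) - t) / t ^ 2) (𝓝[>] 0) (𝓝 (κ y)))
    {y : E} (hy : ((0 : ℝ), y) ∈ U) :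
    halfDeriv (1, 0) (halfDeriv (1, 0) f) (0, y) = 2 * κ y := by
  have h1 := tendsto_slice_taylor hU hf hy (h0 y hy)
  rw [halfDeriv_eq_one hU hf h0 hκ hy] at h1
  simp only [mul_one] at h1
  have := tendsto_nhds_unique h1 (hκ y hy)
  linarith

/-- Since `κ` is half the second transverse derivative of `f` on the boundary, smoothness in `y`
follows from the smoothness of `f`, although `κ` is only given by pointwise limits. This is the
source of smoothness for the fibre coordinate of jets. -/
theorem contDiffOn_secondCoefficient (hU : IsOpen U) (hf : ContDiffOn ℝ ∞ f (halfProd E ∩ U))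
    (h0 : ∀ y, ((0 : ℝ), y) ∈ U → f (0, y) = 0)
    (hκ : ∀ y, ((0 : ℝ), y) ∈ U →
      Tendsto (fun t => (f (t, y) - t) / t ^ 2) (𝓝[>] 0) (𝓝 (κ y)))
    : ContDiffOn ℝ ∞ κ {y : E | ((0 : ℝ), y) ∈ U} := by
  have h := contDiffOn_boundarySlice ((hf.halfDeriv hU (1, 0)).halfDeriv hU (1, 0))
  refine (h.const_smul (1 / 2 : ℝ)).congr fun y hy => ?_
  simp only [halfDeriv_halfDeriv_eq hU hf h0 hκ hy, smul_eq_mul]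
  ring

/-- The Taylor coefficients of `∂_v f` at `t = 0` are the derivatives along `v` of those of `f`,
namely of `0`, `1` and `κ`, by commuting derivatives. Only the quadratic one survives. -/
theorem tendsto_halfDeriv_tangential_div_sq (hU : IsOpen U) (hf : ContDiffOn ℝ ∞ f (halfProd E ∩ U))
    (h0 : ∀ y, ((0 : ℝ), y) ∈ U → f (0, y) = 0)
    (hκ : ∀ y, ((0 : ℝ), y) ∈ U →
      Tendsto (fun t => (f (t, y) - t) / t ^ 2) (𝓝[>] 0) (𝓝 (κ y)))
    {y : E} (hy : ((0 : ℝ), y) ∈ U) (v : E) :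
    Tendsto (fun t => halfDeriv (0, v) f (t, y) / t ^ 2) (𝓝[>] 0) (𝓝 (fderiv ℝ κ y v)) := by
  have hV := isOpen_boundarySlice hU
  have hz : ((0 : ℝ), y) ∈ halfProd E ∩ U := ⟨mem_halfProd.2 le_rfl, hy⟩
  have hD := hf.halfDeriv hU (1, 0)
  have e1 : halfDeriv (0, v) f (0, y) = 0 := by
    rw [← fderiv_boundarySlice hU hf hy]
    have : (fun y => f (0, y)) =ᶠ[𝓝 y] fun _ => 0 := by
      filter_upwards [hV.mem_nhds hy] with y' hy' using h0 y' hy'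
    rw [this.fderiv_eq]; simp
  have e2 : halfDeriv (1, 0) (halfDeriv (0, v) f) (0, y) = 0 := by
    rw [halfDeriv_comm hU hf hz, ← fderiv_boundarySlice hU hD hy]
    have : (fun y => halfDeriv (1, 0) f (0, y)) =ᶠ[𝓝 y] fun _ => 1 := by
      filter_upwards [hV.mem_nhds hy] with y' hy' using halfDeriv_eq_one hU hf h0 hκ hy'
    rw [this.fderiv_eq]; simp
  have e3 : halfDeriv (1, 0) (halfDeriv (1, 0) (halfDeriv (0, v) f)) (0, y)
      = 2 * fderiv ℝ κ y v := by
    rw [halfDeriv_congr hU (fun z hz => halfDeriv_comm hU hf hz (1, 0) (0, v)) hz,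
      halfDeriv_comm hU hD hz, ← fderiv_boundarySlice hU (hD.halfDeriv hU _) hy]
    have : (fun y => halfDeriv (1, 0) (halfDeriv (1, 0) f) (0, y)) =ᶠ[𝓝 y] fun y => 2 * κ y := by
      filter_upwards [hV.mem_nhds hy] with y' hy' using halfDeriv_halfDeriv_eq hU hf h0 hκ hy'
    rw [this.fderiv_eq, fderiv_const_mul]
    · simp
    · exact ((contDiffOn_secondCoefficient hU hf h0 hκ).contDiffAt (hV.mem_nhds hy)).differentiableAt
        (by simp)
  have h := tendsto_slice_taylor hU (hf.halfDeriv hU (0, v)) hy e1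
  rw [e2, e3] at h
  simpa using h

end Taylor

end DefiningFunction

/-! ### First order expansions at the left end point of an interval -/

section RightExpansion

variable {F G : Type*} [NormedAddCommGroup F] [NormedSpace ℝ F]
  [NormedAddCommGroup G] [NormedSpace ℝ G]

/-- `f t = a + t b + o(t)` as `t → 0⁺`. -/
def HasRightExpansion (f : ℝ → F) (a b : F) : Prop :=
  Tendsto (fun t : ℝ => t⁻¹ • (f t - a)) (𝓝[>] 0) (𝓝 b)

theorem tendsto_id_nhdsGT_zero : Tendsto (fun t : ℝ => t) (𝓝[>] 0) (𝓝 0) :=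
  tendsto_id.mono_left nhdsWithin_le_nhds

theorem Filter.Tendsto.clm_apply {α : Type*} {l : Filter α} {f : α → F →L[ℝ] G} {g : α → F}
    {a : F →L[ℝ] G} {c : F} (hf : Tendsto f l (𝓝 a)) (hg : Tendsto g l (𝓝 c)) :
    Tendsto (fun x => f x (g x)) l (𝓝 (a c)) :=
  (isBoundedBilinearMap_apply.continuous.tendsto (a, c)).comp (hf.prodMk_nhds hg)

theorem HasDerivWithinAt.hasRightExpansion {f : ℝ → F} {b : F}
    (h : HasDerivWithinAt f b (Ioi 0) 0) : HasRightExpansion f (f 0) b := by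
  rw [hasDerivWithinAt_iff_tendsto_slope' self_notMem_Ioi] at h
  refine h.congr fun t => ?_
  rw [slope_def_module, sub_zero]

namespace HasRightExpansion

variable {f g : ℝ → F} {a b c d : F}

theorem congr' (h : HasRightExpansion f a b) (hfg : f =ᶠ[𝓝[>] 0] g) : HasRightExpansion g a b :=
  Tendsto.congr' (hfg.mono fun t ht => by rw [ht]) h

theorem tendsto (h : HasRightExpansion f a b) : Tendsto f (𝓝[>] 0) (𝓝 a) := by
  have h1 := (tendsto_id_nhdsGT_zero.smul h).add_const a
  rw [zero_smul, zero_add] at h1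
  refine h1.congr' ?_
  filter_upwards [self_mem_nhdsWithin] with t ht
  rw [smul_inv_smul₀ (ne_of_gt ht), sub_add_cancel]

theorem unique (h : HasRightExpansion f a b) (h' : HasRightExpansion f a c) : b = c :=
  tendsto_nhds_unique h h'

theorem const (a : F) : HasRightExpansion (fun _ => a) a 0 := by
  simp [HasRightExpansion]

theorem add (h : HasRightExpansion f a b) (h' : HasRightExpansion g c d) :
    HasRightExpansion (fun t => f t + g t) (a + c) (b + d) :=
  Tendsto.congr (fun t => by rw [← smul_add, add_sub_add_comm]) (Tendsto.add h h')

theorem clm_apply {f : ℝ → F →L[ℝ] G} {g : ℝ → F} {a b : F →L[ℝ] G} {c d : F}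
    (h : HasRightExpansion f a b) (h' : HasRightExpansion g c d) :
    HasRightExpansion (fun t => f t (g t)) (a c) (b c + a d) := by
  have h1 : Tendsto (fun t : ℝ => (t⁻¹ • (f t - a)) (g t) + a (t⁻¹ • (g t - c))) (𝓝[>] 0)
      (𝓝 (b c + a d)) :=
    (Tendsto.clm_apply h h'.tendsto).add ((a.continuous.tendsto _).comp h')
  refine h1.congr fun t => ?_
  simp only [smul_apply, sub_apply, map_smul, map_sub,
    ← smul_add]
  congr 1
  abel

theorem mul {f g : ℝ → ℝ} {a b c d : ℝ} (h : HasRightExpansion f a b)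
    (h' : HasRightExpansion g c d) :
    HasRightExpansion (fun t => f t * g t) (a * c) (b * c + a * d) := by
  have h1 : Tendsto (fun t : ℝ => (t⁻¹ • (f t - a)) * (g t) + a * (t⁻¹ • (g t - c))) (𝓝[>] 0)
      (𝓝 (b * c + a * d)) :=
    (Tendsto.mul h h'.tendsto).add (Tendsto.const_mul a h')
  refine h1.congr fun t => ?_
  simp only [smul_eq_mul]
  ring

theorem smul_fun {f : ℝ → ℝ} {g : ℝ → F} {a b : ℝ} {c d : F} (h : HasRightExpansion f a b)
    (h' : HasRightExpansion g c d) :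
    HasRightExpansion (fun t => f t • g t) (a • c) (b • c + a • d) := by
  have h1 : Tendsto (fun t : ℝ => (t⁻¹ • (f t - a)) • (g t) + a • (t⁻¹ • (g t - c))) (𝓝[>] 0)
      (𝓝 (b • c + a • d)) :=
    (Tendsto.smul h h'.tendsto).add (Tendsto.const_smul h' a)
  refine h1.congr fun t => ?_
  simp only [smul_eq_mul]
  module

theorem inv {f : ℝ → ℝ} {a b : ℝ} (h : HasRightExpansion f a b) (ha : a ≠ 0) :
    HasRightExpansion (fun t => (f t)⁻¹) a⁻¹ (-b / a ^ 2) := by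
  have h1 : Tendsto (fun t : ℝ => -(t⁻¹ • (f t - a)) * ((f t)⁻¹ * a⁻¹)) (𝓝[>] 0)
      (𝓝 (-b * (a⁻¹ * a⁻¹))) :=
    (Tendsto.neg h).mul ((h.tendsto.inv₀ ha).mul_const _)
  rw [show -b * (a⁻¹ * a⁻¹) = -b / a ^ 2 by field_simp] at h1
  refine h1.congr' ?_
  filter_upwards [h.tendsto.eventually_ne ha] with t ht
  simp only [smul_eq_mul]
  field_simp
  ring

/-- Collects the terms of a comparison that do not affect the first order. -/
theorem sq_mul {f : ℝ → ℝ} {c : ℝ} (h : Tendsto f (𝓝[>] 0) (𝓝 c)) :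
    HasRightExpansion (fun t => t ^ 2 * f t) 0 0 := by
  have h1 := tendsto_id_nhdsGT_zero.mul h
  rw [zero_mul] at h1
  refine Tendsto.congr' ?_ h1
  filter_upwards [self_mem_nhdsWithin] with t ht
  have : t ≠ 0 := ne_of_gt ht
  simp only [smul_eq_mul, sub_zero]
  field_simp

end HasRightExpansion

end RightExpansion

/-! ### Comparison of two asymptotic expansions of a metric -/

section MetricComparison

variable {E : Type*} [NormedAddCommGroup E] [NormedSpace ℝ E]

variable {ν κ σ σ' : ℝ} {r a : ℝ → ℝ} {A : ℝ → ℝ} {B : ℝ → E →L[ℝ] ℝ}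
  {C : ℝ → E →L[ℝ] E →L[ℝ] ℝ} {Z : ℝ → E} {η : E} {H K : E →L[ℝ] E →L[ℝ] ℝ}

theorem hasRightExpansion_div (hr : Tendsto (fun t => (r t - t) / t ^ 2) (𝓝[>] 0) (𝓝 κ)) :
    HasRightExpansion (fun t => r t / t) 1 κ := by
  refine hr.congr' ?_
  filter_upwards [self_mem_nhdsWithin] with t ht
  have : t ≠ 0 := ne_of_gt ht
  simp only [smul_eq_mul]
  field_simp

/-- This is `(t/r)² = 1 - 2κt + o(t)`, the factor that converts the weight `r²` of one chart into
the weight `t²` of the other. -/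
theorem hasRightExpansion_div_inv_sq (hr : Tendsto (fun t => (r t - t) / t ^ 2) (𝓝[>] 0) (𝓝 κ)) :
    HasRightExpansion (fun t => (r t / t)⁻¹ * (r t / t)⁻¹) 1 (-2 * κ) := by
  have h := (hasRightExpansion_div hr).inv one_ne_zero
  convert h.mul h using 1
  · norm_num
  · ring

theorem eventually_pos_of_expansion
    (hr : Tendsto (fun t => (r t - t) / t ^ 2) (𝓝[>] 0) (𝓝 κ)) : ∀ᶠ t in 𝓝[>] 0, 0 < r t := by
  filter_upwards [(hasRightExpansion_div hr).tendsto.eventually_const_lt zero_lt_one,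
    self_mem_nhdsWithin] with t h ht
  exact (div_pos_iff_of_pos_right ht).1 h

/-- Here `t` and `r` are the normal coordinates of the two charts along a line of the first, `a` and
`Z` the transverse derivatives of the second chart's coordinates, and `A`, `B`, `C` the normal,
mixed and tangential components of the metric in the second chart. Up to `O(t²)`, `ν t⁴ g` equals
`(t/r)⁴ a² (ν r⁴ A)`; the factors `1 - 4κt` and `1 + 4κt` cancel to first order and leave `1 +
2σ't`. -/
theorem normal_normal_comparison {g : ℝ → ℝ}
    (hr : Tendsto (fun t => (r t - t) / t ^ 2) (𝓝[>] 0) (𝓝 κ))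
    (ha : HasRightExpansion a 1 (2 * κ)) (hZ : Tendsto Z (𝓝[>] 0) (𝓝 η))
    (hA : HasRightExpansion (fun t => ν * r t ^ 4 * A t) 1 (2 * σ'))
    (hB : Tendsto (fun t => r t ^ 2 • B t) (𝓝[>] 0) (𝓝 0))
    (hC : Tendsto (fun t => r t ^ 2 • C t) (𝓝[>] 0) (𝓝 H))
    (hg : HasRightExpansion (fun t => ν * t ^ 4 * g t) 1 (2 * σ))
    (hgA : ∀ᶠ t in 𝓝[>] 0, g t = a t * a t * A t + 2 * (a t * B t (Z t)) + C t (Z t) (Z t)) :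
    σ = σ' := by
  have hq := hasRightExpansion_div_inv_sq hr
  have h1 := ((hq.mul hq).mul hA).mul (ha.mul ha)
  have h2 : HasRightExpansion (fun t => t ^ 2 * (ν * (((r t / t)⁻¹ * (r t / t)⁻¹) *
      (2 * (a t * (r t ^ 2 • B t) (Z t)) + (r t ^ 2 • C t) (Z t) (Z t))))) 0 0 := by
    refine HasRightExpansion.sq_mul (c := ν * (1 * (2 * (1 * (0 : E →L[ℝ] ℝ) η) + H η η))) ?_
    exact (hq.tendsto.mul (((ha.tendsto.mul (hB.clm_apply hZ)).const_mul 2).add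
      ((hC.clm_apply hZ).clm_apply hZ))).const_mul ν
  suffices h : _ =ᶠ[𝓝[>] 0] fun t => ν * t ^ 4 * g t by
    have h3 := (h1.add h2).congr' h
    rw [show (1 * 1 * 1 * (1 * 1) + 0 : ℝ) = 1 by norm_num] at h3
    linarith [hg.unique h3]
  filter_upwards [hgA, self_mem_nhdsWithin, eventually_pos_of_expansion hr] with t ht h0 hr0
  have h0' : t ≠ 0 := ne_of_gt h0
  rw [ht]
  simp only [smul_apply, smul_eq_mul]
  field_simp
  ring

variable {v w : E} {p p' g : ℝ → ℝ} {Q Q' : ℝ → E} {dκ dκ' : ℝ} {V W V₁ W₁ : E}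

/-- With `p` and `Q` the derivatives of the second chart's coordinates along a tangential `v`, the
singular component `A ~ ν⁻¹ r⁻⁴` meets `p ~ dκ t²`, so the limit of `t² g` is `ν⁻¹ dκ + H(η, V)`.
This limit is zero by hypothesis. -/
theorem normal_tangential_comparison (hν : ν ≠ 0)
    (hr : Tendsto (fun t => (r t - t) / t ^ 2) (𝓝[>] 0) (𝓝 κ))
    (ha : HasRightExpansion a 1 (2 * κ)) (hZ : Tendsto Z (𝓝[>] 0) (𝓝 η))
    (hp : Tendsto (fun t => p t / t ^ 2) (𝓝[>] 0) (𝓝 dκ)) (hQ : Tendsto Q (𝓝[>] 0) (𝓝 V))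
    (hA : HasRightExpansion (fun t => ν * r t ^ 4 * A t) 1 (2 * σ'))
    (hB : Tendsto (fun t => r t ^ 2 • B t) (𝓝[>] 0) (𝓝 0))
    (hC : Tendsto (fun t => r t ^ 2 • C t) (𝓝[>] 0) (𝓝 H))
    (hg : Tendsto (fun t => t ^ 2 * g t) (𝓝[>] 0) (𝓝 0))
    (hgA : ∀ᶠ t in 𝓝[>] 0,
      g t = a t * p t * A t + a t * B t (Q t) + p t * B t (Z t) + C t (Z t) (Q t)) :
    H η V = -ν⁻¹ * dκ := by
  have hq := (hasRightExpansion_div_inv_sq hr).tendsto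
  have h1 : Tendsto (fun t => ν⁻¹ * (((r t / t)⁻¹ * (r t / t)⁻¹) * ((r t / t)⁻¹ * (r t / t)⁻¹)
      * (ν * r t ^ 4 * A t) * a t * (p t / t ^ 2)) + ((r t / t)⁻¹ * (r t / t)⁻¹) *
      (a t * (r t ^ 2 • B t) (Q t) + t ^ 2 * (p t / t ^ 2) * (r t ^ 2 • B t) (Z t)
        + (r t ^ 2 • C t) (Z t) (Q t))) (𝓝[>] 0)
      (𝓝 (ν⁻¹ * (1 * 1 * 1 * 1 * dκ) + 1 * (1 * (0 : E →L[ℝ] ℝ) V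
        + 0 ^ 2 * dκ * (0 : E →L[ℝ] ℝ) η + H η V))) :=
    (((((hq.mul hq).mul hA.tendsto).mul ha.tendsto).mul hp).const_mul _).add
      (hq.mul (((ha.tendsto.mul (hB.clm_apply hQ)).add
        (((tendsto_id_nhdsGT_zero.pow 2).mul hp).mul (hB.clm_apply hZ))).add
        ((hC.clm_apply hZ).clm_apply hQ)))
  suffices h : _ =ᶠ[𝓝[>] 0] fun t => t ^ 2 * g t by
    have h2 := tendsto_nhds_unique hg (h1.congr' h)
    simp only [one_mul, zero_apply, mul_zero, zero_add] at h2
    linarith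
  filter_upwards [hgA, self_mem_nhdsWithin, eventually_pos_of_expansion hr] with t ht h0 hr0
  have h0' : t ≠ 0 := ne_of_gt h0
  rw [ht]
  simp only [smul_apply, smul_eq_mul]
  field_simp
  ring

/-- Now `A` comes with two factors of size `t²`, so `t² p p' A` is `O(t²)`, and so are the `B`
terms. To first order there remains `(t/r)² (r² C)(Q, Q')`, expanded by the product rule. -/
theorem tangential_tangential_comparison {m : ℝ} (hν : ν ≠ 0)
    (hr : Tendsto (fun t => (r t - t) / t ^ 2) (𝓝[>] 0) (𝓝 κ))
    (hp : Tendsto (fun t => p t / t ^ 2) (𝓝[>] 0) (𝓝 dκ)) (hQ : HasRightExpansion Q V V₁)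
    (hp' : Tendsto (fun t => p' t / t ^ 2) (𝓝[>] 0) (𝓝 dκ')) (hQ' : HasRightExpansion Q' W W₁)
    (hA : HasRightExpansion (fun t => ν * r t ^ 4 * A t) 1 (2 * σ'))
    (hB : Tendsto (fun t => r t ^ 2 • B t) (𝓝[>] 0) (𝓝 0))
    (hC : HasRightExpansion (fun t => r t ^ 2 • C t) H K)
    (hg : HasRightExpansion (fun t => t ^ 2 * g t) (H V W) m)
    (hgA : ∀ᶠ t in 𝓝[>] 0,
      g t = p t * p' t * A t + p t * B t (Q' t) + p' t * B t (Q t) + C t (Q t) (Q' t)) :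
    m = -2 * κ * H V W + (K V W + H V₁ W + H V W₁) := by
  have hq := hasRightExpansion_div_inv_sq hr
  have h1 := hq.mul ((hC.clm_apply hQ).clm_apply hQ')
  have h2 : HasRightExpansion (fun t => t ^ 2 * (
      ν⁻¹ * (((r t / t)⁻¹ * (r t / t)⁻¹) * ((r t / t)⁻¹ * (r t / t)⁻¹)
        * (ν * r t ^ 4 * A t) * (p t / t ^ 2) * (p' t / t ^ 2)) + ((r t / t)⁻¹ * (r t / t)⁻¹) *
      ((p t / t ^ 2) * (r t ^ 2 • B t) (Q' t) + (p' t / t ^ 2) * (r t ^ 2 • B t) (Q t)))) 0 0 := by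
    refine HasRightExpansion.sq_mul (c := ν⁻¹ * (1 * 1 * 1 * dκ * dκ') +
      1 * (dκ * (0 : E →L[ℝ] ℝ) W + dκ' * (0 : E →L[ℝ] ℝ) V)) ?_
    exact (((((hq.tendsto.mul hq.tendsto).mul hA.tendsto).mul hp).mul hp').const_mul _).add
      (hq.tendsto.mul ((hp.mul (hB.clm_apply hQ'.tendsto)).add (hp'.mul (hB.clm_apply hQ.tendsto))))
  suffices h : _ =ᶠ[𝓝[>] 0] fun t => t ^ 2 * g t by
    have h3 := (h1.add h2).congr' h
    rw [show (1 * H V W + 0 : ℝ) = H V W by ring] at h3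
    rw [hg.unique h3]
    simp only [add_apply]
    ring
  filter_upwards [hgA, self_mem_nhdsWithin, eventually_pos_of_expansion hr] with t ht h0 hr0
  have h0' : t ≠ 0 := ne_of_gt h0
  rw [ht]
  simp only [smul_apply, smul_eq_mul]
  field_simp
  ring

end MetricComparison

/-! ### Koszul's formula under changes of coordinates -/

section Koszul

variable {E : Type*} [NormedAddCommGroup E] [NormedSpace ℝ E]

/-- The right hand side of Koszul's formula for a metric `H` in coordinates. -/
def koszul (H : E → E →L[ℝ] E →L[ℝ] ℝ) (y u v w : E) : ℝ :=
  (1 / 2) * (fderiv ℝ H y u v w + fderiv ℝ H y v u w - fderiv ℝ H y w u v)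

variable {H H' : E → E →L[ℝ] E →L[ℝ] ℝ} {Y : E → E} {y : E}

theorem fderiv_pullback_form (hY : ContDiffAt ℝ ∞ Y y) (hH' : DifferentiableAt ℝ H' (Y y))
    (hH : ∀ᶠ z in 𝓝 y, ∀ v w, H z v w = H' (Y z) (fderiv ℝ Y z v) (fderiv ℝ Y z w)) (u v w : E)
    (hHd : DifferentiableAt ℝ H y) :
    fderiv ℝ H y u v w = fderiv ℝ H' (Y y) (fderiv ℝ Y y u) (fderiv ℝ Y y v) (fderiv ℝ Y y w)
      + H' (Y y) (fderiv ℝ (fderiv ℝ Y) y u v) (fderiv ℝ Y y w)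
      + H' (Y y) (fderiv ℝ Y y v) (fderiv ℝ (fderiv ℝ Y) y u w) := by
  have hdY : DifferentiableAt ℝ (fderiv ℝ Y) y :=
    (hY.fderiv_right (m := 1) (WithTop.coe_le_coe.2 (le_top : (2 : ℕ∞) ≤ ⊤))).differentiableAt
      (by simp)
  have h1 : HasFDerivAt (fun z => H' (Y z)) ((fderiv ℝ H' (Y y)).comp (fderiv ℝ Y y)) y :=
    HasFDerivAt.comp (g := H') y hH'.hasFDerivAt (hY.differentiableAt (by simp)).hasFDerivAt
  have h2 : ∀ v, HasFDerivAt (fun z => fderiv ℝ Y z v)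
      ((fderiv ℝ (fderiv ℝ Y) y).flip v) y := fun v => by
    simpa using! hdY.hasFDerivAt.clm_apply (hasFDerivAt_const v y)
  have h3 := (h1.clm_apply (h2 v)).clm_apply (h2 w)
  have h4 : HasFDerivAt (fun z => H z v w) (((fderiv ℝ H y).flip v).flip w) y := by
    simpa using! (hHd.hasFDerivAt.clm_apply (hasFDerivAt_const v y)).clm_apply
      (hasFDerivAt_const w y)
  have h5 := (h3.congr_of_eventuallyEq (hH.mono fun z hz => hz v w)).unique h4
  have h6 := congrArg (fun L : E →L[ℝ] ℝ => L u) h5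
  simp only [add_apply, ContinuousLinearMap.comp_apply,
    ContinuousLinearMap.flip_apply] at h6
  rw [← h6]
  ring

/-- Each of the three derivatives in Koszul's formula produces two terms with the second derivative
of `Y`; symmetry cancels all but the one pairing `D²Y(u, v)` with `w`. -/
theorem koszul_pullback (hY : ContDiffAt ℝ ∞ Y y) (hH' : DifferentiableAt ℝ H' (Y y))
    (hsymm : ∀ v w, H' (Y y) v w = H' (Y y) w v)
    (hH : ∀ᶠ z in 𝓝 y, ∀ v w, H z v w = H' (Y z) (fderiv ℝ Y z v) (fderiv ℝ Y z w))
    (hHd : DifferentiableAt ℝ H y) (u v w : E) :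
    koszul H y u v w = koszul H' (Y y) (fderiv ℝ Y y u) (fderiv ℝ Y y v) (fderiv ℝ Y y w)
      + H' (Y y) (fderiv ℝ (fderiv ℝ Y) y u v) (fderiv ℝ Y y w) := by
  have hs : ∀ v w, fderiv ℝ (fderiv ℝ Y) y v w = fderiv ℝ (fderiv ℝ Y) y w v := fun v w =>
    (hY.isSymmSndFDerivAt (by simpa using! (WithTop.coe_le_coe.2 (le_top : (2 : ℕ∞) ≤ ⊤)))).eq v w
  simp only [koszul, fderiv_pullback_form hY hH' hH _ _ _ hHd]
  rw [hs v u, hs w u, hs w v, hsymm (fderiv ℝ Y y u), hsymm (fderiv ℝ Y y v)]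
  ring

variable {Γ Γ' : E → E → E}

/-- The classical transformation law of Christoffel symbols. It suffices to pair both sides with
vectors in the image of `fderiv ℝ Y y`, by nondegeneracy and surjectivity, and this is
`koszul_pullback`. -/
theorem christoffel_pullback (hY : ContDiffAt ℝ ∞ Y y) (hH' : DifferentiableAt ℝ H' (Y y))
    (hsymm : ∀ v w, H' (Y y) v w = H' (Y y) w v)
    (hnd : ∀ v, (∀ w, H' (Y y) v w = 0) → v = 0)
    (hsurj : Function.Surjective (fderiv ℝ Y y))
    (hH : ∀ᶠ z in 𝓝 y, ∀ v w, H z v w = H' (Y z) (fderiv ℝ Y z v) (fderiv ℝ Y z w))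
    (hHd : DifferentiableAt ℝ H y)
    (hΓ : ∀ u v w, H y (Γ u v) w = koszul H y u v w)
    (hΓ' : ∀ u v w, H' (Y y) (Γ' u v) w = koszul H' (Y y) u v w) (u v : E) :
    fderiv ℝ Y y (Γ u v)
      = Γ' (fderiv ℝ Y y u) (fderiv ℝ Y y v) + fderiv ℝ (fderiv ℝ Y) y u v := by
  rw [← sub_eq_zero]
  refine hnd _ fun w' => ?_
  obtain ⟨w, rfl⟩ := hsurj w'
  simp only [map_sub, map_add, sub_apply, add_apply]
  rw [← hH.self_of_nhds, hΓ, hΓ', koszul_pullback hY hH' hsymm hH hHd]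
  ring

/-- If `η` is the gradient of `-ν⁻¹ κ`, then the Lie derivative of the metric along `η` is
`-2 ν⁻¹ ∇∇κ`; all of it read in other coordinates. -/
theorem lieDerivative_gradient {κ : E → ℝ} {η : E → E} {ν : ℝ}
    (hY : ContDiffAt ℝ ∞ Y y) (hH' : DifferentiableAt ℝ H' (Y y))
    (hsymm : ∀ v w, H' (Y y) v w = H' (Y y) w v)
    (hκ : ContDiffAt ℝ ∞ κ y) (hη : DifferentiableAt ℝ η y)
    (hgrad : ∀ᶠ z in 𝓝 y, ∀ v, H' (Y z) (η z) (fderiv ℝ Y z v) = -ν⁻¹ * fderiv ℝ κ z v)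
    (hdsymm : ∀ u v w, fderiv ℝ H' (Y y) u v w = fderiv ℝ H' (Y y) u w v)
    (hΓ' : ∀ u v w, H' (Y y) (Γ' u v) w = koszul H' (Y y) u v w)
    (hΓ : ∀ u v, fderiv ℝ Y y (Γ u v)
      = Γ' (fderiv ℝ Y y u) (fderiv ℝ Y y v) + fderiv ℝ (fderiv ℝ Y) y u v) (u v : E) :
    fderiv ℝ H' (Y y) (η y) (fderiv ℝ Y y u) (fderiv ℝ Y y v)
      + H' (Y y) (fderiv ℝ η y u) (fderiv ℝ Y y v) + H' (Y y) (fderiv ℝ Y y u) (fderiv ℝ η y v)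
      = -2 * ν⁻¹ * (fderiv ℝ (fderiv ℝ κ) y u v - fderiv ℝ κ y (Γ u v)) := by
  have hdd : (2 : ℕ∞ω) ≤ ∞ := WithTop.coe_le_coe.2 (le_top : (2 : ℕ∞) ≤ ⊤)
  have hdY : DifferentiableAt ℝ (fderiv ℝ Y) y :=
    (hY.fderiv_right (m := 1) hdd).differentiableAt (by simp)
  have hdκ : DifferentiableAt ℝ (fderiv ℝ κ) y :=
    (hκ.fderiv_right (m := 1) hdd).differentiableAt (by simp)
  have hs : ∀ v w, fderiv ℝ (fderiv ℝ Y) y v w = fderiv ℝ (fderiv ℝ Y) y w v := fun v w =>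
    (hY.isSymmSndFDerivAt (by simpa using! hdd)).eq v w
  have hsκ : ∀ v w, fderiv ℝ (fderiv ℝ κ) y v w = fderiv ℝ (fderiv ℝ κ) y w v := fun v w =>
    (hκ.isSymmSndFDerivAt (by simpa using! hdd)).eq v w
  have h1 : HasFDerivAt (fun z => H' (Y z)) ((fderiv ℝ H' (Y y)).comp (fderiv ℝ Y y)) y :=
    HasFDerivAt.comp (g := H') y hH'.hasFDerivAt (hY.differentiableAt (by simp)).hasFDerivAt
  -- The gradient equation is differentiated along `u` at fixed `v`.
  have key : ∀ u v, fderiv ℝ H' (Y y) (fderiv ℝ Y y u) (η y) (fderiv ℝ Y y v)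
      + H' (Y y) (fderiv ℝ η y u) (fderiv ℝ Y y v)
      + H' (Y y) (η y) (fderiv ℝ (fderiv ℝ Y) y u v)
      = -ν⁻¹ * fderiv ℝ (fderiv ℝ κ) y u v := by
    intro u v
    have h2 : HasFDerivAt (fun z => fderiv ℝ Y z v) ((fderiv ℝ (fderiv ℝ Y) y).flip v) y := by
      simpa using! hdY.hasFDerivAt.clm_apply (hasFDerivAt_const v y)
    have h2' : HasFDerivAt (fun z => fderiv ℝ κ z v) ((fderiv ℝ (fderiv ℝ κ) y).flip v) y := by
      simpa using! hdκ.hasFDerivAt.clm_apply (hasFDerivAt_const v y)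
    have h3 := (h1.clm_apply hη.hasFDerivAt).clm_apply h2
    have h4 := h2'.const_mul (-ν⁻¹)
    have h5 := (h4.congr_of_eventuallyEq (hgrad.mono fun z hz => hz v)).unique h3
    have h6 := congrArg (fun L : E →L[ℝ] ℝ => L u) h5
    simp only [add_apply, ContinuousLinearMap.comp_apply,
      ContinuousLinearMap.flip_apply, smul_apply, smul_eq_mul] at h6
    rw [h6]
    ring
  -- Both orders of differentiation are added and twice the gradient equation at `Γ u v` is
  -- subtracted. The second derivatives of `Y` cancel, and Koszul's formula trades the derivatives
  -- of the metric along `u` and `v` for the one along `η`.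
  have k1 := key u v
  have k2 := key v u
  have k3 := hgrad.self_of_nhds (Γ u v)
  rw [hΓ, map_add, hsymm, hΓ', koszul] at k3
  rw [hs v u, hsκ v u] at k2
  rw [hsymm (fderiv ℝ Y y u)]
  rw [hdsymm _ (η y)] at k1 k2
  linear_combination k1 + k2 - 2 * k3

end Koszul

/-! ### Coordinates `(t, y)` on a manifold with boundary -/

/-- The identification of `ℝ × ℝⁿ` with `ℝⁿ⁺¹`. -/
def euclideanCons (n : ℕ) :
    (ℝ × EuclideanSpace ℝ (Fin n)) ≃L[ℝ] EuclideanSpace ℝ (Fin (n + 1)) :=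
  LinearEquiv.toContinuousLinearEquiv
    { toFun := fun z => WithLp.toLp 2 (Fin.cons z.1 fun i => z.2 i)
      invFun := fun x => (x 0, WithLp.toLp 2 fun i => x i.succ)
      map_add' := fun z w => by
        ext i
        refine Fin.cases ?_ (fun i => ?_) i <;> simp
      map_smul' := fun c z => by
        ext i
        refine Fin.cases ?_ (fun i => ?_) i <;> simp
      left_inv := fun z => by
        ext <;> simp
      right_inv := fun x => by
        ext i
        refine Fin.cases ?_ (fun i => ?_) i <;> simp }

theorem euclideanCons_zero {n : ℕ} (z : ℝ × EuclideanSpace ℝ (Fin n)) :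
    euclideanCons n z 0 = z.1 := rfl

theorem euclideanCons_succ {n : ℕ} (z : ℝ × EuclideanSpace ℝ (Fin n)) (i : Fin n) :
    euclideanCons n z i.succ = z.2 i := rfl

theorem euclideanCons_single_zero {n : ℕ} :
    euclideanCons n (1, 0) = EuclideanSpace.single 0 1 := by
  ext i
  refine Fin.cases ?_ (fun i => ?_) i
  · simp [euclideanCons_zero]
  · simp [euclideanCons_succ]

theorem euclideanCons_single_succ {n : ℕ} (i : Fin n) :
    euclideanCons n (0, EuclideanSpace.single i 1) = EuclideanSpace.single i.succ 1 := by
  ext j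
  refine Fin.cases ?_ (fun j => ?_) j
  · simp [euclideanCons_zero, Fin.succ_ne_zero]
  · simp [euclideanCons_succ]

namespace InfinityData

section Coordinates

variable {n : ℕ} {M : Type*} [TopologicalSpace M] [ChartedSpace (EuclideanHalfSpace (n + 1)) M]

/-- The coordinates `(ρ, y)` of a chart. -/
def coord (e : OpenPartialHomeomorph M (EuclideanHalfSpace (n + 1))) (p : M) :
    ℝ × EuclideanSpace ℝ (Fin n) :=
  (rhoCoord e p, yCoord e p)

/-- The point with given coordinates `(ρ, y)`. -/
def coordInv (e : OpenPartialHomeomorph M (EuclideanHalfSpace (n + 1)))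
    (z : ℝ × EuclideanSpace ℝ (Fin n)) : M :=
  e.symm ((𝓡∂ (n + 1)).symm (euclideanCons n z))

/-- An open set of coordinates `(ρ, y)` whose part in the half-space corresponds to `W`. -/
def coordDom (e : OpenPartialHomeomorph M (EuclideanHalfSpace (n + 1))) (W : Set M) :
    Set (ℝ × EuclideanSpace ℝ (Fin n)) :=
  (fun z => (𝓡∂ (n + 1)).symm (euclideanCons n z)) ⁻¹' (e.target ∩ e.symm ⁻¹' W)

variable {e e' : OpenPartialHomeomorph M (EuclideanHalfSpace (n + 1))} {W : Set M} {p : M}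
  {z : ℝ × EuclideanSpace ℝ (Fin n)}

theorem euclideanCons_coord : euclideanCons n (coord e p) = e.extend (𝓡∂ (n + 1)) p := by
  ext i
  refine Fin.cases ?_ (fun i => ?_) i <;> rfl

theorem coord_eq : coord e p = (euclideanCons n).symm (e.extend (𝓡∂ (n + 1)) p) := rfl

theorem euclideanCons_mem_range (hz : z ∈ halfProd _) : euclideanCons n z ∈ range (𝓡∂ (n + 1)) := by
  rw [range_modelWithCornersEuclideanHalfSpace]
  exact mem_halfProd.1 hz

theorem isOpen_coordDom (hW : IsOpen W) : IsOpen (coordDom e W) :=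
  (e.isOpen_inter_preimage_symm hW).preimage
    ((𝓡∂ (n + 1)).continuous_symm.comp (euclideanCons n).continuous)

theorem coordInv_coord (hp : p ∈ e.source) : coordInv e (coord e p) = p := by
  rw [coordInv, euclideanCons_coord]
  exact e.extend_left_inv (I := 𝓡∂ (n + 1)) hp

theorem coord_mem_coordDom (hp : p ∈ e.source) (hW : p ∈ W) : coord e p ∈ coordDom e W := by
  have h : (𝓡∂ (n + 1)).symm (euclideanCons n (coord e p)) = e p := by
    rw [euclideanCons_coord]
    exact (𝓡∂ (n + 1)).left_inv (e p)
  rw [coordDom, mem_preimage, h]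
  exact ⟨e.map_source hp, by simpa [e.left_inv hp] using hW⟩

theorem coordInv_mem_source (hz : z ∈ coordDom e W) : coordInv e z ∈ e.source :=
  e.map_target hz.1

theorem coordInv_mem (hz : z ∈ coordDom e W) : coordInv e z ∈ W := hz.2

theorem coord_coordInv (hz : z ∈ halfProd _) (hz' : z ∈ coordDom e W) :
    coord e (coordInv e z) = z := by
  rw [coord_eq, ContinuousLinearEquiv.symm_apply_eq]
  change (𝓡∂ (n + 1)) (e (e.symm _)) = _
  rw [e.right_inv hz'.1, (𝓡∂ (n + 1)).right_inv (euclideanCons_mem_range hz)]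

variable [IsManifold (𝓡∂ (n + 1)) ∞ M]

theorem contMDiffOn_coordInv (he : e ∈ IsManifold.maximalAtlas (𝓡∂ (n + 1)) ∞ M) :
    ContMDiffOn 𝓘(ℝ, ℝ × EuclideanSpace ℝ (Fin n)) (𝓡∂ (n + 1)) ∞ (coordInv e)
      (halfProd _ ∩ coordDom e W) := by
  refine (contMDiffOn_extend_symm he).comp
    (euclideanCons n).contDiff.contMDiff.contMDiffOn fun z hz => ?_
  exact ⟨_, hz.2.1, (𝓡∂ (n + 1)).right_inv (euclideanCons_mem_range hz.1)⟩

theorem contMDiffOn_coord (he : e ∈ IsManifold.maximalAtlas (𝓡∂ (n + 1)) ∞ M) :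
    ContMDiffOn (𝓡∂ (n + 1)) 𝓘(ℝ, ℝ × EuclideanSpace ℝ (Fin n)) ∞ (coord e) e.source :=
  (euclideanCons n).symm.contDiff.contMDiff.comp_contMDiffOn (e.contMDiffOn_extend he)

theorem contDiffOn_comp_coordInv {F : Type*} [NormedAddCommGroup F] [NormedSpace ℝ F]
    (he : e ∈ IsManifold.maximalAtlas (𝓡∂ (n + 1)) ∞ M) {f : M → F}
    (hf : ContMDiffOn (𝓡∂ (n + 1)) 𝓘(ℝ, F) ∞ f W) :
    ContDiffOn ℝ ∞ (fun z => f (coordInv e z)) (halfProd _ ∩ coordDom e W) :=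
  contMDiffOn_iff_contDiffOn.1 (hf.comp (contMDiffOn_coordInv he) fun _ hz => coordInv_mem hz.2)

/-- Boundary points are defined through the preferred charts; any chart of the maximal atlas is a
local diffeomorphism onto the half-space and so detects them by its zeroth coordinate. -/
theorem isBoundaryPoint_iff_rhoCoord (he : e ∈ IsManifold.maximalAtlas (𝓡∂ (n + 1)) ∞ M)
    (hp : p ∈ e.source) : (𝓡∂ (n + 1)).IsBoundaryPoint p ↔ rhoCoord e p = 0 := by
  have h : IsLocalDiffeomorphAt (𝓡∂ (n + 1)) (𝓡∂ (n + 1)) ∞ e p :=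
    ⟨⟨e.toPartialEquiv, e.open_source, e.open_target, contMDiffOn_of_mem_maximalAtlas he,
      contMDiffOn_symm_of_mem_maximalAtlas he⟩, hp, fun _ _ => rfl⟩
  rw [h.isBoundaryPoint_iff (by simp), ModelWithCorners.isBoundaryPoint_iff,
    frontier_range_modelWithCornersEuclideanHalfSpace]
  exact eq_comm

theorem coordInv_mem_interior (he : e ∈ IsManifold.maximalAtlas (𝓡∂ (n + 1)) ∞ M)
    (hz : z ∈ coordDom e W) (hpos : 0 < z.1) : coordInv e z ∈ (𝓡∂ (n + 1)).interior M := by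
  rw [← ModelWithCorners.compl_boundary]
  intro h
  have h1 := (isBoundaryPoint_iff_rhoCoord he (coordInv_mem_source hz)).1 h
  have h2 := congrArg Prod.fst (coord_coordInv (mem_halfProd.2 hpos.le) hz)
  change rhoCoord e _ = _ at h2
  linarith

end Coordinates

end InfinityData

namespace InfinityData

variable {n : ℕ} {M B : Type*}
    [TopologicalSpace M] [ChartedSpace (EuclideanHalfSpace (n + 1)) M]
    [IsManifold (𝓡∂ (n + 1)) ∞ M]
    [TopologicalSpace B] [ChartedSpace (EuclideanSpace ℝ (Fin n)) B]
    [IsManifold (𝓡 n) ∞ B]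
    {e e' : OpenPartialHomeomorph M (EuclideanHalfSpace (n + 1))}

/-! ### Two-jets along the coordinate lines transverse to the boundary -/

/-- Along a coordinate line the distance to `x` in the preferred chart is `O(t)`, since the change
of charts is differentiable up to the boundary. The little-o in the definition of 2-jets therefore
becomes `o(t²)`. -/
theorem tendsto_slice_of_twoJet_eq (he : e ∈ IsManifold.maximalAtlas (𝓡∂ (n + 1)) ∞ M)
    {x : M} {f g : SmoothFunAt (n := n) x}
    (h : Quotient.mk (twoJetSetoid x) f = Quotient.mk (twoJetSetoid x) g)
    {y : EuclideanSpace ℝ (Fin n)} {W : Set M} (hy : ((0 : ℝ), y) ∈ coordDom e W)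
    (hx : coordInv e (0, y) = x) :
    Tendsto (fun t => (f.1 (coordInv e (t, y)) - g.1 (coordInv e (t, y))) / t ^ 2)
      (𝓝[>] 0) (𝓝 0) := by
  have h1 : (fun p => f.1 p - g.1 p) =o[𝓝 x] _ := Quotient.exact h
  have hsm := contDiffOn_comp_coordInv he (contMDiffOn_extChartAt (I := 𝓡∂ (n + 1)) (n := ∞)
    (x := x))
  have hxs : ((0 : ℝ), y) ∈ coordDom e (chartAt (EuclideanHalfSpace (n + 1)) x).source := by
    refine ⟨hy.1, ?_⟩
    have h0 : coordInv e (0, y) ∈ (chartAt (EuclideanHalfSpace (n + 1)) x).source := by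
      rw [hx]
      exact mem_chart_source _ x
    exact h0
  have h2 := (hasDerivWithinAt_halfDeriv (isOpen_coordDom (chartAt _ x).open_source) hsm
    le_rfl hxs).mono Ioi_subset_Ici_self
  have h3 := h2.hasFDerivWithinAt.isBigO_sub
  have h4 : Tendsto (fun t : ℝ => coordInv e (t, y)) (𝓝[>] 0) (𝓝 x) := by
    have h5 := (contMDiffOn_coordInv (W := univ) he).continuousOn (0, y)
      ⟨mem_halfProd.2 le_rfl, hy.1, mem_univ _⟩
    rw [← hx]
    refine h5.tendsto.comp (tendsto_nhdsWithin_iff.2 ⟨?_, ?_⟩)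
    · exact (Continuous.prodMk_left y).continuousAt.tendsto.mono_left nhdsWithin_le_nhds
    · filter_upwards [self_mem_nhdsWithin, nhdsWithin_le_nhds (eventually_mem_of_boundarySlice
        (isOpen_coordDom (e := e) (chartAt _ x).open_source) hxs)] with t ht h't
      exact ⟨mem_halfProd.2 (le_of_lt ht), h't.1, mem_univ _⟩
  have h6 := h1.comp_tendsto h4
  simp only [hx, sub_zero] at h3
  have h7 := h6.trans_isBigO (h3.norm_left.pow 2)
  exact h7.tendsto_div_nhds_zero

/-! ### Boundary charts -/

variable (S : InfinityData n M B)

theorem coord_ι (he : e ∈ IsManifold.maximalAtlas (𝓡∂ (n + 1)) ∞ M) {x : B}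
    (hx : S.ι x ∈ e.source) : coord e (S.ι x) = (0, yCoord e (S.ι x)) := by
  refine Prod.ext ?_ rfl
  refine (isBoundaryPoint_iff_rhoCoord he hx).1 ?_
  have : S.ι x ∈ range S.ι := ⟨x, rfl⟩
  rwa [S.range_ι] at this

theorem coordInv_zero_yCoord (he : e ∈ IsManifold.maximalAtlas (𝓡∂ (n + 1)) ∞ M) {x : B}
    (hx : S.ι x ∈ e.source) : coordInv e (0, yCoord e (S.ι x)) = S.ι x := by
  rw [← coord_ι S he hx, coordInv_coord hx]

theorem zero_yCoord_mem (he : e ∈ IsManifold.maximalAtlas (𝓡∂ (n + 1)) ∞ M) {x : B}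
    (hx : S.ι x ∈ e.source) {W : Set M} (hW : S.ι x ∈ W) :
    ((0 : ℝ), yCoord e (S.ι x)) ∈ coordDom e W := by
  rw [← coord_ι S he hx]
  exact coord_mem_coordDom hx hW

theorem exists_ι_eq_coordInv (he : e ∈ IsManifold.maximalAtlas (𝓡∂ (n + 1)) ∞ M)
    {y : EuclideanSpace ℝ (Fin n)} {W : Set M} (hy : ((0 : ℝ), y) ∈ coordDom e W) :
    ∃ x, S.ι x = coordInv e (0, y) := by
  have h : coordInv e (0, y) ∈ range S.ι := by
    rw [S.range_ι]
    refine (isBoundaryPoint_iff_rhoCoord he (coordInv_mem_source hy)).2 ?_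
    exact congrArg Prod.fst (coord_coordInv (mem_halfProd.2 le_rfl) hy)
  exact h

theorem exists_boundary_point (he : e ∈ IsManifold.maximalAtlas (𝓡∂ (n + 1)) ∞ M)
    {y : EuclideanSpace ℝ (Fin n)} {W : Set M} (hy : ((0 : ℝ), y) ∈ coordDom e W) :
    ∃ x, S.ι x ∈ e.source ∧ S.ι x ∈ W ∧ yCoord e (S.ι x) = y := by
  obtain ⟨x, hx⟩ := S.exists_ι_eq_coordInv he hy
  refine ⟨x, hx ▸ coordInv_mem_source hy, hx ▸ coordInv_mem hy, ?_⟩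
  rw [hx]
  exact congrArg Prod.snd (coord_coordInv (mem_halfProd.2 le_rfl) hy)

theorem bdryTarget_eq (he : e ∈ IsManifold.maximalAtlas (𝓡∂ (n + 1)) ∞ M) :
    S.bdryTarget e = {y | ((0 : ℝ), y) ∈ coordDom e univ} := by
  ext y
  constructor
  · rintro ⟨x, hx, rfl⟩
    exact S.zero_yCoord_mem he hx (mem_univ _)
  · intro hy
    obtain ⟨x, hx, -, h⟩ := S.exists_boundary_point he hy
    exact ⟨x, hx, h⟩

theorem isOpen_bdryTarget (he : e ∈ IsManifold.maximalAtlas (𝓡∂ (n + 1)) ∞ M) :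
    IsOpen (S.bdryTarget e) := by
  rw [S.bdryTarget_eq he]
  exact isOpen_boundarySlice (isOpen_coordDom isOpen_univ)

theorem ι_injective : Function.Injective S.ι := S.isSmoothEmbedding_ι.isEmbedding.injective

theorem contMDiff_ι : ContMDiff (𝓡 n) (𝓡∂ (n + 1)) ∞ S.ι := S.isSmoothEmbedding_ι.contMDiff

theorem contMDiffOn_yCoord_ι (he : e ∈ IsManifold.maximalAtlas (𝓡∂ (n + 1)) ∞ M) :
    ContMDiffOn (𝓡 n) 𝓘(ℝ, EuclideanSpace ℝ (Fin n)) ∞ (fun x => yCoord e (S.ι x))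
      (S.ι ⁻¹' e.source) :=
  (contDiff_snd.contMDiff.comp_contMDiffOn (contMDiffOn_coord he)).comp
    S.contMDiff_ι.contMDiffOn fun _ hx => hx

theorem contMDiffOn_coordInv_zero (he : e ∈ IsManifold.maximalAtlas (𝓡∂ (n + 1)) ∞ M) :
    ContMDiffOn 𝓘(ℝ, EuclideanSpace ℝ (Fin n)) (𝓡∂ (n + 1)) ∞ (fun y => coordInv e (0, y))
      (S.bdryTarget e) := by
  rw [S.bdryTarget_eq he]
  exact (contMDiffOn_coordInv he).comp (contDiff_prodMk_right (0 : ℝ)).contMDiff.contMDiffOn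
    fun y hy => ⟨mem_halfProd.2 le_rfl, hy⟩

variable [Nonempty B]

theorem ι_invFun (he : e ∈ IsManifold.maximalAtlas (𝓡∂ (n + 1)) ∞ M)
    {y : EuclideanSpace ℝ (Fin n)} (hy : y ∈ S.bdryTarget e) :
    S.ι (Function.invFun S.ι (coordInv e (0, y))) = coordInv e (0, y) := by
  rw [S.bdryTarget_eq he] at hy
  exact Function.invFun_eq (S.exists_ι_eq_coordInv he hy)

/-- The chart `y` of the boundary induced by a chart `(ρ, y)`. -/
def bdryChart (e : OpenPartialHomeomorph M (EuclideanHalfSpace (n + 1)))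
    (he : e ∈ IsManifold.maximalAtlas (𝓡∂ (n + 1)) ∞ M) :
    OpenPartialHomeomorph B (EuclideanSpace ℝ (Fin n)) where
  toFun x := yCoord e (S.ι x)
  invFun y := Function.invFun S.ι (coordInv e (0, y))
  source := S.ι ⁻¹' e.source
  target := S.bdryTarget e
  map_source' x hx := ⟨x, hx, rfl⟩
  map_target' y hy := by
    rw [mem_preimage, S.ι_invFun he hy]
    rw [S.bdryTarget_eq he] at hy
    exact coordInv_mem_source hy
  left_inv' x hx := by
    rw [S.coordInv_zero_yCoord he hx, Function.leftInverse_invFun S.ι_injective]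
  right_inv' y hy := by
    rw [S.ι_invFun he hy]
    rw [S.bdryTarget_eq he] at hy
    exact congrArg Prod.snd (coord_coordInv (mem_halfProd.2 le_rfl) hy)
  open_source := e.open_source.preimage S.contMDiff_ι.continuous
  open_target := S.isOpen_bdryTarget he
  continuousOn_toFun := (S.contMDiffOn_yCoord_ι he).continuousOn
  continuousOn_invFun := by
    rw [S.isSmoothEmbedding_ι.isEmbedding.isInducing.continuousOn_iff]
    exact (S.contMDiffOn_coordInv_zero he).continuousOn.congr fun y hy => S.ι_invFun he hy

/-- The inverse is defined by choice; its smoothness is tested after composing with the immersion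
`ι`, where it becomes the smooth map `y ↦ coordInv e (0, y)`. -/
theorem contMDiffOn_bdryChart_symm (he : e ∈ IsManifold.maximalAtlas (𝓡∂ (n + 1)) ∞ M) :
    ContMDiffOn (𝓡 n) (𝓡 n) ∞ (S.bdryChart e he).symm (S.bdryTarget e) := by
  intro y hy
  have hmem := (S.isOpen_bdryTarget he).mem_nhds hy
  refine ContMDiffAt.contMDiffWithinAt ?_
  have him := S.isSmoothEmbedding_ι.isImmersion.isImmersionAt ((S.bdryChart e he).symm y)
  refine (ContMDiffAt.iff_comp_isImmersionAt him).2 ⟨?_, ?_⟩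
  · exact (S.bdryChart e he).continuousAt_symm hy
  · refine ((S.contMDiffOn_coordInv_zero he).contMDiffAt hmem).congr_of_eventuallyEq ?_
    filter_upwards [hmem] with z hz using S.ι_invFun he hz

end InfinityData

/-! ### Bilinear forms given by matrices -/

section MatForm

variable {n : ℕ}

/-- The bilinear form `v ⊗ w ↦ v_α w_β`. -/
def coordForm (n : ℕ) (α β : Fin n) :
    EuclideanSpace ℝ (Fin n) →L[ℝ] EuclideanSpace ℝ (Fin n) →L[ℝ] ℝ :=
  (EuclideanSpace.proj α : EuclideanSpace ℝ (Fin n) →L[ℝ] ℝ).smulRight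
    (EuclideanSpace.proj β : EuclideanSpace ℝ (Fin n) →L[ℝ] ℝ)

/-- The bilinear form with a given matrix. -/
def matForm (n : ℕ) (A : Fin n → Fin n → ℝ) :
    EuclideanSpace ℝ (Fin n) →L[ℝ] EuclideanSpace ℝ (Fin n) →L[ℝ] ℝ :=
  ∑ α, ∑ β, A α β • coordForm n α β

theorem matForm_apply (A : Fin n → Fin n → ℝ) (v w : EuclideanSpace ℝ (Fin n)) :
    matForm n A v w = ∑ α, ∑ β, A α β * v α * w β := by
  simp [matForm, coordForm, mul_assoc]

theorem ContDiffOn.sum_sum_smul_const {E F : Type*} [NormedAddCommGroup E] [NormedSpace ℝ E]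
    [NormedAddCommGroup F] [NormedSpace ℝ F] {s : Set E}
    {A : E → Fin n → Fin n → ℝ} (hA : ∀ α β, ContDiffOn ℝ ∞ (fun y => A y α β) s)
    (b : Fin n → Fin n → F) : ContDiffOn ℝ ∞ (fun y => ∑ α, ∑ β, A y α β • b α β) s :=
  ContDiffOn.sum fun α _ => ContDiffOn.sum fun β _ => (hA α β).smul contDiffOn_const

theorem ContDiffOn.matForm {E : Type*} [NormedAddCommGroup E] [NormedSpace ℝ E] {s : Set E}
    {A : E → Fin n → Fin n → ℝ} (hA : ∀ α β, ContDiffOn ℝ ∞ (fun y => A y α β) s) :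
    ContDiffOn ℝ ∞ (fun y => matForm n (A y)) s :=
  ContDiffOn.sum_sum_smul_const hA (coordForm n)

theorem HasRightExpansion.sum {F ι : Type*} [NormedAddCommGroup F] [NormedSpace ℝ F]
    {s : Finset ι} {f : ι → ℝ → F} {a b : ι → F}
    (h : ∀ i ∈ s, HasRightExpansion (f i) (a i) (b i)) :
    HasRightExpansion (fun t => ∑ i ∈ s, f i t) (∑ i ∈ s, a i) (∑ i ∈ s, b i) := by
  refine (tendsto_finsetSum s h).congr fun t => ?_
  rw [← Finset.smul_sum, Finset.sum_sub_distrib]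

theorem HasRightExpansion.sum_sum_smul_const {F : Type*} [NormedAddCommGroup F]
    [NormedSpace ℝ F] {A : ℝ → Fin n → Fin n → ℝ} {A₀ A₁ : Fin n → Fin n → ℝ}
    (h : ∀ α β, HasRightExpansion (fun t => A t α β) (A₀ α β) (A₁ α β))
    (b : Fin n → Fin n → F) :
    HasRightExpansion (fun t => ∑ α, ∑ β, A t α β • b α β) (∑ α, ∑ β, A₀ α β • b α β)
      (∑ α, ∑ β, A₁ α β • b α β) := by
  refine HasRightExpansion.sum fun α _ => HasRightExpansion.sum fun β _ => ?_
  simpa using (h α β).smul_fun (HasRightExpansion.const (b α β))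

theorem HasRightExpansion.matForm {A : ℝ → Fin n → Fin n → ℝ} {A₀ A₁ : Fin n → Fin n → ℝ}
    (h : ∀ α β, HasRightExpansion (fun t => A t α β) (A₀ α β) (A₁ α β)) :
    HasRightExpansion (fun t => matForm n (A t)) (matForm n A₀) (matForm n A₁) :=
  HasRightExpansion.sum_sum_smul_const h (coordForm n)

theorem matForm_single (A : Fin n → Fin n → ℝ) (α β : Fin n) :
    matForm n A (EuclideanSpace.single α 1) (EuclideanSpace.single β 1) = A α β := by
  rw [matForm_apply, Finset.sum_eq_single α, Finset.sum_eq_single β] <;> simp +contextual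

theorem clm_ext_single {F : Type*} [NormedAddCommGroup F] [NormedSpace ℝ F]
    {L L' : EuclideanSpace ℝ (Fin n) →L[ℝ] F}
    (h : ∀ α, L (EuclideanSpace.single α 1) = L' (EuclideanSpace.single α 1)) : L = L' := by
  refine ContinuousLinearMap.coe_injective
    ((EuclideanSpace.basisFun (Fin n) ℝ).toBasis.ext fun α => ?_)
  simpa using h α

theorem matForm_eq {L : EuclideanSpace ℝ (Fin n) →L[ℝ] EuclideanSpace ℝ (Fin n) →L[ℝ] ℝ}
    {A : Fin n → Fin n → ℝ}
    (h : ∀ α β, L (EuclideanSpace.single α 1) (EuclideanSpace.single β 1) = A α β) :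
    L = matForm n A :=
  clm_ext_single fun α => clm_ext_single fun β => by rw [h, matForm_single]

end MatForm

namespace InfinityData

variable {n : ℕ} {M B : Type*}
    [TopologicalSpace M] [ChartedSpace (EuclideanHalfSpace (n + 1)) M]
    [IsManifold (𝓡∂ (n + 1)) ∞ M]
    [TopologicalSpace B] [ChartedSpace (EuclideanSpace ℝ (Fin n)) B]
    [IsManifold (𝓡 n) ∞ B]
    {S : InfinityData n M B}

namespace BeigSchmidtChart

/-! ### The fibre coordinate of the jet of a Beig–Schmidt coordinate -/

open Classical in
/-- The number `u` with `j²ρ₁ = j²ρ + u j²ρ²` for the coordinate `ρ₁` of a Beig–Schmidt chart. -/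
def jetCoord (E : S.BeigSchmidtChart) (x : B) : ℝ :=
  if h : S.ι x ∈ E.toChart.source then (E.admissible x h).choose else 0

variable (E E' : S.BeigSchmidtChart)

theorem isTwoJetOf_jetCoord {x : B} (hx : S.ι x ∈ E.toChart.source) :
    IsTwoJetOf (S.jetRho x (E.jetCoord x)) (rhoCoord E.toChart) := by
  rw [jetCoord, dif_pos hx]
  exact (E.admissible x hx).choose_spec

variable {E E'}

theorem tendsto_slice_jetCoord {e : OpenPartialHomeomorph M (EuclideanHalfSpace (n + 1))}
    (he : e ∈ IsManifold.maximalAtlas (𝓡∂ (n + 1)) ∞ M)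
    {x : B} (hx : S.ι x ∈ E.toChart.source) (hxe : S.ι x ∈ e.source) :
    Tendsto (fun t => (S.ρ (coordInv e (t, yCoord e (S.ι x)))
      + E.jetCoord x * S.ρ (coordInv e (t, yCoord e (S.ι x))) ^ 2
      - rhoCoord E.toChart (coordInv e (t, yCoord e (S.ι x)))) / t ^ 2) (𝓝[>] 0) (𝓝 0) := by
  obtain ⟨hf, h⟩ := E.isTwoJetOf_jetCoord hx
  exact tendsto_slice_of_twoJet_eq he h (S.zero_yCoord_mem he hxe (mem_univ _))
    (S.coordInv_zero_yCoord he hxe)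

theorem rhoCoord_slice {y : EuclideanSpace ℝ (Fin n)} {W : Set M}
    (hy : ((0 : ℝ), y) ∈ coordDom E.toChart W) (hW : IsOpen W) :
    ∀ᶠ t in 𝓝[>] 0, rhoCoord E.toChart (coordInv E.toChart (t, y)) = t := by
  filter_upwards [self_mem_nhdsWithin, nhdsWithin_le_nhds
    (eventually_mem_of_boundarySlice (isOpen_coordDom hW) hy)] with t ht h't
  exact congrArg Prod.fst (coord_coordInv (mem_halfProd.2 (le_of_lt (mem_Ioi.1 ht))) h't)

theorem contDiffOn_ρ_coordInv {e : OpenPartialHomeomorph M (EuclideanHalfSpace (n + 1))}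
    (he : e ∈ IsManifold.maximalAtlas (𝓡∂ (n + 1)) ∞ M) :
    ContDiffOn ℝ ∞ (fun z => S.ρ (coordInv e z)) (halfProd _ ∩ coordDom e univ) :=
  contDiffOn_comp_coordInv he S.contMDiff_ρ.contMDiffOn

/-- Some limit of `ρ / t` exists because `ρ` is smooth and vanishes on the boundary. Equality of
2-jets says `ρ + u ρ² - t = o(t²)`; dividing by `t` shows that the limit is `1`. -/
theorem tendsto_ρ_slice_div {x : B} (hx : S.ι x ∈ E.toChart.source) :
    Tendsto (fun t => S.ρ (coordInv E.toChart (t, yCoord E.toChart (S.ι x))) / t)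
      (𝓝[>] 0) (𝓝 1) := by
  have he := E.mem_maximalAtlas
  have hy := S.zero_yCoord_mem he hx (mem_univ _)
  have h1 := tendsto_slice_jetCoord he hx hx
  have h0 : S.ρ (coordInv E.toChart (0, yCoord E.toChart (S.ι x))) = 0 := by
    rw [S.coordInv_zero_yCoord he hx, S.ρ_eq_zero]
  have h2 := tendsto_slice_div (isOpen_coordDom isOpen_univ) (contDiffOn_ρ_coordInv (S := S) he) hy h0
  have h3 := (continuousWithinAt_slice (isOpen_coordDom isOpen_univ)
    (contDiffOn_ρ_coordInv (S := S) he) hy).tendsto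
  rw [h0] at h3
  have h4 := (h2.add ((h3.mul h2).const_mul (E.jetCoord x))).sub
    (tendsto_id_nhdsGT_zero.mul h1)
  simp only [zero_mul, mul_zero, add_zero, sub_zero] at h4
  have h5 := tendsto_nhds_unique h4 ((tendsto_const_nhds (x := (1 : ℝ))).congr' ?_)
  · rwa [h5] at h2
  filter_upwards [self_mem_nhdsWithin, rhoCoord_slice hy isOpen_univ] with t ht hr
  have : t ≠ 0 := ne_of_gt ht
  rw [hr]
  field_simp
  ring

theorem tendsto_ρ_slice {x : B} (hx : S.ι x ∈ E.toChart.source) :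
    Tendsto (fun t => (S.ρ (coordInv E.toChart (t, yCoord E.toChart (S.ι x))) - t) / t ^ 2)
      (𝓝[>] 0) (𝓝 (-E.jetCoord x)) := by
  have h1 := tendsto_slice_jetCoord E.mem_maximalAtlas hx hx
  have h2 := h1.sub (((tendsto_ρ_slice_div hx).pow 2).const_mul (E.jetCoord x))
  rw [one_pow, mul_one, zero_sub] at h2
  refine h2.congr' ?_
  filter_upwards [self_mem_nhdsWithin, rhoCoord_slice
    (S.zero_yCoord_mem E.mem_maximalAtlas hx (mem_univ _)) isOpen_univ] with t ht hr
  have : t ≠ 0 := ne_of_gt ht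
  rw [hr]
  field_simp
  ring

/-- Both coordinates are compared with the fixed `ρ`. The difference of their jet coordinates is
thus the function `κ` of the change of charts. -/
theorem tendsto_rhoCoord_slice {x : B} (hx : S.ι x ∈ E.toChart.source)
    (hx' : S.ι x ∈ E'.toChart.source) :
    Tendsto (fun t => (rhoCoord E'.toChart
      (coordInv E.toChart (t, yCoord E.toChart (S.ι x))) - t) / t ^ 2)
      (𝓝[>] 0) (𝓝 (E'.jetCoord x - E.jetCoord x)) := by
  have h1 := tendsto_slice_jetCoord E.mem_maximalAtlas hx' hx
  have h2 := ((tendsto_ρ_slice hx).sub h1).add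
    (((tendsto_ρ_slice_div hx).pow 2).const_mul (E'.jetCoord x))
  rw [one_pow, mul_one, sub_zero, neg_add_eq_sub] at h2
  refine h2.congr' ?_
  filter_upwards [self_mem_nhdsWithin] with t ht
  have : t ≠ 0 := ne_of_gt ht
  field_simp
  ring

variable (E) in
/-- The chart of the boundary induced by a Beig–Schmidt chart. -/
abbrev bdry [Nonempty B] : OpenPartialHomeomorph B (EuclideanSpace ℝ (Fin n)) :=
  S.bdryChart E.toChart E.mem_maximalAtlas

/-- `jetCoord` is chosen point by point, but `-jetCoord` is the quadratic transverse coefficient of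
the smooth function `ρ` in the chart, so it is smooth in `y`. -/
theorem contDiffOn_jetCoord [Nonempty B] :
    ContDiffOn ℝ ∞ (fun y => E.jetCoord (E.bdry.symm y)) (S.bdryTarget E.toChart) := by
  have he := E.mem_maximalAtlas
  rw [S.bdryTarget_eq he]
  have h := contDiffOn_secondCoefficient (κ := fun y => -E.jetCoord (E.bdry.symm y))
    (isOpen_coordDom isOpen_univ) (contDiffOn_ρ_coordInv (S := S) he) ?_ ?_
  · simpa using h.neg
  all_goals
    intro y hy
    obtain ⟨x, hx, -, rfl⟩ := S.exists_boundary_point he hy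
  · rw [S.coordInv_zero_yCoord he hx, S.ρ_eq_zero]
  · have : E.bdry.symm (yCoord E.toChart (S.ι x)) = x := E.bdry.left_inv hx
    rw [this]
    exact tendsto_ρ_slice hx

/-! ### The boundary metric in coordinates -/

variable (E) in
/-- The boundary metric in coordinates. -/
def hForm (y : EuclideanSpace ℝ (Fin n)) :
    EuclideanSpace ℝ (Fin n) →L[ℝ] EuclideanSpace ℝ (Fin n) →L[ℝ] ℝ :=
  matForm n (E.h y)

variable (E) in
/-- The tensor `k` in coordinates. -/
def kForm (y : EuclideanSpace ℝ (Fin n)) :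
    EuclideanSpace ℝ (Fin n) →L[ℝ] EuclideanSpace ℝ (Fin n) →L[ℝ] ℝ :=
  matForm n (E.k y)

theorem contDiffOn_hForm : ContDiffOn ℝ ∞ E.hForm (S.bdryTarget E.toChart) :=
  ContDiffOn.matForm E.contDiffOn_h

theorem contDiffOn_kForm : ContDiffOn ℝ ∞ E.kForm (S.bdryTarget E.toChart) :=
  ContDiffOn.matForm E.contDiffOn_k

variable (E) in
/-- The differential of the boundary coordinates. -/
def bdryDeriv (x : B) : TangentSpace (𝓡 n) x →L[ℝ] EuclideanSpace ℝ (Fin n) :=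
  mfderiv (𝓡 n) 𝓘(ℝ, EuclideanSpace ℝ (Fin n)) (fun z => yCoord E.toChart (S.ι z)) x

theorem isInvertible_bdryDeriv {x : B} (hx : S.ι x ∈ E.toChart.source) :
    (E.bdryDeriv x).IsInvertible := by
  have : Nonempty B := ⟨x⟩
  have hm := E.mem_maximalAtlas
  have h : E.bdry.MDifferentiable (𝓡 n) (𝓡 n) :=
    ⟨(S.contMDiffOn_yCoord_ι hm).mdifferentiableOn (by simp),
      (S.contMDiffOn_bdryChart_symm hm).mdifferentiableOn (by simp)⟩
  exact ⟨h.mfderiv hx, rfl⟩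

/-- Extends `h_eq` from coordinate vectors by bilinearity, so that symmetry, nondegeneracy and chart
changes of the coordinate form can be deduced from the tensor on the boundary. -/
theorem hForm_bdryDeriv {x : B} (hx : S.ι x ∈ E.toChart.source) (v w : TangentSpace (𝓡 n) x) :
    E.hForm (yCoord E.toChart (S.ι x)) (E.bdryDeriv x v) (E.bdryDeriv x w) = S.h x v w := by
  have hinv := isInvertible_bdryDeriv hx
  let H : EuclideanSpace ℝ (Fin n) →L[ℝ] EuclideanSpace ℝ (Fin n) →L[ℝ] ℝ := S.h x
  let D : EuclideanSpace ℝ (Fin n) →L[ℝ] EuclideanSpace ℝ (Fin n) := (E.bdryDeriv x).inverse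
  have h1 : H.bilinearComp D D = E.hForm (yCoord E.toChart (S.ι x)) :=
    matForm_eq fun α β => (E.h_eq x hx α β).symm
  have h2 : ∀ v, D (E.bdryDeriv x v) = v := fun v =>
    congrArg (fun L : TangentSpace (𝓡 n) x →L[ℝ] TangentSpace (𝓡 n) x => L v)
      hinv.inverse_comp_self
  rw [← h1, ContinuousLinearMap.bilinearComp_apply, h2, h2]
  rfl

theorem exists_bdryDeriv_eq {x : B} (hx : S.ι x ∈ E.toChart.source)
    (a : EuclideanSpace ℝ (Fin n)) : ∃ v, E.bdryDeriv x v = a :=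
  (isInvertible_bdryDeriv hx).bijective.surjective a

theorem _root_.InfinityData.h_symm (S : InfinityData n M B) (x : B) (v w : TangentSpace (𝓡 n) x) :
    S.h x v w = S.h x w v := by
  rcases S.signature with ⟨-, h⟩ | ⟨-, h⟩
  · exact (h x).1 v w
  · exact (h x).1 v w

/-- In the Lorentzian case a vector orthogonal to everything is orthogonal to the time-like `u`,
hence has positive square unless it vanishes, while its square is zero. -/
theorem _root_.InfinityData.h_nondegenerate (S : InfinityData n M B) (x : B)
    (v : TangentSpace (𝓡 n) x) (hv : ∀ w, S.h x v w = 0) : v = 0 := by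
  by_contra hne
  rcases S.signature with ⟨-, h⟩ | ⟨-, h⟩
  · exact (h x).2 v hne |>.ne' (hv v)
  · obtain ⟨hs, u, hu, hpos⟩ := h x
    exact (hpos v (by rw [hs]; exact hv u) hne).ne' (hv v)

theorem hForm_symm {y : EuclideanSpace ℝ (Fin n)} (hy : y ∈ S.bdryTarget E.toChart)
    (v w : EuclideanSpace ℝ (Fin n)) : E.hForm y v w = E.hForm y w v := by
  obtain ⟨x, hx, rfl⟩ := hy
  obtain ⟨v, rfl⟩ := exists_bdryDeriv_eq hx v
  obtain ⟨w, rfl⟩ := exists_bdryDeriv_eq hx w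
  rw [hForm_bdryDeriv hx, hForm_bdryDeriv hx, S.h_symm]

theorem hForm_nondegenerate {y : EuclideanSpace ℝ (Fin n)} (hy : y ∈ S.bdryTarget E.toChart)
    (v : EuclideanSpace ℝ (Fin n)) (hv : ∀ w, E.hForm y v w = 0) : v = 0 := by
  obtain ⟨x, hx, rfl⟩ := hy
  obtain ⟨v, rfl⟩ := exists_bdryDeriv_eq hx v
  rw [S.h_nondegenerate x v fun w => by rw [← hForm_bdryDeriv hx]; exact hv _, map_zero]

/-! ### Christoffel symbols -/

theorem isUnit_det_h {y : EuclideanSpace ℝ (Fin n)} (hy : y ∈ S.bdryTarget E.toChart) :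
    IsUnit (E.h y).det := by
  rw [isUnit_iff_ne_zero]
  intro h0
  obtain ⟨v, hv0, hv⟩ := Matrix.exists_vecMul_eq_zero_iff.2 h0
  refine hv0 ?_
  have h1 := hForm_nondegenerate hy (WithLp.toLp 2 v) fun w => ?_
  · simpa using h1
  · refine (matForm_apply (E.h y) _ w).trans ?_
    rw [Finset.sum_comm]
    refine Finset.sum_eq_zero fun β _ => ?_
    have h2 := congrFun hv β
    simp only [Matrix.vecMul, dotProduct, Pi.zero_apply] at h2
    rw [← Finset.sum_mul]
    convert zero_mul (w β)
    rw [← h2]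
    exact Finset.sum_congr rfl fun α _ => mul_comm _ _

end BeigSchmidtChart

end InfinityData

/-! ### More on one-sided expansions -/

section RightExpansion

variable {F G : Type*} [NormedAddCommGroup F] [NormedSpace ℝ F]
  [NormedAddCommGroup G] [NormedSpace ℝ G]

namespace HasRightExpansion

/-- An expansion ignores the value of `f` at `0`. Resetting that value to `a` turns the expansion
into a one-sided derivative, to which the chain rule applies. -/
theorem hasDerivWithinAt_update {f : ℝ → F} {a b : F} (h : HasRightExpansion f a b) :
    HasDerivWithinAt (Function.update f 0 a) b (Ioi 0) 0 := by
  rw [hasDerivWithinAt_iff_tendsto_slope' self_notMem_Ioi]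
  refine Tendsto.congr' ?_ h
  filter_upwards [self_mem_nhdsWithin] with t ht
  rw [slope_def_module, sub_zero, Function.update_self, Function.update_of_ne (ne_of_gt ht)]

theorem comp_hasFDerivAt {f : F → G} {f' : F →L[ℝ] G} {y : ℝ → F} {a b : F}
    (hf : HasFDerivAt f f' a) (hy : HasRightExpansion y a b) :
    HasRightExpansion (fun t => f (y t)) (f a) (f' b) := by
  have h1 := hy.hasDerivWithinAt_update
  have h2 : HasFDerivAt f f' (Function.update y 0 a 0) := by rwa [Function.update_self]
  have h3 := (h2.comp_hasDerivWithinAt (0 : ℝ) h1).hasRightExpansion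
  simp only [Function.comp_apply, Function.update_self] at h3
  refine h3.congr' ?_
  filter_upwards [self_mem_nhdsWithin] with t ht
  have ht0 : t ≠ 0 := ne_of_gt (mem_Ioi.1 ht)
  simp only [Function.comp_apply, Function.update_of_ne ht0]

theorem of_tendsto_div {r : ℝ → ℝ} {κ : ℝ}
    (hr : Tendsto (fun t => (r t - t) / t ^ 2) (𝓝[>] 0) (𝓝 κ)) : HasRightExpansion r 0 1 := by
  refine (hasRightExpansion_div hr).tendsto.congr fun t => ?_
  rw [sub_zero, smul_eq_mul, div_eq_inv_mul]

/-- The logarithmic remainder is negligible at first order: `r / t → 1` and `r log r → 0`. -/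
theorem zero_of_isBigO {r f : ℝ → ℝ} (hr : HasRightExpansion r 0 1)
    (hf : f =O[𝓝[>] 0] fun t => r t ^ 2 * Real.log (r t)) : HasRightExpansion f 0 0 := by
  have h1 : Tendsto (fun t => r t * Real.log (r t)) (𝓝[>] 0) (𝓝 0) := by
    have h := (Real.continuous_mul_log.tendsto 0).comp hr.tendsto
    simpa [Function.comp_def] using h
  have h2 := Tendsto.mul hr h1
  have h3 : (fun t : ℝ => t⁻¹ • (f t - 0)) =O[𝓝[>] 0]
      fun t => t⁻¹ • (r t - 0) * (r t * Real.log (r t)) := by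
    refine ((isBigO_refl (fun t : ℝ => t⁻¹) _).mul hf).congr (fun t => ?_) fun t => ?_
    · simp
    · simp only [smul_eq_mul]
      ring
  rw [mul_zero] at h2
  exact h3.trans_tendsto h2

theorem of_isBigO_sub {r f g : ℝ → ℝ} {a b : ℝ} (hr : HasRightExpansion r 0 1)
    (hg : HasRightExpansion g a b)
    (hf : (fun t => f t - g t) =O[𝓝[>] 0] fun t => r t ^ 2 * Real.log (r t)) :
    HasRightExpansion f a b := by
  have h := hg.add (hr.zero_of_isBigO hf)
  simpa using h

end HasRightExpansion

end RightExpansion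

namespace InfinityData

variable {n : ℕ} {M B : Type*}
    [TopologicalSpace M] [ChartedSpace (EuclideanHalfSpace (n + 1)) M]
    [IsManifold (𝓡∂ (n + 1)) ∞ M]
    [TopologicalSpace B] [ChartedSpace (EuclideanSpace ℝ (Fin n)) B]
    [IsManifold (𝓡 n) ∞ B]
    {e e' : OpenPartialHomeomorph M (EuclideanHalfSpace (n + 1))} {W : Set M}

/-! ### The physical metric in coordinates `(ρ, y)` -/

theorem isInvertible_mfderiv_extend (he : e ∈ IsManifold.maximalAtlas (𝓡∂ (n + 1)) ∞ M) {p : M}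
    (hp : p ∈ e.source) :
    (mfderiv (𝓡∂ (n + 1)) 𝓘(ℝ, EuclideanSpace ℝ (Fin (n + 1))) (e.extend (𝓡∂ (n + 1)))
      p).IsInvertible := by
  have h : e.MDifferentiable (𝓡∂ (n + 1)) (𝓡∂ (n + 1)) :=
    ⟨(contMDiffOn_of_mem_maximalAtlas he).mdifferentiableOn (by simp),
      (contMDiffOn_symm_of_mem_maximalAtlas he).mdifferentiableOn (by simp)⟩
  have h1 : HasMFDerivAt (𝓡∂ (n + 1)) 𝓘(ℝ, EuclideanSpace ℝ (Fin (n + 1)))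
      (e.extend (𝓡∂ (n + 1))) p _ :=
    ((𝓡∂ (n + 1)).hasMFDerivAt (x := e p)).comp p (h.mdifferentiableAt hp).hasMFDerivAt
  rw [h1.mfderiv]
  exact ⟨h.mfderiv hp, rfl⟩

theorem hasMFDerivAt_coordInv (he : e ∈ IsManifold.maximalAtlas (𝓡∂ (n + 1)) ∞ M)
    (hW : IsOpen W) {z : ℝ × EuclideanSpace ℝ (Fin n)} (hz : z ∈ coordDom e W) (hpos : 0 < z.1) :
    MDifferentiableAt 𝓘(ℝ, ℝ × EuclideanSpace ℝ (Fin n)) (𝓡∂ (n + 1)) (coordInv e) z := by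
  have h : halfProd _ ∩ coordDom e W ∈ 𝓝 z := by
    refine inter_mem (mem_interior_iff_mem_nhds.1 ?_) ((isOpen_coordDom hW).mem_nhds hz)
    rw [interior_halfProd]
    exact ⟨hpos, trivial⟩
  exact ((contMDiffOn_coordInv he).contMDiffAt h).mdifferentiableAt (by simp)

theorem halfDeriv_coord_coordInv (he : e ∈ IsManifold.maximalAtlas (𝓡∂ (n + 1)) ∞ M)
    (he' : e' ∈ IsManifold.maximalAtlas (𝓡∂ (n + 1)) ∞ M)
    {z : ℝ × EuclideanSpace ℝ (Fin n)} (hz : z ∈ coordDom e e'.source) (hpos : 0 < z.1)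
    (v : ℝ × EuclideanSpace ℝ (Fin n)) :
    euclideanCons n (halfDeriv v (fun z => coord e' (coordInv e z)) z) =
      mfderiv (𝓡∂ (n + 1)) 𝓘(ℝ, EuclideanSpace ℝ (Fin (n + 1))) (e'.extend (𝓡∂ (n + 1)))
        (coordInv e z)
        (mfderiv 𝓘(ℝ, ℝ × EuclideanSpace ℝ (Fin n)) (𝓡∂ (n + 1)) (coordInv e) z v) := by
  have h1 := (hasMFDerivAt_coordInv he e'.open_source hz hpos).hasMFDerivAt
  have h2 := (((e'.contMDiffOn_extend he').contMDiffAt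
    (e'.open_source.mem_nhds (coordInv_mem hz))).mdifferentiableAt (by simp)).hasMFDerivAt
  have h3 := (h2.comp z h1).hasFDerivAt
  have h4 := (euclideanCons n).symm.hasFDerivAt.comp z h3
  have h5 : HasFDerivAt (fun z => coord e' (coordInv e z)) _ z := h4
  rw [halfDeriv, h5.hasFDerivWithinAt.fderivWithin
    (uniqueDiffOn_halfProd z (mem_halfProd.2 hpos.le))]
  exact (euclideanCons n).apply_symm_apply _

theorem halfDeriv_coord_coordInv_self {z : ℝ × EuclideanSpace ℝ (Fin n)}
    (hz : z ∈ coordDom e e.source) (hpos : 0 < z.1) (v : ℝ × EuclideanSpace ℝ (Fin n)) :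
    halfDeriv v (fun z => coord e (coordInv e z)) z = v := by
  have h : HasFDerivAt (fun z => coord e (coordInv e z)) (ContinuousLinearMap.id ℝ _) z := by
    refine (hasFDerivAt_id z).congr_of_eventuallyEq ?_
    filter_upwards [(isOpen_coordDom e.open_source).mem_nhds hz,
      (isOpen_lt continuous_const continuous_fst).mem_nhds hpos] with w hw hw'
    exact coord_coordInv (mem_halfProd.2 hw'.le) hw
  rw [halfDeriv, h.hasFDerivWithinAt.fderivWithin
    (uniqueDiffOn_halfProd z (mem_halfProd.2 hpos.le))]
  rfl

/-- The tangent vector with given components in the coordinates `(ρ, y)`. -/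
def coordFrame (e : OpenPartialHomeomorph M (EuclideanHalfSpace (n + 1))) (p : M) :
    (ℝ × EuclideanSpace ℝ (Fin n)) →L[ℝ] EuclideanSpace ℝ (Fin (n + 1)) :=
  ContinuousLinearMap.comp (mfderiv (𝓡∂ (n + 1)) 𝓘(ℝ, EuclideanSpace ℝ (Fin (n + 1)))
    (e.extend (𝓡∂ (n + 1))) p).inverse (euclideanCons n).toContinuousLinearMap

theorem coordFrame_eq (he : e ∈ IsManifold.maximalAtlas (𝓡∂ (n + 1)) ∞ M)
    (he' : e' ∈ IsManifold.maximalAtlas (𝓡∂ (n + 1)) ∞ M)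
    {z : ℝ × EuclideanSpace ℝ (Fin n)} (hz : z ∈ coordDom e e'.source) (hpos : 0 < z.1)
    (v : ℝ × EuclideanSpace ℝ (Fin n)) :
    coordFrame e' (coordInv e z) (halfDeriv v (fun z => coord e' (coordInv e z)) z) =
      mfderiv 𝓘(ℝ, ℝ × EuclideanSpace ℝ (Fin n)) (𝓡∂ (n + 1)) (coordInv e) z v := by
  have h1 := isInvertible_mfderiv_extend he' (coordInv_mem hz)
  change (mfderiv (𝓡∂ (n + 1)) 𝓘(ℝ, EuclideanSpace ℝ (Fin (n + 1)))
    (e'.extend (𝓡∂ (n + 1))) _).inverse (euclideanCons n _) = _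
  rw [halfDeriv_coord_coordInv he he' hz hpos]
  exact congrArg (fun L : TangentSpace (𝓡∂ (n + 1)) (coordInv e z) →L[ℝ]
    TangentSpace (𝓡∂ (n + 1)) (coordInv e z) => L (mfderiv 𝓘(ℝ, ℝ × EuclideanSpace ℝ (Fin n))
      (𝓡∂ (n + 1)) (coordInv e) z v)) h1.inverse_comp_self

/-- At interior points the coordinate frames of two charts differ by the Jacobian of the change of
charts. Nothing is claimed at `t = 0`, as the physical metric is only controlled in the interior. -/
theorem coordFrame_transform (he : e ∈ IsManifold.maximalAtlas (𝓡∂ (n + 1)) ∞ M)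
    (he' : e' ∈ IsManifold.maximalAtlas (𝓡∂ (n + 1)) ∞ M)
    {z : ℝ × EuclideanSpace ℝ (Fin n)} (hz : z ∈ coordDom e e'.source) (hpos : 0 < z.1)
    (v : ℝ × EuclideanSpace ℝ (Fin n)) :
    coordFrame e (coordInv e z) v = coordFrame e' (coordInv e z)
      (halfDeriv v (fun z => coord e' (coordInv e z)) z) := by
  have hze : z ∈ coordDom e e.source := ⟨hz.1, coordInv_mem_source hz⟩
  rw [coordFrame_eq he he' hz hpos, ← coordFrame_eq he he hze hpos,
    halfDeriv_coord_coordInv_self hze hpos]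

variable (S : InfinityData n M B)

/-- The physical metric at a point as a form on the model space. -/
def metricVal (p : M) : EuclideanSpace ℝ (Fin (n + 1)) →L[ℝ] EuclideanSpace ℝ (Fin (n + 1)) →L[ℝ] ℝ :=
  S.metric p

/-- The physical metric in the coordinates `(ρ, y)`. -/
def metricForm (e : OpenPartialHomeomorph M (EuclideanHalfSpace (n + 1))) (p : M) :
    (ℝ × EuclideanSpace ℝ (Fin n)) →L[ℝ] (ℝ × EuclideanSpace ℝ (Fin n)) →L[ℝ] ℝ :=
  (S.metricVal p).bilinearComp (coordFrame e p) (coordFrame e p)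

theorem metricForm_eq_metricVal (p : M) (v w : ℝ × EuclideanSpace ℝ (Fin n)) :
    S.metricForm e p v w = S.metricVal p (coordFrame e p v) (coordFrame e p w) := rfl

theorem coordFrame_normal (p : M) : coordFrame e p (1, 0) = coordVec e 0 p :=
  congrArg (mfderiv (𝓡∂ (n + 1)) 𝓘(ℝ, EuclideanSpace ℝ (Fin (n + 1)))
    (e.extend (𝓡∂ (n + 1))) p).inverse euclideanCons_single_zero

theorem coordFrame_tangential (p : M) (α : Fin n) :
    coordFrame e p (0, EuclideanSpace.single α 1) = coordVec e α.succ p :=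
  congrArg (mfderiv (𝓡∂ (n + 1)) 𝓘(ℝ, EuclideanSpace ℝ (Fin (n + 1)))
    (e.extend (𝓡∂ (n + 1))) p).inverse (euclideanCons_single_succ α)

theorem metricForm_transform (he : e ∈ IsManifold.maximalAtlas (𝓡∂ (n + 1)) ∞ M)
    (he' : e' ∈ IsManifold.maximalAtlas (𝓡∂ (n + 1)) ∞ M)
    {z : ℝ × EuclideanSpace ℝ (Fin n)} (hz : z ∈ coordDom e e'.source) (hpos : 0 < z.1)
    (v w : ℝ × EuclideanSpace ℝ (Fin n)) :
    S.metricForm e (coordInv e z) v w = S.metricForm e' (coordInv e z)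
      (halfDeriv v (fun z => coord e' (coordInv e z)) z)
      (halfDeriv w (fun z => coord e' (coordInv e z)) z) := by
  rw [metricForm_eq_metricVal, metricForm_eq_metricVal,
    coordFrame_transform he he' hz hpos v, coordFrame_transform he he' hz hpos w]

theorem metricForm_symm {p : M} (hp : p ∈ (𝓡∂ (n + 1)).interior M)
    (v w : ℝ × EuclideanSpace ℝ (Fin n)) : S.metricForm e p v w = S.metricForm e p w v :=
  (S.isLorentzianForm_metric p hp).1 _ _

/-- The component `g_ρρ`. -/
def metricNN (e : OpenPartialHomeomorph M (EuclideanHalfSpace (n + 1))) (p : M) : ℝ :=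
  S.metricForm e p (1, 0) (1, 0)

/-- The components `g_ρα`. -/
def metricNT (e : OpenPartialHomeomorph M (EuclideanHalfSpace (n + 1))) (p : M) :
    EuclideanSpace ℝ (Fin n) →L[ℝ] ℝ :=
  (S.metricForm e p (1, 0)).comp (ContinuousLinearMap.inr ℝ ℝ (EuclideanSpace ℝ (Fin n)))

/-- The components `g_αβ`. -/
def metricTT (e : OpenPartialHomeomorph M (EuclideanHalfSpace (n + 1))) (p : M) :
    EuclideanSpace ℝ (Fin n) →L[ℝ] EuclideanSpace ℝ (Fin n) →L[ℝ] ℝ :=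
  (S.metricForm e p).bilinearComp (ContinuousLinearMap.inr ℝ ℝ (EuclideanSpace ℝ (Fin n)))
    (ContinuousLinearMap.inr ℝ ℝ (EuclideanSpace ℝ (Fin n)))

theorem metricForm_apply {p : M} (hp : p ∈ (𝓡∂ (n + 1)).interior M)
    (v w : ℝ × EuclideanSpace ℝ (Fin n)) :
    S.metricForm e p v w = v.1 * w.1 * S.metricNN e p + v.1 * S.metricNT e p w.2
      + w.1 * S.metricNT e p v.2 + S.metricTT e p v.2 w.2 := by
  have h : ∀ v : ℝ × EuclideanSpace ℝ (Fin n), v = v.1 • ((1 : ℝ), (0 : EuclideanSpace ℝ (Fin n)))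
      + (0, v.2) := fun v => by ext <;> simp
  conv_lhs => rw [h v, h w]
  simp only [map_add, map_smul, add_apply, smul_apply, smul_eq_mul, metricNN, metricNT, metricTT,
    ContinuousLinearMap.comp_apply, ContinuousLinearMap.bilinearComp_apply,
    ContinuousLinearMap.inr_apply]
  rw [S.metricForm_symm hp (0, v.2) (1, 0)]
  ring

theorem metricNN_eq (p : M) : S.metricNN e p = S.metricComp e 0 0 p := by
  rw [metricNN, metricForm_eq_metricVal, coordFrame_normal]
  rfl

theorem metricNT_single (p : M) (α : Fin n) :
    S.metricNT e p (EuclideanSpace.single α 1) = S.metricComp e 0 α.succ p := by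
  change S.metricForm e p (1, 0) (0, EuclideanSpace.single α 1) = _
  rw [metricForm_eq_metricVal, coordFrame_normal, coordFrame_tangential]
  rfl

theorem metricTT_eq (p : M) :
    S.metricTT e p = matForm n fun α β => S.metricComp e α.succ β.succ p := by
  refine matForm_eq fun α β => ?_
  change S.metricForm e p (0, EuclideanSpace.single α 1) (0, EuclideanSpace.single β 1) = _
  rw [metricForm_eq_metricVal, coordFrame_tangential, coordFrame_tangential]
  rfl

end InfinityData

theorem tendsto_sum_smul_const {n : ℕ} {F : Type*} [NormedAddCommGroup F] [NormedSpace ℝ F]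
    {l : Filter ℝ} {A : ℝ → Fin n → ℝ} (h : ∀ α, Tendsto (fun t => A t α) l (𝓝 0))
    (b : Fin n → F) : Tendsto (fun t => ∑ α, A t α • b α) l (𝓝 0) := by
  have h1 := tendsto_finsetSum (Finset.univ : Finset (Fin n)) fun α _ => (h α).smul_const (b α)
  simpa using h1

namespace InfinityData

variable {n : ℕ} {M B : Type*}
    [TopologicalSpace M] [ChartedSpace (EuclideanHalfSpace (n + 1)) M]
    [IsManifold (𝓡∂ (n + 1)) ∞ M]
    [TopologicalSpace B] [ChartedSpace (EuclideanSpace ℝ (Fin n)) B]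
    [IsManifold (𝓡 n) ∞ B]
    {S : InfinityData n M B}

namespace BeigSchmidtChart

variable {E E' : S.BeigSchmidtChart}

/-! ### The metric along curves ending on the boundary -/

section Curve

variable {x : B} {c : ℝ → M} {η : EuclideanSpace ℝ (Fin n)}

theorem isOpen_target_nhds (hx : S.ι x ∈ E.toChart.source) :
    S.bdryTarget E.toChart ∈ 𝓝 (yCoord E.toChart (S.ι x)) :=
  (S.isOpen_bdryTarget E.mem_maximalAtlas).mem_nhds ⟨x, hx, rfl⟩

variable (E) in
theorem hForm_single (y : EuclideanSpace ℝ (Fin n)) (α β : Fin n) :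
    E.hForm y (EuclideanSpace.single α 1) (EuclideanSpace.single β 1) = E.h y α β :=
  matForm_single _ _ _

variable (E) in
theorem kForm_single (y : EuclideanSpace ℝ (Fin n)) (α β : Fin n) :
    E.kForm y (EuclideanSpace.single α 1) (EuclideanSpace.single β 1) = E.k y α β :=
  matForm_single _ _ _

theorem differentiableAt_hForm {y : EuclideanSpace ℝ (Fin n)} (hy : y ∈ S.bdryTarget E.toChart) :
    DifferentiableAt ℝ E.hForm y :=
  (E.contDiffOn_hForm.contDiffAt ((S.isOpen_bdryTarget
    E.mem_maximalAtlas).mem_nhds hy)).differentiableAt (by simp)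

theorem hasFDerivAt_hForm_apply {y : EuclideanSpace ℝ (Fin n)} (hy : y ∈ S.bdryTarget E.toChart)
    (v w : EuclideanSpace ℝ (Fin n)) :
    HasFDerivAt (fun y => E.hForm y v w) (((fderiv ℝ E.hForm y).flip v).flip w) y := by
  have h4 := (differentiableAt_hForm hy).hasFDerivAt
  simpa using! (h4.clm_apply (hasFDerivAt_const v y)).clm_apply (hasFDerivAt_const w y)

theorem fderiv_hForm_single {y : EuclideanSpace ℝ (Fin n)} (hy : y ∈ S.bdryTarget E.toChart)
    (v : EuclideanSpace ℝ (Fin n)) (α β : Fin n) :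
    fderiv ℝ E.hForm y v (EuclideanSpace.single α 1) (EuclideanSpace.single β 1)
      = fderiv ℝ (fun y => E.h y α β) y v := by
  have h3 := hasFDerivAt_hForm_apply hy (EuclideanSpace.single α 1) (EuclideanSpace.single β 1)
  have h5 : (fun y => E.hForm y (EuclideanSpace.single α 1) (EuclideanSpace.single β 1))
      = fun y => E.h y α β := funext fun y => hForm_single E y α β
  rw [h5] at h3
  rw [h3.fderiv]
  rfl

/-- The curve `c` is arbitrary so that the expansions of a chart can be used both along its own
transverse lines, where `η = 0`, and along those of another chart. -/
theorem hasRightExpansion_metricNN (hx : S.ι x ∈ E.toChart.source)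
    (hc : Tendsto c (𝓝[>] 0) (𝓝[(𝓡∂ (n + 1)).interior M] S.ι x))
    (hr : HasRightExpansion (fun t => rhoCoord E.toChart (c t)) 0 1)
    (hy : HasRightExpansion (fun t => yCoord E.toChart (c t)) (yCoord E.toChart (S.ι x)) η) :
    HasRightExpansion
      (fun t => S.ν₀ * rhoCoord E.toChart (c t) ^ 4 * S.metricNN E.toChart (c t)) 1
      (2 * E.σ (yCoord E.toChart (S.ι x))) := by
  have hσ := HasRightExpansion.comp_hasFDerivAt ((E.contDiffOn_σ.contDiffAt
    (isOpen_target_nhds hx)).differentiableAt (by simp)).hasFDerivAt hy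
  have h1 := hr.mul hσ
  have h2 := (((HasRightExpansion.const (1 : ℝ)).add
    ((HasRightExpansion.const (2 : ℝ)).mul h1)).add (h1.mul h1))
  -- One power of `ρ` is given up, so that this remainder has the same form as those of the other
  -- components.
  have hO : (fun t => rhoCoord E.toChart (c t) ^ 3 * Real.log (rhoCoord E.toChart (c t)))
      =O[𝓝[>] 0] fun t => rhoCoord E.toChart (c t) ^ 2 * Real.log (rhoCoord E.toChart (c t)) := by
    have h := (hr.tendsto.isBigO_one ℝ).mul (isBigO_refl (fun t => rhoCoord E.toChart (c t) ^ 2 *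
      Real.log (rhoCoord E.toChart (c t))) (𝓝[>] 0))
    exact h.congr (fun t => by ring) fun t => one_mul _
  have h3 := hr.of_isBigO_sub h2 (f := fun t => S.ν₀ * rhoCoord E.toChart (c t) ^ 4 *
    S.metricNN E.toChart (c t)) ?_
  · convert h3 using 1 <;> ring
  · refine IsBigO.trans (((E.expansion_rho_rho x hx).comp_tendsto hc).congr (fun t => ?_)
      fun t => rfl) hO
    simp only [Function.comp_apply, metricNN_eq]
    ring

theorem tendsto_metricNT (hx : S.ι x ∈ E.toChart.source)
    (hc : Tendsto c (𝓝[>] 0) (𝓝[(𝓡∂ (n + 1)).interior M] S.ι x))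
    (hr : HasRightExpansion (fun t => rhoCoord E.toChart (c t)) 0 1) :
    Tendsto (fun t => rhoCoord E.toChart (c t) ^ 2 • S.metricNT E.toChart (c t)) (𝓝[>] 0)
      (𝓝 0) := by
  refine (tendsto_sum_smul_const (A := fun t α => rhoCoord E.toChart (c t) ^ 2 *
    S.metricComp E.toChart 0 α.succ (c t)) (fun α => (hr.zero_of_isBigO
      ((E.expansion_rho_y x hx α).comp_tendsto hc)).tendsto)
    fun α => (EuclideanSpace.proj α : EuclideanSpace ℝ (Fin n) →L[ℝ] ℝ)).congr fun t => ?_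
  refine clm_ext_single fun α => ?_
  rw [smul_apply, metricNT_single, sum_apply,
    Finset.sum_eq_single α] <;> simp +contextual

/-- The curve drifts tangentially with velocity `η`; the point at which `h` is evaluated moves
along, and this adds the derivative of `h` along `η` to `k - 2σh`. -/
theorem hasRightExpansion_metricTT (hx : S.ι x ∈ E.toChart.source)
    (hc : Tendsto c (𝓝[>] 0) (𝓝[(𝓡∂ (n + 1)).interior M] S.ι x))
    (hr : HasRightExpansion (fun t => rhoCoord E.toChart (c t)) 0 1)
    (hy : HasRightExpansion (fun t => yCoord E.toChart (c t)) (yCoord E.toChart (S.ι x)) η) :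
    HasRightExpansion (fun t => rhoCoord E.toChart (c t) ^ 2 • S.metricTT E.toChart (c t))
      (E.hForm (yCoord E.toChart (S.ι x)))
      (fderiv ℝ E.hForm (yCoord E.toChart (S.ι x)) η + (E.kForm (yCoord E.toChart (S.ι x))
        - (2 * E.σ (yCoord E.toChart (S.ι x))) • E.hForm (yCoord E.toChart (S.ι x)))) := by
  have hmem := isOpen_target_nhds hx
  have hσ := HasRightExpansion.comp_hasFDerivAt ((E.contDiffOn_σ.contDiffAt
    hmem).differentiableAt (by simp)).hasFDerivAt hy
  have hk := fun α β => HasRightExpansion.comp_hasFDerivAt (((E.contDiffOn_k α β).contDiffAt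
    hmem).differentiableAt (by simp)).hasFDerivAt hy
  have hh := fun α β => HasRightExpansion.comp_hasFDerivAt (((E.contDiffOn_h α β).contDiffAt
    hmem).differentiableAt (by simp)).hasFDerivAt hy
  have key : ∀ α β, HasRightExpansion (fun t => rhoCoord E.toChart (c t) ^ 2 *
      S.metricComp E.toChart α.succ β.succ (c t)) (E.h (yCoord E.toChart (S.ι x)) α β)
      (fderiv ℝ (fun y => E.h y α β) (yCoord E.toChart (S.ι x)) η
        + (E.k (yCoord E.toChart (S.ι x)) α β - 2 * E.σ (yCoord E.toChart (S.ι x)) *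
          E.h (yCoord E.toChart (S.ι x)) α β)) := by
    intro α β
    have h1 := (hh α β).add (hr.mul ((hk α β).add
      (((HasRightExpansion.const (-2 : ℝ)).mul hσ).mul (hh α β))))
    have h2 := hr.of_isBigO_sub h1 (f := fun t => rhoCoord E.toChart (c t) ^ 2 *
      S.metricComp E.toChart α.succ β.succ (c t)) ?_
    · convert h2 using 1 <;> ring
    · refine ((E.expansion_y_y x hx α β).comp_tendsto hc).congr (fun t => ?_) fun t => rfl
      simp only [Function.comp_apply]
      ring
  have h := HasRightExpansion.matForm key
  have e1 : ∀ t, matForm n (fun α β => rhoCoord E.toChart (c t) ^ 2 *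
      S.metricComp E.toChart α.succ β.succ (c t))
      = rhoCoord E.toChart (c t) ^ 2 • S.metricTT E.toChart (c t) := by
    intro t
    refine (matForm_eq fun α β => ?_).symm
    rw [smul_apply, smul_apply, metricTT_eq, matForm_single, smul_eq_mul]
  simp only [e1] at h
  have e2 : fderiv ℝ E.hForm (yCoord E.toChart (S.ι x)) η + (E.kForm (yCoord E.toChart (S.ι x))
      - (2 * E.σ (yCoord E.toChart (S.ι x))) • E.hForm (yCoord E.toChart (S.ι x)))
      = matForm n fun α β => fderiv ℝ (fun y => E.h y α β) (yCoord E.toChart (S.ι x)) η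
        + (E.k (yCoord E.toChart (S.ι x)) α β - 2 * E.σ (yCoord E.toChart (S.ι x)) *
          E.h (yCoord E.toChart (S.ι x)) α β) :=
    matForm_eq fun α β => by
      have a1 := fderiv_hForm_single (E := E) ⟨x, hx, rfl⟩ η α β
      have a2 := hForm_single E (yCoord E.toChart (S.ι x)) α β
      have a3 := kForm_single E (yCoord E.toChart (S.ι x)) α β
      simp only [add_apply, sub_apply, smul_apply, smul_eq_mul]
      linear_combination a1 + a3 - 2 * E.σ (yCoord E.toChart (S.ι x)) * a2
  rw [e2]
  exact h

end Curve

/-! ### The change of coordinates between two Beig–Schmidt charts -/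

variable (E E') in
/-- The coordinate `ρ` of `E'` in terms of the coordinates of `E`. -/
def transRho (z : ℝ × EuclideanSpace ℝ (Fin n)) : ℝ := rhoCoord E'.toChart (coordInv E.toChart z)

variable (E E') in
/-- The coordinates `y` of `E'` in terms of the coordinates of `E`. -/
def transY (z : ℝ × EuclideanSpace ℝ (Fin n)) : EuclideanSpace ℝ (Fin n) :=
  yCoord E'.toChart (coordInv E.toChart z)

variable (E E') in
/-- The change of the coordinates `y` on the boundary. -/
def bdryTrans (y : EuclideanSpace ℝ (Fin n)) : EuclideanSpace ℝ (Fin n) := E.transY E' (0, y)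

variable (E E') in
/-- The derivative of the coordinates `y` of `E'` with respect to the `ρ` of `E`. -/
def bdryShear (y : EuclideanSpace ℝ (Fin n)) : EuclideanSpace ℝ (Fin n) :=
  halfDeriv (1, 0) (E.transY E') (0, y)

variable (E E') in
/-- The difference of the fibre coordinates of the jets of two Beig–Schmidt coordinates. -/
def jetDiff [Nonempty B] (y : EuclideanSpace ℝ (Fin n)) : ℝ :=
  E'.jetCoord (E.bdry.symm y) - E.jetCoord (E.bdry.symm y)

variable (E E') in
/-- The overlap of two Beig–Schmidt charts in the coordinates of the first. -/
abbrev overlap : Set (ℝ × EuclideanSpace ℝ (Fin n)) := coordDom E.toChart E'.toChart.source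

theorem isOpen_overlap : IsOpen (E.overlap E') := isOpen_coordDom E'.toChart.open_source

theorem contDiffOn_trans : ContDiffOn ℝ ∞ (fun z => coord E'.toChart (coordInv E.toChart z))
    (halfProd _ ∩ E.overlap E') :=
  contDiffOn_comp_coordInv E.mem_maximalAtlas (contMDiffOn_coord E'.mem_maximalAtlas)

theorem contDiffOn_transRho : ContDiffOn ℝ ∞ (E.transRho E') (halfProd _ ∩ E.overlap E') :=
  contDiff_fst.comp_contDiffOn contDiffOn_trans

theorem contDiffOn_transY : ContDiffOn ℝ ∞ (E.transY E') (halfProd _ ∩ E.overlap E') :=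
  contDiff_snd.comp_contDiffOn contDiffOn_trans

theorem halfDeriv_trans {z : ℝ × EuclideanSpace ℝ (Fin n)} (hz : z ∈ halfProd _)
    (hz' : z ∈ E.overlap E') (v : ℝ × EuclideanSpace ℝ (Fin n)) :
    halfDeriv v (fun z => coord E'.toChart (coordInv E.toChart z)) z
      = (halfDeriv v (E.transRho E') z, halfDeriv v (E.transY E') z) := by
  have h1 := hasFDerivWithinAt_halfProd isOpen_overlap (contDiffOn_transRho (E := E) (E' := E'))
    ⟨hz, hz'⟩
  have h2 := hasFDerivWithinAt_halfProd isOpen_overlap (contDiffOn_transY (E := E) (E' := E'))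
    ⟨hz, hz'⟩
  have h3 : HasFDerivWithinAt (fun z => coord E'.toChart (coordInv E.toChart z)) _ (halfProd _) z :=
    h1.prodMk h2
  rw [halfDeriv, h3.fderivWithin (uniqueDiffOn_halfProd z hz)]
  rfl

section

variable {x : B} (hx : S.ι x ∈ E.toChart.source) (hx' : S.ι x ∈ E'.toChart.source)

theorem mem_overlap (hx : S.ι x ∈ E.toChart.source) (hx' : S.ι x ∈ E'.toChart.source) :
    ((0 : ℝ), yCoord E.toChart (S.ι x)) ∈ E.overlap E' :=
  S.zero_yCoord_mem E.mem_maximalAtlas hx hx'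

theorem transRho_zero {y : EuclideanSpace ℝ (Fin n)} (hy : ((0 : ℝ), y) ∈ E.overlap E') :
    E.transRho E' (0, y) = 0 := by
  obtain ⟨x, hx, hx', rfl⟩ := S.exists_boundary_point E.mem_maximalAtlas hy
  rw [transRho, S.coordInv_zero_yCoord E.mem_maximalAtlas hx]
  exact congrArg Prod.fst (S.coord_ι E'.mem_maximalAtlas hx')

theorem bdryTrans_yCoord (hx : S.ι x ∈ E.toChart.source) :
    E.bdryTrans E' (yCoord E.toChart (S.ι x)) = yCoord E'.toChart (S.ι x) := by
  rw [bdryTrans, transY, S.coordInv_zero_yCoord E.mem_maximalAtlas hx]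

theorem tendsto_transRho [Nonempty B] {y : EuclideanSpace ℝ (Fin n)}
    (hy : ((0 : ℝ), y) ∈ E.overlap E') :
    Tendsto (fun t => (E.transRho E' (t, y) - t) / t ^ 2) (𝓝[>] 0) (𝓝 (E.jetDiff E' y)) := by
  obtain ⟨x, hx, hx', rfl⟩ := S.exists_boundary_point E.mem_maximalAtlas hy
  have : E.bdry.symm (yCoord E.toChart (S.ι x)) = x := E.bdry.left_inv hx
  rw [jetDiff, this]
  exact tendsto_rhoCoord_slice hx hx'

theorem isOpen_bdryOverlap : IsOpen {y | ((0 : ℝ), y) ∈ E.overlap E'} :=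
  isOpen_boundarySlice isOpen_overlap

theorem contDiffOn_jetDiff [Nonempty B] :
    ContDiffOn ℝ ∞ (E.jetDiff E') {y | ((0 : ℝ), y) ∈ E.overlap E'} :=
  contDiffOn_secondCoefficient isOpen_overlap contDiffOn_transRho (fun _ => transRho_zero)
    fun _ => tendsto_transRho

theorem contDiffOn_bdryTrans :
    ContDiffOn ℝ ∞ (E.bdryTrans E') {y | ((0 : ℝ), y) ∈ E.overlap E'} :=
  contDiffOn_boundarySlice contDiffOn_transY

theorem contDiffOn_bdryShear :
    ContDiffOn ℝ ∞ (E.bdryShear E') {y | ((0 : ℝ), y) ∈ E.overlap E'} :=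
  contDiffOn_boundarySlice (contDiffOn_transY.halfDeriv isOpen_overlap _)

theorem tendsto_coordInv_slice (hx : S.ι x ∈ E.toChart.source) :
    Tendsto (fun t => coordInv E.toChart (t, yCoord E.toChart (S.ι x))) (𝓝[>] 0)
      (𝓝[(𝓡∂ (n + 1)).interior M] S.ι x) := by
  have he := E.mem_maximalAtlas
  have hz := mem_overlap hx hx
  have hev : ∀ᶠ t in 𝓝[>] (0 : ℝ), 0 < t ∧ (t, yCoord E.toChart (S.ι x)) ∈ E.overlap E := by
    filter_upwards [self_mem_nhdsWithin, nhdsWithin_le_nhds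
      (eventually_mem_of_boundarySlice isOpen_overlap hz)] with t ht h't using ⟨ht, h't⟩
  refine tendsto_nhdsWithin_iff.2 ⟨?_, ?_⟩
  · have h5 := (contMDiffOn_coordInv (W := E.toChart.source) he).continuousOn
      (0, yCoord E.toChart (S.ι x)) ⟨mem_halfProd.2 le_rfl, hz⟩
    rw [← S.coordInv_zero_yCoord he hx]
    rw [ContinuousWithinAt, S.coordInv_zero_yCoord he hx] at h5
    rw [S.coordInv_zero_yCoord he hx]
    refine h5.comp (tendsto_nhdsWithin_iff.2 ⟨?_, ?_⟩)
    · exact (Continuous.prodMk_left _).continuousAt.tendsto.mono_left nhdsWithin_le_nhds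
    · exact hev.mono fun t ht => ⟨mem_halfProd.2 ht.1.le, ht.2⟩
  · exact hev.mono fun t ht => coordInv_mem_interior he ht.2 ht.1

theorem hasRightExpansion_slice {F : Type*} [NormedAddCommGroup F] [NormedSpace ℝ F]
    {f : ℝ × EuclideanSpace ℝ (Fin n) → F} {U : Set (ℝ × EuclideanSpace ℝ (Fin n))}
    (hU : IsOpen U) (hf : ContDiffOn ℝ ∞ f (halfProd _ ∩ U)) {y : EuclideanSpace ℝ (Fin n)}
    (hy : ((0 : ℝ), y) ∈ U) :
    HasRightExpansion (fun t => f (t, y)) (f (0, y)) (halfDeriv (1, 0) f (0, y)) :=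
  ((hasDerivWithinAt_halfDeriv hU hf le_rfl hy).mono Ioi_subset_Ici_self).hasRightExpansion

end

end BeigSchmidtChart

end InfinityData

theorem HasRightExpansion.apply_apply {F : Type*} [NormedAddCommGroup F] [NormedSpace ℝ F]
    {f : ℝ → F →L[ℝ] F →L[ℝ] ℝ} {a b : F →L[ℝ] F →L[ℝ] ℝ} (h : HasRightExpansion f a b)
    (v w : F) : HasRightExpansion (fun t => f t v w) (a v w) (b v w) := by
  simpa using (h.clm_apply (.const v)).clm_apply (.const w)

theorem clm_zero_apply_apply {F G : Type*} [NormedAddCommGroup F] [NormedSpace ℝ F]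
    [NormedAddCommGroup G] [NormedSpace ℝ G] (L : G →L[ℝ] F →L[ℝ] F →L[ℝ] ℝ) (v w : F) :
    L 0 v w = 0 := by simp

theorem Finset.sum_comm_cycle' {ι : Type*} [Fintype ι] (f : ι → ι → ι → ℝ) :
    ∑ a, ∑ b, ∑ c, f a b c = ∑ c, ∑ a, ∑ b, f a b c := by
  rw [Finset.sum_comm (γ := ι) (f := fun c a => ∑ b, f a b c)]
  exact Finset.sum_congr rfl fun a _ => Finset.sum_comm

namespace InfinityData

variable {n : ℕ} {M B : Type*}
    [TopologicalSpace M] [ChartedSpace (EuclideanHalfSpace (n + 1)) M]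
    [IsManifold (𝓡∂ (n + 1)) ∞ M]
    [TopologicalSpace B] [ChartedSpace (EuclideanSpace ℝ (Fin n)) B]
    [IsManifold (𝓡 n) ∞ B]
    {S : InfinityData n M B}

namespace BeigSchmidtChart

variable {E E' : S.BeigSchmidtChart} {x : B}

/-! ### Comparison of the expansions in two Beig–Schmidt charts -/

theorem eventually_slice_mem {W : Set M} (hW : IsOpen W) {y : EuclideanSpace ℝ (Fin n)}
    (hy : ((0 : ℝ), y) ∈ coordDom E.toChart W) :
    ∀ᶠ t in 𝓝[>] (0 : ℝ), 0 < t ∧ (t, y) ∈ coordDom E.toChart W := by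
  filter_upwards [self_mem_nhdsWithin, nhdsWithin_le_nhds
    (eventually_mem_of_boundarySlice (isOpen_coordDom hW) hy)] with t ht h't using ⟨ht, h't⟩

theorem coord_slice (hx : S.ι x ∈ E.toChart.source) :
    ∀ᶠ t in 𝓝[>] (0 : ℝ),
      coord E.toChart (coordInv E.toChart (t, yCoord E.toChart (S.ι x)))
        = (t, yCoord E.toChart (S.ι x)) :=
  (eventually_slice_mem E.toChart.open_source (mem_overlap hx hx)).mono fun _ ht =>
    coord_coordInv (mem_halfProd.2 ht.1.le) ht.2

theorem hasRightExpansion_rhoCoord_slice (hx : S.ι x ∈ E.toChart.source) :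
    HasRightExpansion (fun t => rhoCoord E.toChart
      (coordInv E.toChart (t, yCoord E.toChart (S.ι x)))) 0 1 := by
  have h : HasRightExpansion (fun t : ℝ => t) 0 1 :=
    .of_tendsto_div (κ := 0) (by simp)
  exact h.congr' ((coord_slice hx).mono fun t ht => (congrArg Prod.fst ht).symm)

theorem hasRightExpansion_yCoord_slice (hx : S.ι x ∈ E.toChart.source) :
    HasRightExpansion (fun t => yCoord E.toChart
      (coordInv E.toChart (t, yCoord E.toChart (S.ι x)))) (yCoord E.toChart (S.ι x)) 0 :=
  (HasRightExpansion.const _).congr' ((coord_slice hx).mono fun _ ht => (congrArg Prod.snd ht).symm)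

theorem hasRightExpansion_metricNN_slice (hx : S.ι x ∈ E.toChart.source) :
    HasRightExpansion (fun t => S.ν₀ * t ^ 4 * S.metricForm E.toChart
      (coordInv E.toChart (t, yCoord E.toChart (S.ι x))) (1, 0) (1, 0)) 1
      (2 * E.σ (yCoord E.toChart (S.ι x))) := by
  refine (hasRightExpansion_metricNN hx (tendsto_coordInv_slice hx)
    (hasRightExpansion_rhoCoord_slice hx) (hasRightExpansion_yCoord_slice hx)).congr' ?_
  filter_upwards [coord_slice hx] with t ht
  rw [show rhoCoord E.toChart _ = t from congrArg Prod.fst ht]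
  rfl

theorem tendsto_metricNT_slice (hx : S.ι x ∈ E.toChart.source) (v : EuclideanSpace ℝ (Fin n)) :
    Tendsto (fun t => t ^ 2 * S.metricForm E.toChart
      (coordInv E.toChart (t, yCoord E.toChart (S.ι x))) (1, 0) (0, v)) (𝓝[>] 0) (𝓝 0) := by
  have h := (tendsto_metricNT hx (tendsto_coordInv_slice hx)
    (hasRightExpansion_rhoCoord_slice hx)).clm_apply (tendsto_const_nhds (x := v))
  rw [zero_apply] at h
  refine h.congr' ?_
  filter_upwards [coord_slice hx] with t ht
  rw [show rhoCoord E.toChart _ = t from congrArg Prod.fst ht]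
  rfl

theorem hasRightExpansion_metricTT_slice (hx : S.ι x ∈ E.toChart.source)
    (v w : EuclideanSpace ℝ (Fin n)) :
    HasRightExpansion (fun t => t ^ 2 * S.metricForm E.toChart
      (coordInv E.toChart (t, yCoord E.toChart (S.ι x))) (0, v) (0, w))
      (E.hForm (yCoord E.toChart (S.ι x)) v w)
      (E.kForm (yCoord E.toChart (S.ι x)) v w
        - 2 * E.σ (yCoord E.toChart (S.ι x)) * E.hForm (yCoord E.toChart (S.ι x)) v w) := by
  have h := (hasRightExpansion_metricTT hx (tendsto_coordInv_slice hx)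
    (hasRightExpansion_rhoCoord_slice hx) (hasRightExpansion_yCoord_slice hx)).apply_apply v w
  rw [add_apply, add_apply, clm_zero_apply_apply, zero_add] at h
  refine h.congr' ?_
  filter_upwards [coord_slice hx] with t ht
  rw [show rhoCoord E.toChart _ = t from congrArg Prod.fst ht]
  rfl

/-- Provides the relation `hgA` between the two sets of metric components that the comparison lemmas
assume. -/
theorem metricForm_slice_transform (hx : S.ι x ∈ E.toChart.source)
    (hx' : S.ι x ∈ E'.toChart.source) (v w : ℝ × EuclideanSpace ℝ (Fin n)) :
    ∀ᶠ t in 𝓝[>] (0 : ℝ),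
      S.metricForm E.toChart (coordInv E.toChart (t, yCoord E.toChart (S.ι x))) v w =
        S.metricForm E'.toChart (coordInv E.toChart (t, yCoord E.toChart (S.ι x)))
          (halfDeriv v (E.transRho E') (t, yCoord E.toChart (S.ι x)),
            halfDeriv v (E.transY E') (t, yCoord E.toChart (S.ι x)))
          (halfDeriv w (E.transRho E') (t, yCoord E.toChart (S.ι x)),
            halfDeriv w (E.transY E') (t, yCoord E.toChart (S.ι x))) := by
  filter_upwards [eventually_slice_mem E'.toChart.open_source (mem_overlap hx hx')] with t ht
  rw [S.metricForm_transform E.mem_maximalAtlas E'.mem_maximalAtlas ht.2 ht.1,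
    halfDeriv_trans (mem_halfProd.2 ht.1.le) ht.2, halfDeriv_trans (mem_halfProd.2 ht.1.le) ht.2]

theorem slice_mem_interior (hx : S.ι x ∈ E.toChart.source) :
    ∀ᶠ t in 𝓝[>] (0 : ℝ), coordInv E.toChart (t, yCoord E.toChart (S.ι x))
      ∈ (𝓡∂ (n + 1)).interior M :=
  (tendsto_nhdsWithin_iff.1 (tendsto_coordInv_slice hx)).2

theorem hasRightExpansion_transY_slice (hx : S.ι x ∈ E.toChart.source)
    (hx' : S.ι x ∈ E'.toChart.source) :
    HasRightExpansion (fun t => yCoord E'.toChart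
      (coordInv E.toChart (t, yCoord E.toChart (S.ι x)))) (yCoord E'.toChart (S.ι x))
      (E.bdryShear E' (yCoord E.toChart (S.ι x))) := by
  have h := hasRightExpansion_slice isOpen_overlap (contDiffOn_transY (E := E) (E' := E'))
    (mem_overlap hx hx')
  rwa [show E.transY E' (0, yCoord E.toChart (S.ι x)) = _ from bdryTrans_yCoord hx] at h

theorem hasRightExpansion_dtransRho [Nonempty B] (hx : S.ι x ∈ E.toChart.source)
    (hx' : S.ι x ∈ E'.toChart.source) :
    HasRightExpansion (fun t => halfDeriv (1, 0) (E.transRho E') (t, yCoord E.toChart (S.ι x))) 1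
      (2 * E.jetDiff E' (yCoord E.toChart (S.ι x))) := by
  have hz := mem_overlap hx hx'
  have hR := contDiffOn_transRho (E := E) (E' := E')
  have h := hasRightExpansion_slice isOpen_overlap (hR.halfDeriv isOpen_overlap (1, 0)) hz
  rwa [halfDeriv_eq_one isOpen_overlap hR (fun _ => transRho_zero) (fun _ => tendsto_transRho) hz,
    halfDeriv_halfDeriv_eq isOpen_overlap hR (fun _ => transRho_zero)
      (fun _ => tendsto_transRho) hz] at h

/-- By commuting derivatives, the first-order coefficient of the tangential Jacobian of `y'` is the
derivative of the drift `η`; it supplies the part of `L_η h` that involves derivatives of `η`. -/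
theorem hasRightExpansion_tangential (hx : S.ι x ∈ E.toChart.source)
    (hx' : S.ι x ∈ E'.toChart.source) (v : EuclideanSpace ℝ (Fin n)) :
    HasRightExpansion (fun t => halfDeriv (0, v) (E.transY E') (t, yCoord E.toChart (S.ι x)))
      (fderiv ℝ (E.bdryTrans E') (yCoord E.toChart (S.ι x)) v)
      (fderiv ℝ (E.bdryShear E') (yCoord E.toChart (S.ι x)) v) := by
  have hz := mem_overlap hx hx'
  have hY := contDiffOn_transY (E := E) (E' := E')
  have h := hasRightExpansion_slice isOpen_overlap (hY.halfDeriv isOpen_overlap (0, v)) hz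
  rwa [halfDeriv_comm isOpen_overlap hY ⟨mem_halfProd.2 le_rfl, hz⟩,
    ← fderiv_boundarySlice isOpen_overlap hY hz,
    ← fderiv_boundarySlice isOpen_overlap (hY.halfDeriv isOpen_overlap (1, 0)) hz] at h

theorem ν₀_ne_zero (S : InfinityData n M B) : S.ν₀ ≠ 0 := by
  rcases S.signature with ⟨h, -⟩ | ⟨h, -⟩
  · exact h.ne
  · exact h.ne'

section

variable [Nonempty B]

theorem σ_eq (hx : S.ι x ∈ E.toChart.source) (hx' : S.ι x ∈ E'.toChart.source) :
    E.σ (yCoord E.toChart (S.ι x)) = E'.σ (yCoord E'.toChart (S.ι x)) := by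
  have hz := mem_overlap hx hx'
  have hc := tendsto_coordInv_slice hx
  have hκ := tendsto_transRho hz
  have hY := hasRightExpansion_transY_slice hx hx'
  have hr := HasRightExpansion.of_tendsto_div hκ
  refine normal_normal_comparison (ν := S.ν₀) hκ (hasRightExpansion_dtransRho hx hx')
    (hasRightExpansion_slice isOpen_overlap
      (contDiffOn_transY.halfDeriv isOpen_overlap (1, 0)) hz).tendsto
    (hasRightExpansion_metricNN hx' hc hr hY)
    (tendsto_metricNT hx' hc hr) (hasRightExpansion_metricTT hx' hc hr hY).tendsto
    (hasRightExpansion_metricNN_slice hx) ?_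
  filter_upwards [metricForm_slice_transform hx hx' (1, 0) (1, 0), slice_mem_interior hx]
    with t ht hint
  rw [ht, S.metricForm_apply hint]
  ring

/-- The vanishing of the `dρ dy` components in both charts makes the drift `η` the gradient of
`-ν₀⁻¹κ`. -/
theorem hForm_bdryShear (hx : S.ι x ∈ E.toChart.source) (hx' : S.ι x ∈ E'.toChart.source)
    (v : EuclideanSpace ℝ (Fin n)) :
    E'.hForm (yCoord E'.toChart (S.ι x)) (E.bdryShear E' (yCoord E.toChart (S.ι x)))
      (fderiv ℝ (E.bdryTrans E') (yCoord E.toChart (S.ι x)) v)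
      = -S.ν₀⁻¹ * fderiv ℝ (E.jetDiff E') (yCoord E.toChart (S.ι x)) v := by
  have hz := mem_overlap hx hx'
  have hc := tendsto_coordInv_slice hx
  have hκ := tendsto_transRho hz
  have hY := hasRightExpansion_transY_slice hx hx'
  have hr := HasRightExpansion.of_tendsto_div hκ
  refine normal_tangential_comparison (ν₀_ne_zero S) hκ (hasRightExpansion_dtransRho hx hx')
    (hasRightExpansion_slice isOpen_overlap
      (contDiffOn_transY.halfDeriv isOpen_overlap (1, 0)) hz).tendsto
    (tendsto_halfDeriv_tangential_div_sq isOpen_overlap contDiffOn_transRho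
      (fun _ => transRho_zero) (fun _ => tendsto_transRho) hz v)
    (hasRightExpansion_tangential hx hx' v).tendsto
    (hasRightExpansion_metricNN hx' hc hr hY)
    (tendsto_metricNT hx' hc hr) (hasRightExpansion_metricTT hx' hc hr hY).tendsto
    (tendsto_metricNT_slice hx v) ?_
  filter_upwards [metricForm_slice_transform hx hx' (1, 0) (0, v), slice_mem_interior hx]
    with t ht hint
  rw [ht, S.metricForm_apply hint]

/-! ### The boundary metric in two Beig–Schmidt charts -/

theorem fderiv_bdryTrans (hx : S.ι x ∈ E.toChart.source) (hx' : S.ι x ∈ E'.toChart.source)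
    (v : TangentSpace (𝓡 n) x) :
    fderiv ℝ (E.bdryTrans E') (yCoord E.toChart (S.ι x)) (E.bdryDeriv x v)
      = E'.bdryDeriv x v := by
  have h1 : HasMFDerivAt (𝓡 n) 𝓘(ℝ, EuclideanSpace ℝ (Fin n))
      (fun z => yCoord E.toChart (S.ι z)) x (E.bdryDeriv x) :=
    (((S.contMDiffOn_yCoord_ι E.mem_maximalAtlas).contMDiffAt
      (E.bdry.open_source.mem_nhds hx)).mdifferentiableAt (by simp)).hasMFDerivAt
  have h2 := ((contDiffOn_bdryTrans.contDiffAt (isOpen_bdryOverlap.mem_nhds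
    (mem_overlap hx hx'))).differentiableAt (by simp)).hasFDerivAt
  have h3 := h2.hasMFDerivAt.comp x h1
  have h4 : HasMFDerivAt (𝓡 n) 𝓘(ℝ, EuclideanSpace ℝ (Fin n))
      (fun z => yCoord E'.toChart (S.ι z)) x
      ((fderiv ℝ (E.bdryTrans E') (yCoord E.toChart (S.ι x))).comp (E.bdryDeriv x)) := by
    refine h3.congr_of_eventuallyEq ?_
    filter_upwards [E.bdry.open_source.mem_nhds hx] with z hz using (bdryTrans_yCoord hz).symm
  have h5 : E'.bdryDeriv x
      = (fderiv ℝ (E.bdryTrans E') (yCoord E.toChart (S.ι x))).comp (E.bdryDeriv x) := h4.mfderiv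
  rw [h5]
  rfl

theorem hForm_bdryTrans {y : EuclideanSpace ℝ (Fin n)} (hy : ((0 : ℝ), y) ∈ E.overlap E')
    (v w : EuclideanSpace ℝ (Fin n)) :
    E.hForm y v w = E'.hForm (E.bdryTrans E' y) (fderiv ℝ (E.bdryTrans E') y v)
      (fderiv ℝ (E.bdryTrans E') y w) := by
  obtain ⟨x, hx, hx', rfl⟩ := S.exists_boundary_point E.mem_maximalAtlas hy
  obtain ⟨v, rfl⟩ := exists_bdryDeriv_eq hx v
  obtain ⟨w, rfl⟩ := exists_bdryDeriv_eq hx w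
  rw [fderiv_bdryTrans hx hx', fderiv_bdryTrans hx hx', bdryTrans_yCoord hx,
    hForm_bdryDeriv hx, hForm_bdryDeriv hx']

theorem surjective_fderiv_bdryTrans {y : EuclideanSpace ℝ (Fin n)}
    (hy : ((0 : ℝ), y) ∈ E.overlap E') : Function.Surjective (fderiv ℝ (E.bdryTrans E') y) := by
  obtain ⟨x, hx, hx', rfl⟩ := S.exists_boundary_point E.mem_maximalAtlas hy
  intro w
  obtain ⟨w, rfl⟩ := exists_bdryDeriv_eq hx' w
  exact ⟨_, fderiv_bdryTrans hx hx' w⟩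

/-! ### The Levi-Civita connection of the boundary metric -/

variable (E) in
/-- The Christoffel symbols of the boundary metric as a bilinear map. -/
def gammaForm (y v w : EuclideanSpace ℝ (Fin n)) : EuclideanSpace ℝ (Fin n) :=
  WithLp.toLp 2 fun α => ∑ γ, ∑ β, christoffel E.h y α γ β * v γ * w β

theorem sum_single (v : EuclideanSpace ℝ (Fin n)) :
    v = ∑ α, v α • EuclideanSpace.single α (1 : ℝ) := by
  have h := (EuclideanSpace.basisFun (Fin n) ℝ).sum_repr v
  simpa using h.symm

variable (E) in
theorem hForm_apply (y v w : EuclideanSpace ℝ (Fin n)) :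
    E.hForm y v w = ∑ α, ∑ β, E.h y α β * v α * w β := matForm_apply _ _ _

theorem fderiv_hForm_apply {y : EuclideanSpace ℝ (Fin n)} (hy : y ∈ S.bdryTarget E.toChart)
    (u v w : EuclideanSpace ℝ (Fin n)) :
    fderiv ℝ E.hForm y u v w = ∑ γ, ∑ α, ∑ β,
      fderiv ℝ (fun z => E.h z α β) y (EuclideanSpace.single γ 1) * u γ * v α * w β := by
  have h1 : fderiv ℝ E.hForm y u = matForm n fun α β => fderiv ℝ (fun z => E.h z α β) y u :=
    matForm_eq fun α β => fderiv_hForm_single hy u α β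
  have h2 : ∀ α β, fderiv ℝ (fun z => E.h z α β) y u
      = ∑ γ, fderiv ℝ (fun z => E.h z α β) y (EuclideanSpace.single γ 1) * u γ := by
    intro α β
    conv_lhs => rw [sum_single u]
    rw [map_sum]
    exact Finset.sum_congr rfl fun γ _ => by rw [map_smul, smul_eq_mul, mul_comm]
  rw [h1, matForm_apply]
  simp only [h2, Finset.sum_mul]
  calc _ = ∑ α, ∑ γ, ∑ β, fderiv ℝ (fun z => E.h z α β) y (EuclideanSpace.single γ 1)
      * u γ * v α * w β := Finset.sum_congr rfl fun α _ => Finset.sum_comm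
    _ = _ := Finset.sum_comm

theorem h_mul_christoffel {y : EuclideanSpace ℝ (Fin n)} (hy : y ∈ S.bdryTarget E.toChart)
    (γ β δ : Fin n) : ∑ α, E.h y δ α * christoffel E.h y α γ β = (1 / 2) *
      (fderiv ℝ (fun z => E.h z δ β) y (EuclideanSpace.single γ 1)
        + fderiv ℝ (fun z => E.h z δ γ) y (EuclideanSpace.single β 1)
        - fderiv ℝ (fun z => E.h z γ β) y (EuclideanSpace.single δ 1)) := by
  set b : Fin n → ℝ := fun δ => fderiv ℝ (fun z => E.h z δ β) y (EuclideanSpace.single γ 1)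
        + fderiv ℝ (fun z => E.h z δ γ) y (EuclideanSpace.single β 1)
        - fderiv ℝ (fun z => E.h z γ β) y (EuclideanSpace.single δ 1) with hb
  have h1 : (E.h y).mulVec ((E.h y)⁻¹.mulVec b) = b := by
    rw [Matrix.mulVec_mulVec, Matrix.mul_nonsing_inv _ (isUnit_det_h hy), Matrix.one_mulVec]
  have h2 := congrFun h1 δ
  change _ = (1 / 2) * b δ
  rw [← h2]
  simp only [Matrix.mulVec, dotProduct, Finset.mul_sum]
  refine Finset.sum_congr rfl fun α _ => ?_
  simp only [christoffel, Finset.mul_sum]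
  exact Finset.sum_congr rfl fun ε _ => by ring

theorem h_symm {y : EuclideanSpace ℝ (Fin n)} (hy : y ∈ S.bdryTarget E.toChart) (α β : Fin n) :
    E.h y α β = E.h y β α := by
  rw [← hForm_single, hForm_symm hy, hForm_single]

theorem fderiv_h_symm {y : EuclideanSpace ℝ (Fin n)} (hy : y ∈ S.bdryTarget E.toChart)
    (α β : Fin n) :
    fderiv ℝ (fun z => E.h z α β) y = fderiv ℝ (fun z => E.h z β α) y := by
  refine Filter.EventuallyEq.fderiv_eq ?_
  filter_upwards [(S.isOpen_bdryTarget E.mem_maximalAtlas).mem_nhds hy] with z hz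
    using h_symm hz α β

/-- Links the index formula for the Christoffel symbols to Koszul's formula, in which the
transformation laws are proved. The work is a relabelling of triple sums. -/
theorem hForm_gammaForm {y : EuclideanSpace ℝ (Fin n)} (hy : y ∈ S.bdryTarget E.toChart)
    (u v w : EuclideanSpace ℝ (Fin n)) :
    E.hForm y (E.gammaForm y u v) w = koszul E.hForm y u v w := by
  rw [hForm_symm hy, hForm_apply, koszul, fderiv_hForm_apply hy, fderiv_hForm_apply hy,
    fderiv_hForm_apply hy]
  have e1 : ∀ δ, ∑ α, E.h y δ α * w δ * (E.gammaForm y u v) α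
      = ∑ γ, ∑ β, (∑ α, E.h y δ α * christoffel E.h y α γ β) * u γ * v β * w δ := by
    intro δ
    simp only [gammaForm, Finset.mul_sum, Finset.sum_mul]
    rw [Finset.sum_comm]
    refine Finset.sum_congr rfl fun γ _ => ?_
    rw [Finset.sum_comm]
    exact Finset.sum_congr rfl fun β _ => Finset.sum_congr rfl fun α _ => by ring
  simp only [e1, h_mul_christoffel hy]
  rw [Finset.sum_comm_cycle' (fun γ α β => fderiv ℝ (fun z => E.h z α β) y
      (EuclideanSpace.single γ 1) * u γ * v α * w β),
    Finset.sum_comm_cycle' (fun γ α β => fderiv ℝ (fun z => E.h z α β) y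
      (EuclideanSpace.single γ 1) * v γ * u α * w β), ← Finset.sum_add_distrib,
    ← Finset.sum_sub_distrib, Finset.mul_sum]
  refine Finset.sum_congr rfl fun δ _ => ?_
  rw [Finset.sum_comm (f := fun γ α => fderiv ℝ (fun z => E.h z α δ) y
      (EuclideanSpace.single γ 1) * v γ * u α * w δ), ← Finset.sum_add_distrib,
    ← Finset.sum_sub_distrib, Finset.mul_sum]
  refine Finset.sum_congr rfl fun γ _ => ?_
  rw [← Finset.sum_add_distrib, ← Finset.sum_sub_distrib, Finset.mul_sum]
  refine Finset.sum_congr rfl fun β _ => ?_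
  rw [fderiv_h_symm hy β δ, fderiv_h_symm hy γ δ]
  ring

/-! ### The transformation of `k` -/

theorem gammaForm_transform {y : EuclideanSpace ℝ (Fin n)} (hy : ((0 : ℝ), y) ∈ E.overlap E')
    (u v : EuclideanSpace ℝ (Fin n)) :
    fderiv ℝ (E.bdryTrans E') y (E.gammaForm y u v)
      = E'.gammaForm (E.bdryTrans E' y) (fderiv ℝ (E.bdryTrans E') y u)
        (fderiv ℝ (E.bdryTrans E') y v) + fderiv ℝ (fderiv ℝ (E.bdryTrans E')) y u v := by
  have hnhds := isOpen_bdryOverlap.mem_nhds hy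
  obtain ⟨x, hx, hx', rfl⟩ := S.exists_boundary_point E.mem_maximalAtlas hy
  have ht : E.bdryTrans E' (yCoord E.toChart (S.ι x)) ∈ S.bdryTarget E'.toChart :=
    ⟨x, hx', (bdryTrans_yCoord hx).symm⟩
  exact christoffel_pullback (contDiffOn_bdryTrans.contDiffAt hnhds) (differentiableAt_hForm ht)
    (hForm_symm ht) (hForm_nondegenerate ht) (surjective_fderiv_bdryTrans hy)
    (by filter_upwards [hnhds] with z hz using hForm_bdryTrans hz)
    (differentiableAt_hForm ⟨x, hx, rfl⟩) (hForm_gammaForm ⟨x, hx, rfl⟩) (hForm_gammaForm ht) u v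

theorem fderiv_hForm_symm {y : EuclideanSpace ℝ (Fin n)} (hy : y ∈ S.bdryTarget E.toChart)
    (u v w : EuclideanSpace ℝ (Fin n)) :
    fderiv ℝ E.hForm y u v w = fderiv ℝ E.hForm y u w v := by
  have h1 := hasFDerivAt_hForm_apply hy v w
  have h2 := hasFDerivAt_hForm_apply hy w v
  have h3 := h1.congr_of_eventuallyEq (f₁ := fun y => E.hForm y w v) (by
    filter_upwards [(S.isOpen_bdryTarget E.mem_maximalAtlas).mem_nhds hy] with z hz
      using hForm_symm hz w v)
  exact congrArg (fun L : EuclideanSpace ℝ (Fin n) →L[ℝ] ℝ => L u) (h3.unique h2)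

/-- The tangential comparison reads `k - 2σh = -2κh + k' - 2σ'h' + L_η h'` with `κ = jetDiff`. The
`σ` terms cancel by `σ_eq`, and the Lie derivative along the gradient `η` equals `-2ν₀⁻¹` times the
Hessian of `κ`. -/
theorem kForm_transform {y : EuclideanSpace ℝ (Fin n)} (hy : ((0 : ℝ), y) ∈ E.overlap E')
    (v w : EuclideanSpace ℝ (Fin n)) :
    E'.kForm (E.bdryTrans E' y) (fderiv ℝ (E.bdryTrans E') y v) (fderiv ℝ (E.bdryTrans E') y w)
      = E.kForm y v w + 2 * E.jetDiff E' y * E.hForm y v w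
        + 2 * S.ν₀⁻¹ * (fderiv ℝ (fderiv ℝ (E.jetDiff E')) y v w
          - fderiv ℝ (E.jetDiff E') y (E.gammaForm y v w)) := by
  have hnhds := isOpen_bdryOverlap.mem_nhds hy
  have hG := gammaForm_transform hy
  have hH := hForm_bdryTrans hy v w
  obtain ⟨x, hx, hx', rfl⟩ := S.exists_boundary_point E.mem_maximalAtlas hy
  have ht : E.bdryTrans E' (yCoord E.toChart (S.ι x)) ∈ S.bdryTarget E'.toChart :=
    ⟨x, hx', (bdryTrans_yCoord hx).symm⟩
  have hLie := lieDerivative_gradient (contDiffOn_bdryTrans.contDiffAt hnhds)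
    (differentiableAt_hForm ht) (hForm_symm ht) (contDiffOn_jetDiff.contDiffAt hnhds)
    ((contDiffOn_bdryShear.contDiffAt hnhds).differentiableAt (by simp))
    (ν := S.ν₀) (by
      filter_upwards [hnhds] with z hz v
      obtain ⟨x, hx, hx', rfl⟩ := S.exists_boundary_point E.mem_maximalAtlas hz
      rw [bdryTrans_yCoord hx]
      exact hForm_bdryShear hx hx' v)
    (fderiv_hForm_symm ht) (hForm_gammaForm ht) hG v w
  have hc := tendsto_coordInv_slice hx
  have hκ := tendsto_transRho hy
  have hY := hasRightExpansion_transY_slice hx hx'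
  have hr := HasRightExpansion.of_tendsto_div hκ
  have hmain := hasRightExpansion_metricTT_slice hx v w
  rw [hH, bdryTrans_yCoord hx] at hmain
  have hcmp := tangential_tangential_comparison (ν₀_ne_zero S) hκ
    (tendsto_halfDeriv_tangential_div_sq isOpen_overlap contDiffOn_transRho
      (fun _ => transRho_zero) (fun _ => tendsto_transRho) hy v)
    (hasRightExpansion_tangential hx hx' v)
    (tendsto_halfDeriv_tangential_div_sq isOpen_overlap contDiffOn_transRho
      (fun _ => transRho_zero) (fun _ => tendsto_transRho) hy w)
    (hasRightExpansion_tangential hx hx' w)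
    (hasRightExpansion_metricNN hx' hc hr hY)
    (tendsto_metricNT hx' hc hr) (hasRightExpansion_metricTT hx' hc hr hY) hmain (by
      filter_upwards [metricForm_slice_transform hx hx' (0, v) (0, w), slice_mem_interior hx]
        with t ht hint
      rw [ht, S.metricForm_apply hint])
  rw [bdryTrans_yCoord hx] at hLie hH ⊢
  rw [add_apply, add_apply, sub_apply, sub_apply, smul_apply, smul_apply, smul_eq_mul,
    σ_eq hx hx'] at hcmp
  rw [hH]
  linear_combination -hcmp - hLie

end

end BeigSchmidtChart

end InfinityData

/-! ### Connections given by coefficients in charts -/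

namespace ChartConnection

variable {N : Type*} [NormedAddCommGroup N] [NormedSpace ℝ N] [FiniteDimensional ℝ N]
  {Q : Type*} [TopologicalSpace Q] [ChartedSpace N Q] [IsManifold 𝓘(ℝ, N) ∞ Q]
  {F : Type*} [NormedAddCommGroup F] [NormedSpace ℝ F]

/-- The differential of a chart. -/
def chartDeriv (c : OpenPartialHomeomorph Q N) (p : Q) : TangentSpace 𝓘(ℝ, N) p →L[ℝ] N :=
  mvfderiv 𝓘(ℝ, N) c p

/-- A vector field in a chart. -/
def chartVec (c : OpenPartialHomeomorph Q N) (Y : ∀ q : Q, TangentSpace 𝓘(ℝ, N) q) (q : Q) : N :=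
  chartDeriv c q (Y q)

/-- A vector field is differentiable at a point. -/
abbrev DiffAt (Y : ∀ q : Q, TangentSpace 𝓘(ℝ, N) q) (p : Q) : Prop :=
  MDifferentiableAt 𝓘(ℝ, N) 𝓘(ℝ, N).tangent
    (fun q => (⟨q, Y q⟩ : TangentBundle 𝓘(ℝ, N) Q)) p

variable {c c' : OpenPartialHomeomorph Q N} {p : Q} {X Y Z : ∀ q : Q, TangentSpace 𝓘(ℝ, N) q}

theorem mvfderiv_eq {f : Q → F} {L : TangentSpace 𝓘(ℝ, N) p →L[ℝ] F}
    (h : HasMFDerivAt 𝓘(ℝ, N) 𝓘(ℝ, F) f p L) : mvfderiv 𝓘(ℝ, N) f p = L := by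
  ext X
  change mfderiv 𝓘(ℝ, N) 𝓘(ℝ, F) f p X = L X
  rw [h.mfderiv]
  rfl

theorem hasMFDerivAt_mvfderiv {f : Q → F} (h : MDifferentiableAt 𝓘(ℝ, N) 𝓘(ℝ, F) f p) :
    HasMFDerivAt 𝓘(ℝ, N) 𝓘(ℝ, F) f p (mvfderiv 𝓘(ℝ, N) f p) := h.hasMFDerivAt

theorem contMDiffAt_chart (hc : c ∈ IsManifold.maximalAtlas 𝓘(ℝ, N) ∞ Q) (hp : p ∈ c.source) :
    ContMDiffAt 𝓘(ℝ, N) 𝓘(ℝ, N) ∞ c p :=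
  contMDiffAt_of_mem_maximalAtlas hc hp

theorem hasMFDerivAt_chart (hc : c ∈ IsManifold.maximalAtlas 𝓘(ℝ, N) ∞ Q) (hp : p ∈ c.source) :
    HasMFDerivAt 𝓘(ℝ, N) 𝓘(ℝ, N) c p (chartDeriv c p) :=
  ((contMDiffAt_chart hc hp).mdifferentiableAt (by simp)).hasMFDerivAt

theorem isInvertible_chartDeriv (hc : c ∈ IsManifold.maximalAtlas 𝓘(ℝ, N) ∞ Q)
    (hp : p ∈ c.source) : (chartDeriv c p).IsInvertible := by
  have h : c.MDifferentiable 𝓘(ℝ, N) 𝓘(ℝ, N) :=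
    ⟨(contMDiffOn_of_mem_maximalAtlas hc).mdifferentiableOn (by simp),
      (contMDiffOn_symm_of_mem_maximalAtlas hc).mdifferentiableOn (by simp)⟩
  exact ⟨h.mfderiv hp, rfl⟩

theorem mvfderiv_comp_chart (hc : c ∈ IsManifold.maximalAtlas 𝓘(ℝ, N) ∞ Q) (hp : p ∈ c.source)
    {f : Q → F} {g : N → F} (hg : DifferentiableAt ℝ g (c p)) (h : f =ᶠ[𝓝 p] fun q => g (c q)) :
    mvfderiv 𝓘(ℝ, N) f p = (fderiv ℝ g (c p)).comp (chartDeriv c p) :=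
  mvfderiv_eq ((hg.hasFDerivAt.hasMFDerivAt.comp p (hasMFDerivAt_chart hc hp)).congr_of_eventuallyEq
    h)

theorem contDiffAt_comp_chart_symm (hc : c ∈ IsManifold.maximalAtlas 𝓘(ℝ, N) ∞ Q)
    (hp : p ∈ c.source) {f : Q → F} (hf : ContMDiffAt 𝓘(ℝ, N) 𝓘(ℝ, F) ∞ f p) :
    ContDiffAt ℝ ∞ (f ∘ c.symm) (c p) := by
  have h := contMDiffAt_symm_of_mem_maximalAtlas hc (c.map_source hp)
  rw [← c.left_inv hp] at hf
  exact (hf.comp (c p) h).contDiffAt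

theorem differentiableAt_comp_chart_symm (hc : c ∈ IsManifold.maximalAtlas 𝓘(ℝ, N) ∞ Q)
    (hp : p ∈ c.source) {f : Q → F} (hf : MDifferentiableAt 𝓘(ℝ, N) 𝓘(ℝ, F) f p) :
    DifferentiableAt ℝ (f ∘ c.symm) (c p) := by
  have h := contMDiffAt_symm_of_mem_maximalAtlas hc (c.map_source hp)
  rw [← c.left_inv hp] at hf
  exact (hf.comp (c p) (h.mdifferentiableAt (by simp))).differentiableAt

theorem eventuallyEq_comp_symm_comp (hp : p ∈ c.source) (f : Q → F) :
    f =ᶠ[𝓝 p] fun q => (f ∘ c.symm) (c q) := by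
  filter_upwards [c.open_source.mem_nhds hp] with q hq
  rw [Function.comp_apply, c.left_inv hq]

theorem mvfderiv_eq_fderiv_comp_symm (hc : c ∈ IsManifold.maximalAtlas 𝓘(ℝ, N) ∞ Q)
    (hp : p ∈ c.source) {f : Q → F} (hf : MDifferentiableAt 𝓘(ℝ, N) 𝓘(ℝ, F) f p) :
    mvfderiv 𝓘(ℝ, N) f p = (fderiv ℝ (f ∘ c.symm) (c p)).comp (chartDeriv c p) :=
  mvfderiv_comp_chart hc hp (differentiableAt_comp_chart_symm hc hp hf)
    (eventuallyEq_comp_symm_comp hp f)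

theorem contMDiffAt_tangentMapWithin (hc : c ∈ IsManifold.maximalAtlas 𝓘(ℝ, N) ∞ Q)
    (hp : p ∈ c.source) (v : TangentSpace 𝓘(ℝ, N) p) :
    ContMDiffAt 𝓘(ℝ, N).tangent 𝓘(ℝ, N) ∞
      (fun w : TangentBundle 𝓘(ℝ, N) Q => chartDeriv c w.1 w.2) ⟨p, v⟩ := by
  have h1 := (contMDiffOn_of_mem_maximalAtlas hc).contMDiffOn_tangentMapWithin (m := ∞) (by simp)
    c.open_source.uniqueMDiffOn
  have h2 : (Bundle.TotalSpace.proj ⁻¹' c.source : Set (TangentBundle 𝓘(ℝ, N) Q)) ∈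
      𝓝 (⟨p, v⟩ : TangentBundle 𝓘(ℝ, N) Q) :=
    (c.open_source.preimage (FiberBundle.continuous_proj N _)).mem_nhds hp
  have h3 := (contMDiff_snd_tangentBundle_modelSpace N 𝓘(ℝ, N) (n := ∞)).contMDiffAt.comp _
    (h1.contMDiffAt h2)
  refine h3.congr_of_eventuallyEq ?_
  filter_upwards [h2] with w hw
  change mfderiv 𝓘(ℝ, N) 𝓘(ℝ, N) c w.1 w.2 = mfderivWithin 𝓘(ℝ, N) 𝓘(ℝ, N) c c.source w.1 w.2
  rw [mfderivWithin_of_isOpen c.open_source hw]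

theorem contMDiffAt_chartVec (hc : c ∈ IsManifold.maximalAtlas 𝓘(ℝ, N) ∞ Q) (hp : p ∈ c.source)
    (hY : ContMDiffAt 𝓘(ℝ, N) 𝓘(ℝ, N).tangent ∞
      (fun q => (⟨q, Y q⟩ : TangentBundle 𝓘(ℝ, N) Q)) p) :
    ContMDiffAt 𝓘(ℝ, N) 𝓘(ℝ, N) ∞ (chartVec c Y) p :=
  (contMDiffAt_tangentMapWithin hc hp (Y p)).comp p hY

theorem mdifferentiableAt_chartVec (hc : c ∈ IsManifold.maximalAtlas 𝓘(ℝ, N) ∞ Q)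
    (hp : p ∈ c.source) (hY : DiffAt Y p) :
    MDifferentiableAt 𝓘(ℝ, N) 𝓘(ℝ, N) (chartVec c Y) p :=
  ((contMDiffAt_tangentMapWithin hc hp (Y p)).mdifferentiableAt (by simp)).comp p hY

/-- The covariant derivative in a chart. -/
def localCov (c : OpenPartialHomeomorph Q N) (Γ : N → N →L[ℝ] N →L[ℝ] N)
    (Y : ∀ q : Q, TangentSpace 𝓘(ℝ, N) q) (p : Q) :
    TangentSpace 𝓘(ℝ, N) p →L[ℝ] TangentSpace 𝓘(ℝ, N) p :=
  (chartDeriv c p).inverse.comp (mvfderiv 𝓘(ℝ, N) (chartVec c Y) p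
    + ((Γ (c p)).flip (chartVec c Y p)).comp (chartDeriv c p))

variable {Γ Γ' : N → N →L[ℝ] N →L[ℝ] N}

theorem apply_inverse {V : Type*} [AddCommGroup V] [Module ℝ V] [TopologicalSpace V]
    {L : V →L[ℝ] N} (hL : L.IsInvertible) (z : N) : L (L.inverse z) = z := by
  obtain ⟨e, rfl⟩ := hL
  simp

theorem inverse_apply {V : Type*} [AddCommGroup V] [Module ℝ V] [TopologicalSpace V]
    {L : V →L[ℝ] N} (hL : L.IsInvertible) (v : V) : L.inverse (L v) = v := by
  obtain ⟨e, rfl⟩ := hL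
  simp

theorem chartDeriv_localCov (hc : c ∈ IsManifold.maximalAtlas 𝓘(ℝ, N) ∞ Q) (hp : p ∈ c.source)
    (v : TangentSpace 𝓘(ℝ, N) p) :
    chartDeriv c p (localCov c Γ Y p v) = mvfderiv 𝓘(ℝ, N) (chartVec c Y) p v
      + Γ (c p) (chartDeriv c p v) (chartVec c Y p) :=
  apply_inverse (isInvertible_chartDeriv hc hp) _

theorem chartDeriv_injective (hc : c ∈ IsManifold.maximalAtlas 𝓘(ℝ, N) ∞ Q) (hp : p ∈ c.source) :
    Function.Injective (chartDeriv c p) :=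
  (isInvertible_chartDeriv hc hp).bijective.injective

theorem localCov_add (hc : c ∈ IsManifold.maximalAtlas 𝓘(ℝ, N) ∞ Q) (hp : p ∈ c.source)
    (hY : DiffAt Y p) (hZ : DiffAt Z p) :
    localCov c Γ (Y + Z) p = localCov c Γ Y p + localCov c Γ Z p := by
  ext v
  apply chartDeriv_injective hc hp
  have h : chartVec c (Y + Z) = chartVec c Y + chartVec c Z := funext fun q => map_add _ _ _
  rw [add_apply, map_add, chartDeriv_localCov hc hp, chartDeriv_localCov hc hp,
    chartDeriv_localCov hc hp, h, mvfderiv_add (mdifferentiableAt_chartVec hc hp hY)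
    (mdifferentiableAt_chartVec hc hp hZ), add_apply, Pi.add_apply, map_add]
  abel

theorem localCov_smul (hc : c ∈ IsManifold.maximalAtlas 𝓘(ℝ, N) ∞ Q) (hp : p ∈ c.source)
    (hY : DiffAt Y p) {g : Q → ℝ} (hg : MDifferentiableAt 𝓘(ℝ, N) 𝓘(ℝ, ℝ) g p) :
    localCov c Γ (g • Y) p
      = g p • localCov c Γ Y p + (mvfderiv 𝓘(ℝ, N) g p).smulRight (Y p) := by
  ext v
  apply chartDeriv_injective hc hp
  have h : chartVec c (g • Y) = g • chartVec c Y := funext fun q => map_smul _ _ _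
  rw [add_apply, map_add, smul_apply, map_smul, ContinuousLinearMap.smulRight_apply, map_smul,
    chartDeriv_localCov hc hp, chartDeriv_localCov hc hp, h,
    mvfderiv_smul hg (mdifferentiableAt_chartVec hc hp hY)]
  simp only [add_apply, smul_apply, ContinuousLinearMap.smulRight_apply, Pi.smul_apply',
    map_smul, smul_add]
  rw [add_right_comm]
  rfl

/-- The transformation law of connection coefficients under a change of coordinates `φ`. -/
def Compatible (Γ Γ' : N → N →L[ℝ] N →L[ℝ] N) (φ : N → N) (a : N) : Prop :=
  ∀ v w, fderiv ℝ (fderiv ℝ φ) a v w + Γ' (φ a) (fderiv ℝ φ a v) (fderiv ℝ φ a w)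
    = fderiv ℝ φ a (Γ a v w)

/-- In the second chart the field is `Dφ` applied to the field in the first. The product rule
produces one term with `D²φ`, exactly the one absorbed by `Compatible`. -/
theorem localCov_eq (hc : c ∈ IsManifold.maximalAtlas 𝓘(ℝ, N) ∞ Q) (hp : p ∈ c.source)
    (hc' : c' ∈ IsManifold.maximalAtlas 𝓘(ℝ, N) ∞ Q) (hp' : p ∈ c'.source) (hY : DiffAt Y p)
    {φ : N → N} (hφ : ContDiffAt ℝ ∞ φ (c p)) (h : c' =ᶠ[𝓝 p] fun q => φ (c q))
    (hΓ : Compatible Γ Γ' φ (c p)) : localCov c Γ Y p = localCov c' Γ' Y p := by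
  have hφ1 : ∀ᶠ z in 𝓝 (c p), DifferentiableAt ℝ φ z :=
    ((hφ.of_le (m := 1) (by simp)).eventually (by simp)).mono fun z hz => hz.differentiableAt (by simp)
  have hD : ∀ᶠ q in 𝓝 p, chartDeriv c' q = (fderiv ℝ φ (c q)).comp (chartDeriv c q) := by
    filter_upwards [h.eventually_nhds, c.open_source.mem_nhds hp,
      (c.continuousAt hp).eventually hφ1] with q hq hqs hd
    exact mvfderiv_comp_chart hc hqs hd hq
  have hV : chartVec c' Y =ᶠ[𝓝 p] fun q => fderiv ℝ φ (c q) (chartVec c Y q) :=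
    hD.mono fun q hq => congrArg (fun L : TangentSpace 𝓘(ℝ, N) q →L[ℝ] N => L (Y q)) hq
  have hd2 : DifferentiableAt ℝ (fderiv ℝ φ) (c p) :=
    (hφ.fderiv_right (m := 1) (WithTop.coe_le_coe.2 (le_top : (2 : ℕ∞) ≤ ⊤))).differentiableAt
      (by simp)
  have hVd := mdifferentiableAt_chartVec hc hp hY
  have hw := differentiableAt_comp_chart_symm hc hp hVd
  have hV' : chartVec c' Y =ᶠ[𝓝 p]
      fun q => (fun z => fderiv ℝ φ z ((chartVec c Y ∘ c.symm) z)) (c q) := by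
    filter_upwards [hV, eventuallyEq_comp_symm_comp hp (chartVec c Y)] with q h1 h2
    rw [h1]
    exact congrArg _ h2
  have hw2 := hd2.hasFDerivAt.clm_apply hw.hasFDerivAt
  have hmv := mvfderiv_comp_chart hc hp hw2.differentiableAt hV'
  rw [hw2.fderiv] at hmv
  have hcp : (chartVec c Y ∘ c.symm) (c p) = chartVec c Y p := by
    rw [Function.comp_apply, c.left_inv hp]
  ext v
  apply chartDeriv_injective hc' hp'
  rw [chartDeriv_localCov hc' hp', hD.self_of_nhds, ContinuousLinearMap.comp_apply,
    ContinuousLinearMap.comp_apply, chartDeriv_localCov hc hp, hV.self_of_nhds, h.self_of_nhds,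
    hmv, map_add, ← hΓ, hcp, mvfderiv_eq_fderiv_comp_symm hc hp hVd]
  simp only [add_apply, ContinuousLinearMap.comp_apply, ContinuousLinearMap.flip_apply]
  abel

theorem mdifferentiableAt_vectorSpace {V : N → N} {z : N} (hV : DifferentiableAt ℝ V z) :
    MDifferentiableAt 𝓘(ℝ, N) 𝓘(ℝ, N).tangent
      (fun w => (⟨w, V w⟩ : TangentBundle 𝓘(ℝ, N) N)) z := by
  refine (mdifferentiableAt_totalSpace ..).2 ⟨mdifferentiableAt_id, ?_⟩
  convert! hV.mdifferentiableAt with y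
  simp

/-- The bracket is natural under pullback by the chart, and on the model space it is the commutator
of derivatives. Near `p` both fields are pullbacks of their coordinate expressions. -/
theorem chartDeriv_mlieBracket (hc : c ∈ IsManifold.maximalAtlas 𝓘(ℝ, N) ∞ Q)
    (hp : p ∈ c.source) (hX : DiffAt X p) (hY : DiffAt Y p) :
    chartDeriv c p (VectorField.mlieBracket 𝓘(ℝ, N) X Y p)
      = mvfderiv 𝓘(ℝ, N) (chartVec c Y) p (X p) - mvfderiv 𝓘(ℝ, N) (chartVec c X) p (Y p) := by
  have h2 : (2 : ℕ∞ω) ≤ ∞ := WithTop.coe_le_coe.2 (le_top : (2 : ℕ∞) ≤ ⊤)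
  have : IsManifold 𝓘(ℝ, N) (minSmoothness ℝ 2) Q :=
    IsManifold.of_le (n := ∞) (by rw [minSmoothness_of_isRCLikeNormedField]; exact h2)
  have hinv := isInvertible_chartDeriv hc hp
  have hXd := mdifferentiableAt_chartVec hc hp hX
  have hYd := mdifferentiableAt_chartVec hc hp hY
  have hXw := differentiableAt_comp_chart_symm hc hp hXd
  have hYw := differentiableAt_comp_chart_symm hc hp hYd
  let U (Z : ∀ q : Q, TangentSpace 𝓘(ℝ, N) q) (z : N) : TangentSpace 𝓘(ℝ, N) z :=
    (chartVec c Z ∘ c.symm) z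
  have key : ∀ Z : ∀ q : Q, TangentSpace 𝓘(ℝ, N) q,
      VectorField.mpullback 𝓘(ℝ, N) 𝓘(ℝ, N) c (U Z) =ᶠ[𝓝 p] Z := by
    intro Z
    filter_upwards [c.open_source.mem_nhds hp] with q hq
    have h1 : (chartVec c Z ∘ c.symm) (c q) = chartDeriv c q (Z q) := by
      rw [Function.comp_apply, c.left_inv hq]
      rfl
    exact (congrArg (chartDeriv c q).inverse h1).trans
      (inverse_apply (isInvertible_chartDeriv hc hq) (Z q))
  have h1 := VectorField.mpullback_mlieBracket (I := 𝓘(ℝ, N)) (I' := 𝓘(ℝ, N)) (f := c)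
    (V := U X) (W := U Y) (x₀ := p) (n := ∞)
    (mdifferentiableAt_vectorSpace hXw) (mdifferentiableAt_vectorSpace hYw)
    (contMDiffAt_chart hc hp) (by rw [minSmoothness_of_isRCLikeNormedField]; exact h2)
  rw [(key X).mlieBracket_vectorField_eq (key Y)] at h1
  rw [← h1, ← VectorField.mlieBracketWithin_univ, VectorField.mlieBracketWithin_eq_lieBracketWithin,
    VectorField.lieBracketWithin_univ]
  refine (apply_inverse hinv _).trans ?_
  rw [mvfderiv_eq_fderiv_comp_symm hc hp hXd, mvfderiv_eq_fderiv_comp_symm hc hp hYd]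
  have e : ∀ Z : ∀ q : Q, TangentSpace 𝓘(ℝ, N) q, U Z (c p) = chartDeriv c p (Z p) := by
    intro Z
    change chartVec c Z (c.symm (c p)) = _
    rw [c.left_inv hp]
    rfl
  change fderiv ℝ (chartVec c Y ∘ c.symm) (c p) (U X (c p))
    - fderiv ℝ (chartVec c X ∘ c.symm) (c p) (U Y (c p)) = _
  rw [e, e]
  rfl

/-! ### Smoothness -/

/-- The differential of a chart in the trivialisation of the tangent bundle at `p`. -/
def trivDeriv (c : OpenPartialHomeomorph Q N) (p q : Q) : N →L[ℝ] N :=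
  (chartDeriv c q).comp ((trivializationAt N (TangentSpace 𝓘(ℝ, N)) p).symmL ℝ q)

theorem contMDiffAt_trivDeriv (hc : c ∈ IsManifold.maximalAtlas 𝓘(ℝ, N) ∞ Q) (hp : p ∈ c.source) :
    ContMDiffAt 𝓘(ℝ, N) 𝓘(ℝ, N →L[ℝ] N) ∞ (trivDeriv c p) p := by
  have h := (contMDiffAt_chart hc hp).mfderiv_const (m := ∞) (by simp)
  convert! h using 1
  funext q
  change trivDeriv c p q = ContinuousLinearMap.inCoordinates N (TangentSpace 𝓘(ℝ, N)) N
    (TangentSpace 𝓘(ℝ, N)) p q (c p) (c q) (mfderiv 𝓘(ℝ, N) 𝓘(ℝ, N) c q)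
  rw [ContinuousLinearMap.inCoordinates, TangentBundle.continuousLinearMapAt_model_space]
  rfl

theorem isInvertible_trivDeriv (hc : c ∈ IsManifold.maximalAtlas 𝓘(ℝ, N) ∞ Q) {q : Q}
    (hq : q ∈ c.source) (hq' : q ∈ (trivializationAt N (TangentSpace 𝓘(ℝ, N)) p).baseSet) :
    (trivDeriv c p q).IsInvertible ∧ (trivDeriv c p q).inverse
      = ((trivializationAt N (TangentSpace 𝓘(ℝ, N)) p).continuousLinearMapAt ℝ q).comp
        (chartDeriv c q).inverse := by
  obtain ⟨e, he⟩ := isInvertible_chartDeriv hc hq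
  let e' := (trivializationAt N (TangentSpace 𝓘(ℝ, N)) p).continuousLinearEquivAt ℝ q hq'
  have h : trivDeriv c p q = (e'.symm.trans e : N ≃L[ℝ] N) := by
    rw [trivDeriv, ← he]
    ext v
    change e _ = e (e'.symm v)
    rw [Bundle.Trivialization.symm_continuousLinearEquivAt_eq]
    rfl
  refine ⟨⟨_, h.symm⟩, ?_⟩
  rw [h, ContinuousLinearMap.inverse_equiv, ← he, ContinuousLinearMap.inverse_equiv]
  ext v
  change e' (e.symm v) = (trivializationAt N (TangentSpace 𝓘(ℝ, N)) p).continuousLinearMapAt ℝ q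
    (e.symm v)
  rw [Bundle.Trivialization.coe_continuousLinearEquivAt_eq]

/-- With `P` the chart differential in the trivialisation at `p` (`trivDeriv`) and `W` the field in
coordinates, the covariant derivative reads `P⁻¹ ∘ (DW + Γ(·, W)) ∘ P`; `P` and its inverse are
smooth, and so is the middle factor. -/
theorem contMDiffAt_localCov (hc : c ∈ IsManifold.maximalAtlas 𝓘(ℝ, N) ∞ Q) (hp : p ∈ c.source)
    (hΓ : ContDiffAt ℝ ∞ Γ (c p))
    (hY : ContMDiff 𝓘(ℝ, N) 𝓘(ℝ, N).tangent ∞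
      (fun q => (⟨q, Y q⟩ : TangentBundle 𝓘(ℝ, N) Q))) :
    ContMDiffAt 𝓘(ℝ, N) (𝓘(ℝ, N).prod 𝓘(ℝ, N →L[ℝ] N)) ∞
      (fun q => (⟨q, localCov c Γ Y q⟩ : Bundle.TotalSpace (N →L[ℝ] N)
        fun q : Q => TangentSpace 𝓘(ℝ, N) q →L[ℝ] TangentSpace 𝓘(ℝ, N) q)) p := by
  rw [contMDiffAt_hom_bundle]
  refine ⟨contMDiffAt_id, ?_⟩
  have hP := contMDiffAt_trivDeriv hc hp
  have hPinv : ContMDiffAt 𝓘(ℝ, N) 𝓘(ℝ, N →L[ℝ] N) ∞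
      (fun q => (trivDeriv c p q).inverse) p := by
    obtain ⟨e, he⟩ := (isInvertible_trivDeriv hc hp
      (mem_baseSet_trivializationAt N (TangentSpace 𝓘(ℝ, N)) p)).1
    have h := contDiffAt_map_inverse (𝕜 := ℝ) (n := ∞) e
    rw [he] at h
    exact h.contMDiffAt.comp p hP
  have hW := contDiffAt_comp_chart_symm hc hp (contMDiffAt_chartVec hc hp (hY p))
  have hB : ContDiffAt ℝ ∞ (fun z => fderiv ℝ (chartVec c Y ∘ c.symm) z
      + (Γ z).flip ((chartVec c Y ∘ c.symm) z)) (c p) :=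
    (hW.fderiv_right (m := ∞) (by simp)).add (((ContinuousLinearMap.flipₗᵢ ℝ N N
      N).toContinuousLinearEquiv.contDiff.contDiffAt.comp (c p) hΓ).clm_apply hW)
  have hBc := hB.contMDiffAt.comp p (contMDiffAt_chart hc hp)
  refine ((hPinv.clm_comp hBc).clm_comp hP).congr_of_eventuallyEq ?_
  filter_upwards [c.open_source.mem_nhds hp,
    (trivializationAt N (TangentSpace 𝓘(ℝ, N)) p).open_baseSet.mem_nhds
      (mem_baseSet_trivializationAt N (TangentSpace 𝓘(ℝ, N)) p)] with q hq hq'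
  rw [(isInvertible_trivDeriv hc hq hq').2, ContinuousLinearMap.inCoordinates, localCov,
    mvfderiv_eq_fderiv_comp_symm hc hq ((contMDiffAt_chartVec hc hq (hY q)).mdifferentiableAt
      (by simp)), trivDeriv]
  have e : (chartVec c Y ∘ c.symm) (c q) = chartVec c Y q := by
    rw [Function.comp_apply, c.left_inv hq]
  rw [Function.comp_apply (f := fun z => fderiv ℝ (chartVec c Y ∘ c.symm) z
      + (Γ z).flip ((chartVec c Y ∘ c.symm) z)), e]
  rfl

/-! ### Gluing the covariant derivatives of the charts -/

/-- A compatible family of connection coefficients in charts covering a manifold. -/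
structure Atlas (N Q : Type*) [NormedAddCommGroup N] [NormedSpace ℝ N]
    [TopologicalSpace Q] [ChartedSpace N Q] (ι : Type*) where
  chart : ι → OpenPartialHomeomorph Q N
  mem_maximalAtlas : ∀ i, chart i ∈ IsManifold.maximalAtlas 𝓘(ℝ, N) ∞ Q
  exists_mem_source : ∀ p, ∃ i, p ∈ (chart i).source
  Γ : ι → N → N →L[ℝ] N →L[ℝ] N
  contDiffOn_Γ : ∀ i, ContDiffOn ℝ ∞ (Γ i) (chart i).target
  /-- the change of coordinates -/
  φ : ι → ι → N → N
  contDiffAt_φ : ∀ i j, ∀ p ∈ (chart i).source ∩ (chart j).source,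
    ContDiffAt ℝ ∞ (φ i j) (chart i p)
  φ_eq : ∀ i j, ∀ p ∈ (chart i).source ∩ (chart j).source, φ i j (chart i p) = chart j p
  compatible : ∀ i j, ∀ p ∈ (chart i).source ∩ (chart j).source,
    Compatible (Γ i) (Γ j) (φ i j) (chart i p)

namespace Atlas

variable {ι : Type*} (A : Atlas N Q ι)

theorem localCov_eq {i j : ι} (hi : p ∈ (A.chart i).source) (hj : p ∈ (A.chart j).source)
    (hY : DiffAt Y p) :
    localCov (A.chart i) (A.Γ i) Y p = localCov (A.chart j) (A.Γ j) Y p := by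
  refine ChartConnection.localCov_eq (A.mem_maximalAtlas i) hi (A.mem_maximalAtlas j) hj hY
    (A.contDiffAt_φ i j p ⟨hi, hj⟩) ?_ (A.compatible i j p ⟨hi, hj⟩)
  filter_upwards [(A.chart i).open_source.mem_nhds hi, (A.chart j).open_source.mem_nhds hj]
    with q hq hq' using (A.φ_eq i j q ⟨hq, hq'⟩).symm

/-- A chart at a point. -/
def index (p : Q) : ι := (A.exists_mem_source p).choose

theorem mem_source_index (p : Q) : p ∈ (A.chart (A.index p)).source :=
  (A.exists_mem_source p).choose_spec

/-- The connection with the given coefficients. -/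
def connection : CovariantDerivative 𝓘(ℝ, N) N (TangentSpace 𝓘(ℝ, N) : Q → Type _) where
  -- A chart is chosen separately at each point. The connection axioms are pointwise and hold for
  -- any choice; independence of it is `connection_eq`, for fields differentiable at the point.
  toFun Y p := localCov (A.chart (A.index p)) (A.Γ (A.index p)) Y p
  isCovariantDerivativeOnUniv :=
    { add := fun {_ _ x} hY hZ _ =>
        localCov_add (A.mem_maximalAtlas _) (A.mem_source_index x) hY hZ
      leibniz := fun {_ _ x} hY hg _ =>
        localCov_smul (A.mem_maximalAtlas _) (A.mem_source_index x) hY hg }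

theorem connection_eq {i : ι} (hi : p ∈ (A.chart i).source) (hY : DiffAt Y p) :
    A.connection Y p = localCov (A.chart i) (A.Γ i) Y p :=
  A.localCov_eq (A.mem_source_index p) hi hY

theorem chartDeriv_connection {i : ι} (hi : p ∈ (A.chart i).source) (hY : DiffAt Y p)
    (v : TangentSpace 𝓘(ℝ, N) p) :
    chartDeriv (A.chart i) p (A.connection Y p v)
      = mvfderiv 𝓘(ℝ, N) (chartVec (A.chart i) Y) p v
        + A.Γ i (A.chart i p) (chartDeriv (A.chart i) p v) (chartVec (A.chart i) Y p) := by
  rw [A.connection_eq hi hY, chartDeriv_localCov (A.mem_maximalAtlas i) hi]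

/-- The derivative terms of the two covariant derivatives form the bracket, which leaves the
antisymmetric part of the coefficients. -/
theorem torsion_connection
    (hsymm : ∀ i, ∀ p ∈ (A.chart i).source, ∀ v w, A.Γ i (A.chart i p) v w
      = A.Γ i (A.chart i p) w v) : A.connection.torsion = 0 := by
  rw [CovariantDerivative.torsion_eq_zero_iff]
  intro X Y p hX hY
  have hi := A.mem_source_index p
  apply chartDeriv_injective (A.mem_maximalAtlas _) hi
  rw [map_sub, A.chartDeriv_connection hi hY, A.chartDeriv_connection hi hX,
    chartDeriv_mlieBracket (A.mem_maximalAtlas _) hi hX hY, hsymm _ p hi,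
    show chartVec (A.chart (A.index p)) X p = chartDeriv (A.chart (A.index p)) p (X p) from rfl]
  exact add_sub_add_right_eq_sub _ _ _

/-- Near `p` the varying choice of charts may be replaced by the chart chosen at `p`, since a smooth
field is differentiable at all nearby points. -/
theorem contMDiffCovariantDerivative_connection :
    CovariantDerivative.ContMDiffCovariantDerivative A.connection ∞ := by
  refine ⟨⟨fun {Y} hY => ?_⟩⟩
  rw [contMDiffOn_univ] at hY ⊢
  have hY' : ContMDiff 𝓘(ℝ, N) 𝓘(ℝ, N).tangent ∞
      (fun q => (⟨q, Y q⟩ : TangentBundle 𝓘(ℝ, N) Q)) := hY.of_le (by simp)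
  intro p
  have hp := A.mem_source_index p
  have hopen := (A.chart (A.index p)).open_source.mem_nhds hp
  refine (contMDiffAt_localCov (A.mem_maximalAtlas _) hp ((A.contDiffOn_Γ _).contDiffAt
    ((A.chart (A.index p)).open_target.mem_nhds ((A.chart (A.index p)).map_source hp)))
    hY').congr_of_eventuallyEq ?_
  filter_upwards [hopen] with q hq
  exact congrArg (Bundle.TotalSpace.mk q) (A.connection_eq hq
    ((hY' q).mdifferentiableAt (by simp)))

end Atlas

end ChartConnection

namespace InfinityData

variable {n : ℕ} {M B : Type*}
    [TopologicalSpace M] [ChartedSpace (EuclideanHalfSpace (n + 1)) M]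
    [IsManifold (𝓡∂ (n + 1)) ∞ M]
    [TopologicalSpace B] [ChartedSpace (EuclideanSpace ℝ (Fin n)) B]
    [IsManifold (𝓡 n) ∞ B]
    (S : InfinityData n M B)

/-! ### The smooth structure of `Spi` -/

/-- The fibre coordinate given by the boundary defining function. -/
def fiberCoord (p : S.Spi) : ℝ := (S.spiEquiv p).1

theorem spiEquiv_symm_apply (p : S.Spi) : S.spiEquiv.symm (S.fiberCoord p, p.base) = p :=
  S.spiEquiv.symm_apply_apply p

theorem fiberCoord_symm (u : ℝ) (x : B) : S.fiberCoord (S.spiEquiv.symm (u, x)) = u :=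
  congrArg Prod.fst (S.spiEquiv.apply_symm_apply (u, x))

theorem jet_eq_jetRho (p : S.Spi) : p.jet = S.jetRho p.base (S.fiberCoord p) :=
  p.2.choose_spec

theorem continuous_base : Continuous (Spi.base : S.Spi → B) :=
  continuous_snd.comp S.spiHomeomorph.continuous

theorem mem_chartAt_target (p : S.Spi) (z : ℝ × EuclideanSpace ℝ (Fin n)) :
    z ∈ (chartAt (ℝ × EuclideanSpace ℝ (Fin n)) p).target
      ↔ z.2 ∈ (chartAt (EuclideanSpace ℝ (Fin n)) p.base).target := by
  change z ∈ (S.spiHomeomorph.toOpenPartialHomeomorph.trans ((OpenPartialHomeomorph.refl ℝ).prod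
    (chartAt (EuclideanSpace ℝ (Fin n)) p.base))).target ↔ _
  simp only [mfld_simps]

theorem contMDiff_chartAt_self (p : S.Spi) :
    ContMDiffAt 𝓘(ℝ, ℝ × EuclideanSpace ℝ (Fin n)) 𝓘(ℝ, ℝ × EuclideanSpace ℝ (Fin n)) ∞
      (chartAt (ℝ × EuclideanSpace ℝ (Fin n)) p) p :=
  contMDiffAt_of_mem_maximalAtlas (IsManifold.chart_mem_maximalAtlas p) (mem_chart_source _ p)

theorem contMDiff_fiberCoord :
    ContMDiff 𝓘(ℝ, ℝ × EuclideanSpace ℝ (Fin n)) 𝓘(ℝ, ℝ) ∞ S.fiberCoord := by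
  intro p
  have h : ContMDiffAt 𝓘(ℝ, ℝ × EuclideanSpace ℝ (Fin n)) 𝓘(ℝ, ℝ) ∞
      (fun q : S.Spi => (chartAt (ℝ × EuclideanSpace ℝ (Fin n)) p q).1) p :=
    contDiff_fst.contMDiff.contMDiffAt.comp p (S.contMDiff_chartAt_self p)
  exact h

theorem contMDiff_base :
    ContMDiff 𝓘(ℝ, ℝ × EuclideanSpace ℝ (Fin n)) (𝓡 n) ∞ (Spi.base : S.Spi → B) := by
  intro p
  have h1 : ContMDiffAt 𝓘(ℝ, ℝ × EuclideanSpace ℝ (Fin n)) 𝓘(ℝ, EuclideanSpace ℝ (Fin n)) ∞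
      (fun q : S.Spi => chartAt (EuclideanSpace ℝ (Fin n)) p.base q.base) p :=
    contDiff_snd.contMDiff.contMDiffAt.comp p (S.contMDiff_chartAt_self p)
  have h2 : ContMDiffAt (𝓡 n) (𝓡 n) ∞ (chartAt (EuclideanSpace ℝ (Fin n)) p.base).symm
      (chartAt (EuclideanSpace ℝ (Fin n)) p.base p.base) :=
    contMDiffAt_symm_of_mem_maximalAtlas (IsManifold.chart_mem_maximalAtlas p.base)
      (mem_chart_target _ _)
  refine (h2.comp p h1).congr_of_eventuallyEq ?_
  filter_upwards [S.continuous_base.continuousAt.preimage_mem_nhds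
    ((chartAt (EuclideanSpace ℝ (Fin n)) p.base).open_source.mem_nhds
      (mem_chart_source _ p.base))] with q hq
  exact ((chartAt (EuclideanSpace ℝ (Fin n)) p.base).left_inv hq).symm

section

variable {V : Type*} [NormedAddCommGroup V] [NormedSpace ℝ V]

theorem contMDiffAt_spiEquiv_symm {f : V → ℝ} {g : V → B} {z : V} (hf : ContDiffAt ℝ ∞ f z)
    (hg : ContMDiffAt 𝓘(ℝ, V) (𝓡 n) ∞ g z) :
    ContMDiffAt 𝓘(ℝ, V) 𝓘(ℝ, ℝ × EuclideanSpace ℝ (Fin n)) ∞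
      (fun w => S.spiEquiv.symm (f w, g w)) z := by
  set p := S.spiEquiv.symm (f z, g z)
  have hpz : p.base = g z := rfl
  have h1 : ContMDiffAt 𝓘(ℝ, V) (𝓡 n) ∞
      (fun w => chartAt (EuclideanSpace ℝ (Fin n)) p.base (g w)) z :=
    (contMDiffAt_of_mem_maximalAtlas (IsManifold.chart_mem_maximalAtlas p.base)
      (mem_chart_source _ _)).comp z hg
  have h2 : ContMDiffAt 𝓘(ℝ, V) 𝓘(ℝ, ℝ × EuclideanSpace ℝ (Fin n)) ∞
      (fun w => (f w, chartAt (EuclideanSpace ℝ (Fin n)) p.base (g w))) z :=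
    (hf.prodMk h1.contDiffAt).contMDiffAt
  have h3 : ContMDiffAt 𝓘(ℝ, ℝ × EuclideanSpace ℝ (Fin n)) 𝓘(ℝ, ℝ × EuclideanSpace ℝ (Fin n)) ∞
      (chartAt (ℝ × EuclideanSpace ℝ (Fin n)) p).symm
      (f z, chartAt (EuclideanSpace ℝ (Fin n)) p.base (g z)) := by
    refine contMDiffAt_symm_of_mem_maximalAtlas (IsManifold.chart_mem_maximalAtlas p) ?_
    rw [mem_chartAt_target]
    exact mem_chart_target _ _
  refine (h3.comp z h2).congr_of_eventuallyEq ?_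
  filter_upwards [hg.continuousAt.preimage_mem_nhds
    ((chartAt (EuclideanSpace ℝ (Fin n)) p.base).open_source.mem_nhds
      (mem_chart_source _ p.base))] with w hw
  exact congrArg (fun x => S.spiEquiv.symm (f w, x))
    ((chartAt (EuclideanSpace ℝ (Fin n)) p.base).left_inv hw).symm

end

namespace BeigSchmidtChart

variable {S} (E : S.BeigSchmidtChart)

/-! ### Jets of functions of a Beig–Schmidt coordinate -/

/-- Replacing `ρ₁²` by `ρ²` does not change the 2-jet: in `ρ₁² - ρ² = (ρ₁ - ρ)(ρ₁ + ρ)` the first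
factor is quadratically small and the second tends to zero. Hence the shift by `s` may be measured
with either defining function. -/
theorem isTwoJetOf_add_sq {x : B} (hx : S.ι x ∈ E.toChart.source) (s : ℝ) :
    IsTwoJetOf (S.jetRho x (E.jetCoord x + s))
      fun z => rhoCoord E.toChart z + s * rhoCoord E.toChart z ^ 2 := by
  obtain ⟨hf, h⟩ := E.isTwoJetOf_jetCoord hx
  have hf2 : ContMDiffAt (𝓡∂ (n + 1)) 𝓘(ℝ, ℝ) ∞
      (fun z => rhoCoord E.toChart z + s * rhoCoord E.toChart z ^ 2) (S.ι x) :=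
    hf.add (contMDiffAt_const.mul (hf.pow 2))
  refine ⟨hf2, Quotient.sound ?_⟩
  have h1 : (fun p => (S.ρ p + E.jetCoord x * S.ρ p ^ 2) - rhoCoord E.toChart p) =o[𝓝 (S.ι x)]
      fun p => ‖extChartAt (𝓡∂ (n + 1)) (S.ι x) p
        - extChartAt (𝓡∂ (n + 1)) (S.ι x) (S.ι x)‖ ^ 2 := Quotient.exact h
  change (fun p => (S.ρ p + (E.jetCoord x + s) * S.ρ p ^ 2)
    - (rhoCoord E.toChart p + s * rhoCoord E.toChart p ^ 2)) =o[𝓝 (S.ι x)]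
      fun p => ‖extChartAt (𝓡∂ (n + 1)) (S.ι x) p
        - extChartAt (𝓡∂ (n + 1)) (S.ι x) (S.ι x)‖ ^ 2
  have hρ0 : Tendsto S.ρ (𝓝 (S.ι x)) (𝓝 0) := by
    have := S.contMDiff_ρ.continuous.tendsto (S.ι x)
    rwa [S.ρ_eq_zero] at this
  have hr0 : Tendsto (rhoCoord E.toChart) (𝓝 (S.ι x)) (𝓝 0) := by
    have := hf.continuousAt.tendsto
    rwa [show rhoCoord E.toChart (S.ι x) = 0 from
      congrArg Prod.fst (S.coord_ι E.mem_maximalAtlas hx)] at this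
  have hρO : S.ρ =O[𝓝 (S.ι x)] fun p => ‖extChartAt (𝓡∂ (n + 1)) (S.ι x) p
      - extChartAt (𝓡∂ (n + 1)) (S.ι x) (S.ι x)‖ := by
    have h4 := ((S.contMDiff_ρ (S.ι x)).mdifferentiableAt (by simp)).hasMFDerivAt.2.isBigO_sub
    have h5 := (h4.comp_tendsto (map_extChartAt_nhds (I := 𝓡∂ (n + 1)) (S.ι x)).le).norm_right
    refine h5.congr' ?_ (Eventually.of_forall fun p => rfl)
    filter_upwards [extChartAt_source_mem_nhds (I := 𝓡∂ (n + 1)) (S.ι x)] with p hp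
    simp only [Function.comp_apply, writtenInExtChartAt, extChartAt_to_inv, S.ρ_eq_zero,
      (extChartAt (𝓡∂ (n + 1)) (S.ι x)).left_inv hp]
    exact sub_zero _
  have hO := hρO.pow 2
  have h2 : (fun p => rhoCoord E.toChart p - S.ρ p) =O[𝓝 (S.ι x)]
      fun p => ‖extChartAt (𝓡∂ (n + 1)) (S.ι x) p
        - extChartAt (𝓡∂ (n + 1)) (S.ι x) (S.ι x)‖ ^ 2 :=
    ((hO.const_mul_left (E.jetCoord x)).sub h1.isBigO).congr_left fun p => by ring
  have h3 : Tendsto (fun p => s * (S.ρ p + rhoCoord E.toChart p)) (𝓝 (S.ι x)) (𝓝 0) := by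
    simpa using (hρ0.add hr0).const_mul s
  have h6 := ((isLittleO_one_iff ℝ).2 h3).mul_isBigO h2
  simp only [one_mul] at h6
  exact (h1.sub h6).congr_left fun p => by ring

/-! ### Charts of `Spi` -/

/-- The coordinates `(u, y)` of `Spi` associated to a Beig–Schmidt chart. -/
def spiCoord (p : S.Spi) : ℝ × EuclideanSpace ℝ (Fin n) :=
  -- If `j = j²ρ + f j²ρ²` and `j²ρ₁ = j²ρ + c j²ρ²`, then `j = j²ρ₁ + (f - c) j²ρ₁²`, because `ρ`
  -- and `ρ₁` have squares with the same 2-jet.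
  (S.fiberCoord p - E.jetCoord p.base, yCoord E.toChart (S.ι p.base))

/-- The inverse of the coordinates `(u, y)`. -/
def spiCoordInv [Nonempty B] (z : ℝ × EuclideanSpace ℝ (Fin n)) : S.Spi :=
  S.spiEquiv.symm (z.1 + E.jetCoord (E.bdry.symm z.2), E.bdry.symm z.2)

theorem contMDiffAt_spiCoordInv [Nonempty B] {z : ℝ × EuclideanSpace ℝ (Fin n)}
    (hz : z.2 ∈ S.bdryTarget E.toChart) :
    ContMDiffAt 𝓘(ℝ, ℝ × EuclideanSpace ℝ (Fin n)) 𝓘(ℝ, ℝ × EuclideanSpace ℝ (Fin n)) ∞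
      E.spiCoordInv z := by
  have hmem := (S.isOpen_bdryTarget E.mem_maximalAtlas).mem_nhds hz
  refine S.contMDiffAt_spiEquiv_symm ?_ ?_
  · exact contDiffAt_fst.add ((contDiffOn_jetCoord.contDiffAt hmem).comp z contDiffAt_snd)
  · exact ((S.contMDiffOn_bdryChart_symm E.mem_maximalAtlas).contMDiffAt hmem).comp z
      contDiffAt_snd.contMDiffAt

theorem contMDiffAt_jetCoord_base {p : S.Spi} (hp : S.ι p.base ∈ E.toChart.source) :
    ContMDiffAt 𝓘(ℝ, ℝ × EuclideanSpace ℝ (Fin n)) 𝓘(ℝ, ℝ) ∞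
      (fun q : S.Spi => E.jetCoord q.base) p := by
  have : Nonempty B := ⟨p.base⟩
  have hs := E.bdry.open_source.mem_nhds hp
  have h1 : ContMDiffAt (𝓡 n) 𝓘(ℝ, ℝ) ∞ E.jetCoord p.base := by
    refine ((contDiffOn_jetCoord.contDiffAt (isOpen_target_nhds hp)).contMDiffAt.comp p.base
      ((S.contMDiffOn_yCoord_ι E.mem_maximalAtlas).contMDiffAt hs)).congr_of_eventuallyEq ?_
    filter_upwards [hs] with x hx
    exact congrArg E.jetCoord (E.bdry.left_inv hx).symm
  exact h1.comp p (S.contMDiff_base p)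

theorem contMDiffAt_spiCoord {p : S.Spi} (hp : S.ι p.base ∈ E.toChart.source) :
    ContMDiffAt 𝓘(ℝ, ℝ × EuclideanSpace ℝ (Fin n)) 𝓘(ℝ, ℝ × EuclideanSpace ℝ (Fin n)) ∞
      E.spiCoord p := by
  have : Nonempty B := ⟨p.base⟩
  have hs := E.bdry.open_source.mem_nhds hp
  exact ((S.contMDiff_fiberCoord p).sub (E.contMDiffAt_jetCoord_base hp)).prodMk_space
    (((S.contMDiffOn_yCoord_ι E.mem_maximalAtlas).contMDiffAt hs).comp p (S.contMDiff_base p))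

/-- The chart `(u, y)` of `Spi` associated to a Beig–Schmidt chart. -/
def spiChart [Nonempty B] : OpenPartialHomeomorph S.Spi (ℝ × EuclideanSpace ℝ (Fin n)) where
  toFun := E.spiCoord
  invFun := E.spiCoordInv
  source := {p | S.ι p.base ∈ E.toChart.source}
  target := {z | z.2 ∈ S.bdryTarget E.toChart}
  map_source' p hp := ⟨p.base, hp, rfl⟩
  map_target' z hz := E.bdry.map_target hz
  left_inv' p hp := by
    have h : E.bdry.symm (yCoord E.toChart (S.ι p.base)) = p.base := E.bdry.left_inv hp
    rw [spiCoordInv, spiCoord, h, sub_add_cancel, S.spiEquiv_symm_apply]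
  right_inv' z hz := by
    refine Prod.ext ?_ ?_
    · change S.fiberCoord _ - E.jetCoord (E.bdry.symm z.2) = _
      rw [spiCoordInv, fiberCoord_symm, add_sub_cancel_right]
    · exact E.bdry.right_inv hz
  open_source := E.bdry.open_source.preimage S.continuous_base
  open_target := (S.isOpen_bdryTarget E.mem_maximalAtlas).preimage continuous_snd
  continuousOn_toFun p hp := (E.contMDiffAt_spiCoord hp).continuousAt.continuousWithinAt
  continuousOn_invFun z hz := (E.contMDiffAt_spiCoordInv hz).continuousAt.continuousWithinAt

theorem spiChart_mem_maximalAtlas [Nonempty B] :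
    E.spiChart ∈ IsManifold.maximalAtlas 𝓘(ℝ, ℝ × EuclideanSpace ℝ (Fin n)) ∞ S.Spi :=
  OpenPartialHomeomorph.mem_maximalAtlas_of_contMDiffOn _
    (fun _ hp => (E.contMDiffAt_spiCoord hp).contMDiffWithinAt)
    fun _ hz => (E.contMDiffAt_spiCoordInv hz).contMDiffWithinAt

theorem isAssociated_spiChart [Nonempty B] : IsAssociated E.spiChart E where
  mem_maximalAtlas := E.spiChart_mem_maximalAtlas
  mem_source _ hp := hp
  y_eq _ _ := rfl
  jet_eq p hp := by
    have h := E.isTwoJetOf_add_sq hp (S.fiberCoord p - E.jetCoord p.base)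
    rw [add_sub_cancel, ← S.jet_eq_jetRho] at h
    exact h

-- A 2-jet determines its fibre coordinate (`jetRho_injective`), so every chart associated with `E`
-- is a restriction of `E.spiChart`.
variable {E} in
theorem _root_.InfinityData.IsAssociated.eq_spiCoord
    {c : OpenPartialHomeomorph S.Spi (ℝ × EuclideanSpace ℝ (Fin n))} (h : IsAssociated c E)
    {p : S.Spi} (hp : p ∈ c.source) : c p = E.spiCoord p := by
  refine Prod.ext ?_ (h.y_eq p hp)
  obtain ⟨hf, h1⟩ := h.jet_eq p hp
  obtain ⟨hf', h2⟩ := E.isTwoJetOf_add_sq (h.mem_source p hp) (c p).1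
  have h3 := S.jetRho_injective p.base ((S.jet_eq_jetRho p).symm.trans (h1.trans h2.symm))
  rw [spiCoord, h3, add_sub_cancel_left]

end BeigSchmidtChart

end InfinityData

/-! ### Connection coefficients on a product of the line with a vector space -/

section FiberBase

variable {V : Type*} [NormedAddCommGroup V] [NormedSpace ℝ V]

/-- The bilinear map `(v, w) ↦ (K v w, G v w)` that only sees the components along `V`. -/
def fiberBaseForm (K : V →L[ℝ] V →L[ℝ] ℝ) (G : V →L[ℝ] V →L[ℝ] V) :
    ℝ × V →L[ℝ] ℝ × V →L[ℝ] ℝ × V :=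
  (((ContinuousLinearMap.compL ℝ (ℝ × V) V (ℝ × V)).flip (.snd ℝ ℝ V)).comp
    ((ContinuousLinearMap.compL ℝ V ℝ (ℝ × V) (.inl ℝ ℝ V)).comp K
      + (ContinuousLinearMap.compL ℝ V V (ℝ × V) (.inr ℝ ℝ V)).comp G)).comp (.snd ℝ ℝ V)

theorem fiberBaseForm_apply (K : V →L[ℝ] V →L[ℝ] ℝ) (G : V →L[ℝ] V →L[ℝ] V) (v w : ℝ × V) :
    fiberBaseForm K G v w = (K v.2 w.2, G v.2 w.2) := by
  simp [fiberBaseForm]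

theorem ContDiffOn.fiberBaseForm {E : Type*} [NormedAddCommGroup E] [NormedSpace ℝ E] {s : Set E}
    {K : E → V →L[ℝ] V →L[ℝ] ℝ} {G : E → V →L[ℝ] V →L[ℝ] V} (hK : ContDiffOn ℝ ∞ K s)
    (hG : ContDiffOn ℝ ∞ G s) : ContDiffOn ℝ ∞ (fun z => fiberBaseForm (K z) (G z)) s :=
  (contDiffOn_const.clm_comp ((contDiffOn_const.clm_comp hK).add
    (contDiffOn_const.clm_comp hG))).clm_comp contDiffOn_const

theorem ContDiffOn.smul_add_fst_smul {G : Type*} [NormedAddCommGroup G] [NormedSpace ℝ G]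
    {s : Set V} {f g : V → G} (hf : ContDiffOn ℝ ∞ f s) (hg : ContDiffOn ℝ ∞ g s) (b c : ℝ) :
    ContDiffOn ℝ ∞ (fun a : ℝ × V => b • (c • f a.2 + a.1 • g a.2)) {a | a.2 ∈ s} := by
  have h : MapsTo Prod.snd {a : ℝ × V | a.2 ∈ s} s := fun _ ha => ha
  exact contDiffOn_const.smul ((contDiffOn_const.smul (hf.comp contDiff_snd.contDiffOn h)).add
    (contDiff_fst.contDiffOn.smul (hg.comp contDiff_snd.contDiffOn h)))

/-- The change of coordinates `(u, y) ↦ (u - κ(y), Y(y))`. -/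
def shearMap (κ : V → ℝ) (Y : V → V) (z : ℝ × V) : ℝ × V := (z.1 - κ z.2, Y z.2)

variable {κ : V → ℝ} {Y : V → V} {a : ℝ × V}

theorem contDiffAt_shearMap (hκ : ContDiffAt ℝ ∞ κ a.2) (hY : ContDiffAt ℝ ∞ Y a.2) :
    ContDiffAt ℝ ∞ (shearMap κ Y) a :=
  (contDiffAt_fst.sub (hκ.comp a contDiffAt_snd)).prodMk (hY.comp a contDiffAt_snd)

theorem fderiv_shearMap (hκ : DifferentiableAt ℝ κ a.2) (hY : DifferentiableAt ℝ Y a.2)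
    (v : ℝ × V) :
    fderiv ℝ (shearMap κ Y) a v = (v.1 - fderiv ℝ κ a.2 v.2, fderiv ℝ Y a.2 v.2) := by
  have h : HasFDerivAt (shearMap κ Y) _ a :=
    (hasFDerivAt_fst.sub (hκ.hasFDerivAt.comp a hasFDerivAt_snd)).prodMk
      (hY.hasFDerivAt.comp a hasFDerivAt_snd)
  rw [h.fderiv]
  rfl

theorem ContDiffAt.eventually_differentiableAt {E F : Type*} [NormedAddCommGroup E]
    [NormedSpace ℝ E] [NormedAddCommGroup F] [NormedSpace ℝ F] {f : E → F} {x : E}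
    (h : ContDiffAt ℝ ∞ f x) : ∀ᶠ z in 𝓝 x, DifferentiableAt ℝ f z :=
  ((h.of_le (m := 1) (by simp)).eventually (by simp)).mono fun _ hz =>
    hz.differentiableAt (by simp)

theorem ContDiffAt.differentiableAt_fderiv {E F : Type*} [NormedAddCommGroup E]
    [NormedSpace ℝ E] [NormedAddCommGroup F] [NormedSpace ℝ F] {f : E → F} {x : E}
    (h : ContDiffAt ℝ ∞ f x) : DifferentiableAt ℝ (fderiv ℝ f) x :=
  (h.fderiv_right (m := 1) (WithTop.coe_le_coe.2 (le_top : (2 : ℕ∞) ≤ ⊤))).differentiableAt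
    (by simp)

theorem fderiv_fderiv_shearMap (hκ : ContDiffAt ℝ ∞ κ a.2) (hY : ContDiffAt ℝ ∞ Y a.2)
    (v w : ℝ × V) :
    fderiv ℝ (fderiv ℝ (shearMap κ Y)) a v w
      = (-fderiv ℝ (fderiv ℝ κ) a.2 v.2 w.2, fderiv ℝ (fderiv ℝ Y) a.2 v.2 w.2) := by
  have h1 := (contDiffAt_shearMap hκ hY).differentiableAt_fderiv.hasFDerivAt.clm_apply
    (hasFDerivAt_const w a)
  have h2 := ((hasFDerivAt_const w.1 a).sub ((hκ.differentiableAt_fderiv.hasFDerivAt.comp a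
    hasFDerivAt_snd).clm_apply (hasFDerivAt_const w.2 a))).prodMk
    ((hY.differentiableAt_fderiv.hasFDerivAt.comp a hasFDerivAt_snd).clm_apply
      (hasFDerivAt_const w.2 a))
  have h3 := h1.unique (h2.congr_of_eventuallyEq ?_)
  · have h4 := congrArg (fun L : ℝ × V →L[ℝ] ℝ × V => L v) h3
    simpa using h4
  · filter_upwards [continuousAt_snd.eventually hκ.eventually_differentiableAt,
      continuousAt_snd.eventually hY.eventually_differentiableAt] with z h1 h2
      using fderiv_shearMap h1 h2 w

/-- The `V`-component of the transformation law involves `G` alone; in the `ℝ`-component the shear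
by `-κ` contributes `D²κ - dκ ∘ G`, the covariant Hessian of `κ`. -/
theorem compatible_shearMap {K K' : ℝ × V → V →L[ℝ] V →L[ℝ] ℝ} {G G' : V → V →L[ℝ] V →L[ℝ] V}
    (hκ : ContDiffAt ℝ ∞ κ a.2) (hY : ContDiffAt ℝ ∞ Y a.2)
    (hG : ∀ v w, fderiv ℝ Y a.2 (G a.2 v w) = G' (Y a.2) (fderiv ℝ Y a.2 v) (fderiv ℝ Y a.2 w)
      + fderiv ℝ (fderiv ℝ Y) a.2 v w)
    (hK : ∀ v w, K' (shearMap κ Y a) (fderiv ℝ Y a.2 v) (fderiv ℝ Y a.2 w) = K a v w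
      + fderiv ℝ (fderiv ℝ κ) a.2 v w - fderiv ℝ κ a.2 (G a.2 v w)) :
    ChartConnection.Compatible (fun z => fiberBaseForm (K z) (G z.2))
      (fun z => fiberBaseForm (K' z) (G' z.2)) (shearMap κ Y) a := by
  intro v w
  have h1 := fderiv_shearMap (hκ.differentiableAt (by simp)) (hY.differentiableAt (by simp))
  rw [fderiv_fderiv_shearMap hκ hY, fiberBaseForm_apply, fiberBaseForm_apply, h1, h1, h1]
  refine Prod.ext ?_ ?_
  · have := hK v.2 w.2
    simp only [Prod.fst_add]
    rw [this]
    ring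
  · have := hG v.2 w.2
    simp only [Prod.snd_add]
    rw [this, add_comm]
    rfl

end FiberBase

/-! ### Smoothness of the inverse of a matrix -/

section Matrix

variable {E m : Type*} [NormedAddCommGroup E] [NormedSpace ℝ E] [Fintype m] [DecidableEq m]
  {s : Set E} {A : E → Matrix m m ℝ}

theorem ContDiffOn.matrix_det (hA : ∀ i j, ContDiffOn ℝ ∞ (fun z => A z i j) s) :
    ContDiffOn ℝ ∞ (fun z => (A z).det) s := by
  simp only [Matrix.det_apply]
  exact ContDiffOn.sum fun σ _ => (contDiffOn_prod fun i _ => hA _ _).const_smul _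

theorem ContDiffOn.matrix_inv (hA : ∀ i j, ContDiffOn ℝ ∞ (fun z => A z i j) s)
    (h : ∀ z ∈ s, IsUnit (A z).det) (i j : m) : ContDiffOn ℝ ∞ (fun z => (A z)⁻¹ i j) s := by
  simp only [Matrix.inv_def, Matrix.smul_apply, Matrix.adjugate_apply, Ring.inverse_eq_inv',
    smul_eq_mul]
  refine ((ContDiffOn.matrix_det hA).inv fun z hz => (h z hz).ne_zero).mul
    (ContDiffOn.matrix_det fun k l => ?_)
  by_cases hk : k = j
  · subst hk
    simpa using contDiffOn_const
  · simpa [Matrix.updateRow_ne hk] using hA k l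

end Matrix

namespace InfinityData

variable {n : ℕ} {M B : Type*}
    [TopologicalSpace M] [ChartedSpace (EuclideanHalfSpace (n + 1)) M]
    [IsManifold (𝓡∂ (n + 1)) ∞ M]
    [TopologicalSpace B] [ChartedSpace (EuclideanSpace ℝ (Fin n)) B]
    [IsManifold (𝓡 n) ∞ B]
    {S : InfinityData n M B}

namespace BeigSchmidtChart

variable {E E' : S.BeigSchmidtChart} [Nonempty B]

/-! ### The connection coefficients of a Beig–Schmidt chart -/

/-- Symmetry of `k` is not part of the data of a chart; it holds because `k - 2σh` is the
first-order coefficient of a symmetric metric and `h` is symmetric. -/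
theorem kForm_symm {y : EuclideanSpace ℝ (Fin n)} (hy : y ∈ S.bdryTarget E.toChart)
    (v w : EuclideanSpace ℝ (Fin n)) : E.kForm y v w = E.kForm y w v := by
  have hs := hForm_symm hy v w
  obtain ⟨x, hx, rfl⟩ := hy
  have h1 := hasRightExpansion_metricTT_slice hx v w
  have h2 := (hasRightExpansion_metricTT_slice hx w v).congr' (by
    filter_upwards [slice_mem_interior hx] with t ht
    rw [S.metricForm_symm ht])
  rw [← hs] at h2
  have h3 := tendsto_nhds_unique h1 h2
  linarith

theorem contDiffOn_christoffel (α γ β : Fin n) :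
    ContDiffOn ℝ ∞ (fun y => christoffel E.h y α γ β) (S.bdryTarget E.toChart) := by
  have hD : ∀ α β : Fin n, ∀ v, ContDiffOn ℝ ∞ (fun y => fderiv ℝ (fun z => E.h z α β) y v)
      (S.bdryTarget E.toChart) := fun α β v =>
    ((E.contDiffOn_h α β).fderiv_of_isOpen (S.isOpen_bdryTarget E.mem_maximalAtlas)
      (by simp)).clm_apply contDiffOn_const
  exact contDiffOn_const.mul (ContDiffOn.sum fun δ _ =>
    (ContDiffOn.matrix_inv E.contDiffOn_h (fun y hy => isUnit_det_h hy) α δ).mul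
      (((hD _ _ _).add (hD _ _ _)).sub (hD _ _ _)))

theorem christoffel_symm {y : EuclideanSpace ℝ (Fin n)} (hy : y ∈ S.bdryTarget E.toChart)
    (α γ β : Fin n) : christoffel E.h y α γ β = christoffel E.h y α β γ := by
  unfold christoffel
  rw [fderiv_h_symm hy γ β]
  congr 1
  exact Finset.sum_congr rfl fun δ _ => by ring

theorem gammaForm_symm {y : EuclideanSpace ℝ (Fin n)} (hy : y ∈ S.bdryTarget E.toChart)
    (v w : EuclideanSpace ℝ (Fin n)) : E.gammaForm y v w = E.gammaForm y w v := by
  unfold gammaForm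
  congr 1
  funext α
  rw [Finset.sum_comm]
  exact Finset.sum_congr rfl fun γ _ => Finset.sum_congr rfl fun β _ => by
    rw [christoffel_symm hy]; ring

variable (E) in
/-- The Christoffel symbols of the boundary metric as a continuous bilinear map. -/
def gammaBilin (y : EuclideanSpace ℝ (Fin n)) :
    EuclideanSpace ℝ (Fin n) →L[ℝ] EuclideanSpace ℝ (Fin n) →L[ℝ] EuclideanSpace ℝ (Fin n) :=
  ∑ α, (ContinuousLinearMap.compL ℝ _ ℝ _ (ContinuousLinearMap.toSpanSingleton ℝ
    (EuclideanSpace.single α (1 : ℝ)))).comp (matForm n fun γ β => christoffel E.h y α γ β)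

theorem gammaBilin_apply (y v w : EuclideanSpace ℝ (Fin n)) :
    E.gammaBilin y v w = E.gammaForm y v w := by
  rw [sum_single (E.gammaForm y v w), gammaBilin, sum_apply, sum_apply]
  refine Finset.sum_congr rfl fun α _ => ?_
  change matForm n (fun γ β => christoffel E.h y α γ β) v w
    • EuclideanSpace.single α (1 : ℝ) = _
  rw [matForm_apply]
  rfl

theorem contDiffOn_gammaBilin : ContDiffOn ℝ ∞ E.gammaBilin (S.bdryTarget E.toChart) :=
  ContDiffOn.sum fun α _ => contDiffOn_const.clm_comp
    (ContDiffOn.matForm fun γ β => contDiffOn_christoffel α γ β)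

variable (E) in
/-- The bilinear form `-½ C`. -/
def shearForm (a : ℝ × EuclideanSpace ℝ (Fin n)) :
    EuclideanSpace ℝ (Fin n) →L[ℝ] EuclideanSpace ℝ (Fin n) →L[ℝ] ℝ :=
  S.ν₀ • ((1 / 2 : ℝ) • E.kForm a.2 + a.1 • E.hForm a.2)

theorem shearForm_apply (a : ℝ × EuclideanSpace ℝ (Fin n)) (v w : EuclideanSpace ℝ (Fin n)) :
    E.shearForm a v w = S.ν₀ * ((1 / 2) * E.kForm a.2 v w + a.1 * E.hForm a.2 v w) := rfl

variable (E) in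
/-- The connection coefficients in the chart of `Spi` associated to a Beig–Schmidt chart. -/
def connForm (a : ℝ × EuclideanSpace ℝ (Fin n)) : ℝ × EuclideanSpace ℝ (Fin n) →L[ℝ]
    ℝ × EuclideanSpace ℝ (Fin n) →L[ℝ] ℝ × EuclideanSpace ℝ (Fin n) :=
  fiberBaseForm (E.shearForm a) (E.gammaBilin a.2)

theorem connForm_apply (a v w : ℝ × EuclideanSpace ℝ (Fin n)) :
    E.connForm a v w = (E.shearForm a v.2 w.2, E.gammaForm a.2 v.2 w.2) := by
  rw [connForm, fiberBaseForm_apply, gammaBilin_apply]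

theorem connForm_eq_carrollCoefficients (a v w : ℝ × EuclideanSpace ℝ (Fin n)) :
    E.connForm a v w = carrollCoefficients E.h E.C a v w := by
  rw [connForm_apply]
  refine Prod.ext ?_ rfl
  have h1 : E.kForm a.2 v.2 w.2 = ∑ γ, ∑ β, E.k a.2 γ β * v.2 γ * w.2 β := matForm_apply _ _ _
  rw [shearForm_apply, h1, hForm_apply]
  change _ = ∑ γ, ∑ β, -(1 / 2) * ((-2 * S.ν₀) * ((1 / 2 : ℝ) * E.k a.2 γ β
    + a.1 * E.h a.2 γ β)) * v.2 γ * w.2 β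
  simp only [Finset.mul_sum, ← Finset.sum_add_distrib]
  exact Finset.sum_congr rfl fun γ _ => Finset.sum_congr rfl fun β _ => by ring

theorem connForm_symm {a : ℝ × EuclideanSpace ℝ (Fin n)} (ha : a.2 ∈ S.bdryTarget E.toChart)
    (v w : ℝ × EuclideanSpace ℝ (Fin n)) : E.connForm a v w = E.connForm a w v := by
  rw [connForm_apply, connForm_apply, gammaForm_symm ha, shearForm_apply, shearForm_apply,
    kForm_symm ha, hForm_symm ha]

theorem contDiffOn_connForm :
    ContDiffOn ℝ ∞ E.connForm {a | a.2 ∈ S.bdryTarget E.toChart} := by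
  exact ContDiffOn.fiberBaseForm (contDiffOn_kForm.smul_add_fst_smul contDiffOn_hForm _ _)
    (contDiffOn_gammaBilin.comp contDiff_snd.contDiffOn fun _ h => h)

variable (E E') in
/-- The change of the coordinates `(u, y)` of `Spi`. -/
def spiTrans : ℝ × EuclideanSpace ℝ (Fin n) → ℝ × EuclideanSpace ℝ (Fin n) :=
  shearMap (E.jetDiff E') (E.bdryTrans E')

theorem contDiffAt_spiTrans {a : ℝ × EuclideanSpace ℝ (Fin n)}
    (ha : ((0 : ℝ), a.2) ∈ E.overlap E') : ContDiffAt ℝ ∞ (E.spiTrans E') a :=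
  contDiffAt_shearMap (contDiffOn_jetDiff.contDiffAt (isOpen_bdryOverlap.mem_nhds ha))
    (contDiffOn_bdryTrans.contDiffAt (isOpen_bdryOverlap.mem_nhds ha))

theorem spiTrans_spiCoord {p : S.Spi} (hp : S.ι p.base ∈ E.toChart.source) :
    E.spiTrans E' (E.spiCoord p) = E'.spiCoord p := by
  have h : E.bdry.symm (yCoord E.toChart (S.ι p.base)) = p.base := E.bdry.left_inv hp
  refine Prod.ext ?_ (bdryTrans_yCoord hp)
  change S.fiberCoord p - E.jetCoord p.base
    - (E'.jetCoord (E.bdry.symm (yCoord E.toChart (S.ι p.base)))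
      - E.jetCoord (E.bdry.symm (yCoord E.toChart (S.ι p.base)))) = _
  rw [h]
  change _ = S.fiberCoord p - E'.jetCoord p.base
  ring

/-- The reason for the formula for `C`: in `½k' + (u - κ)h'` the term `κh` of the law for `k` is
cancelled by the shift of `u`, and the factor `ν₀` turns `ν₀⁻¹∇dκ` into the Hessian required by
`compatible_shearMap`. -/
theorem compatible_connForm {a : ℝ × EuclideanSpace ℝ (Fin n)}
    (ha : ((0 : ℝ), a.2) ∈ E.overlap E') :
    ChartConnection.Compatible E.connForm E'.connForm (E.spiTrans E') a := by
  refine compatible_shearMap (contDiffOn_jetDiff.contDiffAt (isOpen_bdryOverlap.mem_nhds ha))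
    (contDiffOn_bdryTrans.contDiffAt (isOpen_bdryOverlap.mem_nhds ha)) (fun v w => ?_)
    fun v w => ?_
  · rw [gammaBilin_apply, gammaBilin_apply]
    exact gammaForm_transform ha v w
  · rw [gammaBilin_apply, shearForm_apply, shearForm_apply]
    have h1 := kForm_transform ha v w
    have h2 := hForm_bdryTrans ha v w
    have h3 : S.ν₀ * S.ν₀⁻¹ = 1 := mul_inv_cancel₀ (ν₀_ne_zero S)
    change S.ν₀ * ((1 / 2) * E'.kForm (E.bdryTrans E' a.2) _ _
      + (a.1 - E.jetDiff E' a.2) * E'.hForm (E.bdryTrans E' a.2) _ _) = _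
    rw [h1, ← h2]
    linear_combination (fderiv ℝ (fderiv ℝ (E.jetDiff E')) a.2 v w
          - fderiv ℝ (E.jetDiff E') a.2 (E.gammaForm a.2 v w)) * h3

end BeigSchmidtChart

end InfinityData

theorem fderiv_bilinear_along {V W : Type*} [NormedAddCommGroup V] [NormedSpace ℝ V]
    [NormedAddCommGroup W] [NormedSpace ℝ W] {H : V → V →L[ℝ] V →L[ℝ] ℝ} {y f g : W → V} {a : W}
    {y' f' g' : W →L[ℝ] V} (hH : DifferentiableAt ℝ H (y a)) (hy : HasFDerivAt y y' a)
    (hf : HasFDerivAt f f' a) (hg : HasFDerivAt g g' a) :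
    DifferentiableAt ℝ (fun z => H (y z) (f z) (g z)) a ∧
      ∀ v, fderiv ℝ (fun z => H (y z) (f z) (g z)) a v
        = fderiv ℝ H (y a) (y' v) (f a) (g a) + H (y a) (f' v) (g a) + H (y a) (f a) (g' v) := by
  have h0 := HasFDerivAt.comp (g := H) a hH.hasFDerivAt hy
  have h : HasFDerivAt (fun z => H (y z) (f z)) _ a := h0.clm_apply hf
  have h' : HasFDerivAt (fun z => H (y z) (f z) (g z)) _ a := h.clm_apply hg
  refine ⟨h'.differentiableAt, fun v => ?_⟩
  rw [h'.fderiv]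
  simp
  ring

namespace InfinityData

variable {n : ℕ} {M B : Type*}
    [TopologicalSpace M] [ChartedSpace (EuclideanHalfSpace (n + 1)) M]
    [IsManifold (𝓡∂ (n + 1)) ∞ M]
    [TopologicalSpace B] [ChartedSpace (EuclideanSpace ℝ (Fin n)) B]
    [IsManifold (𝓡 n) ∞ B]
    {S : InfinityData n M B}

open ChartConnection

namespace BeigSchmidtChart

variable [Nonempty B] (E : S.BeigSchmidtChart)

/-! ### The metric and the vertical vector field in the charts of `Spi` -/

theorem bdryDeriv_mfderiv_base {p : S.Spi} (hp : S.ι p.base ∈ E.toChart.source)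
    (v : TangentSpace 𝓘(ℝ, ℝ × EuclideanSpace ℝ (Fin n)) p) :
    E.bdryDeriv p.base (mfderiv 𝓘(ℝ, ℝ × EuclideanSpace ℝ (Fin n)) (𝓡 n) Spi.base p v)
      = (chartDeriv E.spiChart p v).2 := by
  have h1 : HasMFDerivAt (𝓡 n) 𝓘(ℝ, EuclideanSpace ℝ (Fin n))
      (fun z => yCoord E.toChart (S.ι z)) p.base (E.bdryDeriv p.base) :=
    (((S.contMDiffOn_yCoord_ι E.mem_maximalAtlas).contMDiffAt
      (E.bdry.open_source.mem_nhds hp)).mdifferentiableAt (by simp)).hasMFDerivAt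
  have h2 := h1.comp p ((S.contMDiff_base p).mdifferentiableAt (by simp)).hasMFDerivAt
  have h3 := (hasFDerivAt_snd (𝕜 := ℝ) (p := E.spiChart p)).hasMFDerivAt.comp p
    (hasMFDerivAt_chart E.spiChart_mem_maximalAtlas hp)
  have h4 := hasMFDerivAt_unique h2 h3
  exact congrArg (fun L : TangentSpace 𝓘(ℝ, ℝ × EuclideanSpace ℝ (Fin n)) p →L[ℝ]
    EuclideanSpace ℝ (Fin n) => L v) h4

theorem spiH_eq {p : S.Spi} (hp : S.ι p.base ∈ E.toChart.source)
    (v w : TangentSpace 𝓘(ℝ, ℝ × EuclideanSpace ℝ (Fin n)) p) :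
    S.spiH p v w = E.hForm (E.spiChart p).2 (chartDeriv E.spiChart p v).2
      (chartDeriv E.spiChart p w).2 := by
  rw [← E.bdryDeriv_mfderiv_base hp, ← E.bdryDeriv_mfderiv_base hp]
  exact (hForm_bdryDeriv hp _ _).symm

theorem chartVec_spiN {p : S.Spi} (hp : S.ι p.base ∈ E.toChart.source) :
    chartVec E.spiChart S.spiN p = (1, 0) := by
  have h0 : S.spiShift 0 p = p := by
    rw [spiShift, add_zero]
    exact S.spiEquiv_symm_apply p
  have h1 : ContMDiffAt 𝓘(ℝ, ℝ) 𝓘(ℝ, ℝ × EuclideanSpace ℝ (Fin n)) ∞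
      (fun t : ℝ => S.spiShift t p) 0 :=
    S.contMDiffAt_spiEquiv_symm (contDiffAt_const.add contDiffAt_id) contMDiffAt_const
  have h2 := (h1.mdifferentiableAt (by simp)).hasMFDerivAt
  have hc : HasMFDerivAt 𝓘(ℝ, ℝ × EuclideanSpace ℝ (Fin n)) 𝓘(ℝ, ℝ × EuclideanSpace ℝ (Fin n))
      E.spiChart (S.spiShift 0 p) (chartDeriv E.spiChart (S.spiShift 0 p)) :=
    hasMFDerivAt_chart E.spiChart_mem_maximalAtlas (by rw [h0]; exact hp)
  have h3 := hc.comp 0 h2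
  have h4 : HasMFDerivAt 𝓘(ℝ, ℝ) 𝓘(ℝ, ℝ × EuclideanSpace ℝ (Fin n))
      (E.spiChart ∘ fun t : ℝ => S.spiShift t p) 0
      ((ContinuousLinearMap.id ℝ ℝ).prod (0 : ℝ →L[ℝ] EuclideanSpace ℝ (Fin n))) := by
    have h5 : (E.spiChart ∘ fun t : ℝ => S.spiShift t p)
        = fun t => (S.fiberCoord p + t - E.jetCoord p.base, yCoord E.toChart (S.ι p.base)) := by
      funext t
      refine Prod.ext ?_ rfl
      change S.fiberCoord (S.spiEquiv.symm (S.fiberCoord p + t, p.base)) - _ = _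
      rw [fiberCoord_symm]
      rfl
    rw [h5]
    exact ((((hasFDerivAt_id (𝕜 := ℝ) (0 : ℝ)).const_add _).sub_const _).prodMk
      (hasFDerivAt_const _ _)).hasMFDerivAt
  have h6 := hasMFDerivAt_unique h3 h4
  have h7 := congrArg (fun L : ℝ →L[ℝ] ℝ × EuclideanSpace ℝ (Fin n) => L 1) h6
  have h8 : ((ContinuousLinearMap.id ℝ ℝ).prod (0 : ℝ →L[ℝ] EuclideanSpace ℝ (Fin n))) 1
      = (1, 0) := rfl
  refine Eq.trans ?_ (h7.trans h8)
  -- The chain rule gives the differential at `spiShift 0 p`, which equals `p` only propositionally;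
  -- the equality is transported on the common model space of the tangent spaces.
  have : ∀ q : S.Spi, q = p → ∀ v : ℝ × EuclideanSpace ℝ (Fin n),
    (chartDeriv E.spiChart p : ℝ × EuclideanSpace ℝ (Fin n) →L[ℝ] _) v
      = (chartDeriv E.spiChart q : ℝ × EuclideanSpace ℝ (Fin n) →L[ℝ] _) v := by
    rintro q rfl v
    rfl
  exact this _ h0 _

variable {E}

/-- In the sum of two Koszul expressions the last two terms cancel pairwise and only the derivative
along `u` is left. -/
theorem hForm_gammaForm_add {y : EuclideanSpace ℝ (Fin n)} (hy : y ∈ S.bdryTarget E.toChart)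
    (u v w : EuclideanSpace ℝ (Fin n)) :
    E.hForm y (E.gammaForm y u v) w + E.hForm y v (E.gammaForm y u w)
      = fderiv ℝ E.hForm y u v w := by
  rw [hForm_symm hy v, hForm_gammaForm hy, hForm_gammaForm hy, koszul, koszul,
    fderiv_hForm_symm hy u w v]
  ring

end BeigSchmidtChart

open BeigSchmidtChart

variable [Nonempty B]

/-! ### The Carrollian connection of `Spi` -/

/-- The charts of `Spi` associated to the Beig–Schmidt charts, with their connection
coefficients. -/
def spiAtlas (hS : S.IsAsymptoticallyFlat) :
    ChartConnection.Atlas (ℝ × EuclideanSpace ℝ (Fin n)) S.Spi S.BeigSchmidtChart where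
  chart E := E.spiChart
  mem_maximalAtlas E := E.spiChart_mem_maximalAtlas
  exists_mem_source p := hS p.base
  Γ E := E.connForm
  contDiffOn_Γ _ := contDiffOn_connForm
  φ E E' := E.spiTrans E'
  contDiffAt_φ _ _ _ hp := contDiffAt_spiTrans (mem_overlap hp.1 hp.2)
  φ_eq _ _ _ hp := spiTrans_spiCoord hp.1
  compatible _ _ _ hp := compatible_connForm (mem_overlap hp.1 hp.2)

theorem chartDeriv_spiAtlas_connection (hS : S.IsAsymptoticallyFlat) (E : S.BeigSchmidtChart)
    {p : S.Spi} (hp : S.ι p.base ∈ E.toChart.source)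
    {Y : ∀ q : S.Spi, TangentSpace 𝓘(ℝ, ℝ × EuclideanSpace ℝ (Fin n)) q} (hY : S.VecDiffAt Y p)
    (v : TangentSpace 𝓘(ℝ, ℝ × EuclideanSpace ℝ (Fin n)) p) :
    chartDeriv E.spiChart p ((spiAtlas hS).connection Y p v)
      = mvfderiv 𝓘(ℝ, ℝ × EuclideanSpace ℝ (Fin n)) (chartVec E.spiChart Y) p v
        + E.connForm (E.spiChart p) (chartDeriv E.spiChart p v) (chartVec E.spiChart Y p) :=
  (spiAtlas hS).chartDeriv_connection (i := E) hp hY v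

/-- In a chart of Ti/Spi the degenerate metric sees only the `y`-components and depends only on `y`,
so the `C` part of the coefficients drops out and the Levi-Civita property of `h` remains. -/
theorem mvfderiv_spiH (hS : S.IsAsymptoticallyFlat) {p : S.Spi}
    (X : TangentSpace 𝓘(ℝ, ℝ × EuclideanSpace ℝ (Fin n)) p)
    {Y Z : ∀ q : S.Spi, TangentSpace 𝓘(ℝ, ℝ × EuclideanSpace ℝ (Fin n)) q}
    (hY : S.VecDiffAt Y p) (hZ : S.VecDiffAt Z p) :
    mvfderiv 𝓘(ℝ, ℝ × EuclideanSpace ℝ (Fin n)) (fun q => S.spiH q (Y q) (Z q)) p X =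
      S.spiH p ((spiAtlas hS).connection Y p X) (Z p)
        + S.spiH p (Y p) ((spiAtlas hS).connection Z p X) := by
  obtain ⟨E, hp⟩ := hS p.base
  have hc := E.spiChart_mem_maximalAtlas
  have hp' : p ∈ E.spiChart.source := hp
  have hYd := mdifferentiableAt_chartVec hc hp' hY
  have hZd := mdifferentiableAt_chartVec hc hp' hZ
  have hYe := mvfderiv_eq_fderiv_comp_symm hc hp' hYd
  have hZe := mvfderiv_eq_fderiv_comp_symm hc hp' hZd
  have hYw := (differentiableAt_comp_chart_symm hc hp' hYd).hasFDerivAt.snd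
  have hZw := (differentiableAt_comp_chart_symm hc hp' hZd).hasFDerivAt.snd
  have hy : (E.spiChart p).2 ∈ S.bdryTarget E.toChart := ⟨p.base, hp, rfl⟩
  have key := fderiv_bilinear_along (differentiableAt_hForm hy) hasFDerivAt_snd hYw hZw
  have h1 := mvfderiv_comp_chart (f := fun q => S.spiH q (Y q) (Z q)) hc hp' key.1 (by
    filter_upwards [E.spiChart.open_source.mem_nhds hp'] with q hq
    rw [E.spiH_eq hq, Function.comp_apply, Function.comp_apply, E.spiChart.left_inv hq]
    rfl)
  rw [h1, ContinuousLinearMap.comp_apply, key.2, E.spiH_eq hp, E.spiH_eq hp,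
    chartDeriv_spiAtlas_connection hS E hp hY, chartDeriv_spiAtlas_connection hS E hp hZ,
    connForm_apply, connForm_apply, hYe, hZe, Function.comp_apply, Function.comp_apply,
    E.spiChart.left_inv hp']
  have h2 := hForm_gammaForm_add hy (chartDeriv E.spiChart p X).2 (chartVec E.spiChart Y p).2
    (chartVec E.spiChart Z p).2
  simp only [Prod.snd_add, map_add, add_apply]
  change fderiv ℝ E.hForm (E.spiChart p).2 (chartDeriv E.spiChart p X).2
    (chartVec E.spiChart Y p).2 (chartVec E.spiChart Z p).2 + _ + _ = _
  rw [← h2]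
  exact (fun a b c d => by ring : ∀ a b c d : ℝ, a + b + c + d = c + a + (d + b)) _ _ _ _

theorem connection_spiN (hS : S.IsAsymptoticallyFlat) (p : S.Spi) :
    (spiAtlas hS).connection S.spiN p = 0 := by
  -- Working in the chart that defines the connection at `p` makes the differentiability of `spiN`
  -- unnecessary. There `spiN` is the constant field `(1, 0)`, which the coefficients annihilate.
  set E := (spiAtlas hS).index p with hE
  have hp : S.ι p.base ∈ E.toChart.source := (spiAtlas hS).mem_source_index p
  ext X
  apply chartDeriv_injective E.spiChart_mem_maximalAtlas (show p ∈ E.spiChart.source from hp)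
  have h1 : chartDeriv E.spiChart p ((spiAtlas hS).connection S.spiN p X)
      = mvfderiv 𝓘(ℝ, ℝ × EuclideanSpace ℝ (Fin n)) (chartVec E.spiChart S.spiN) p X
        + E.connForm (E.spiChart p) (chartDeriv E.spiChart p X) (chartVec E.spiChart S.spiN p) :=
    chartDeriv_localCov E.spiChart_mem_maximalAtlas (show p ∈ E.spiChart.source from hp) X
  have h2 : mvfderiv 𝓘(ℝ, ℝ × EuclideanSpace ℝ (Fin n)) (chartVec E.spiChart S.spiN) p = 0 := by
    have h3 : HasMFDerivAt 𝓘(ℝ, ℝ × EuclideanSpace ℝ (Fin n)) 𝓘(ℝ, ℝ × EuclideanSpace ℝ (Fin n))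
        (chartVec E.spiChart S.spiN) p 0 := by
      refine (hasMFDerivAt_const ((1, 0) : ℝ × EuclideanSpace ℝ (Fin n)) p).congr_of_eventuallyEq ?_
      filter_upwards [E.spiChart.open_source.mem_nhds hp] with q hq using E.chartVec_spiN hq
    exact mvfderiv_eq h3
  rw [h1, h2, E.chartVec_spiN hp, connForm_apply, shearForm_apply, ← gammaBilin_apply]
  simp

theorem isCarrollian_connection (hS : S.IsAsymptoticallyFlat) :
    S.IsCarrollian (spiAtlas hS).connection where
  smooth := (spiAtlas hS).contMDiffCovariantDerivative_connection
  torsion_eq_zero := (spiAtlas hS).torsion_connection fun _ p hp =>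
    connForm_symm ⟨p.base, hp, rfl⟩
  metric _ X _ _ hY hZ := mvfderiv_spiH hS X hY hZ
  vectorField := connection_spiN hS

/-! ### Coefficients in arbitrary associated charts, and uniqueness. -/

theorem IsAssociated.eventuallyEq {E : S.BeigSchmidtChart}
    {c : OpenPartialHomeomorph S.Spi (ℝ × EuclideanSpace ℝ (Fin n))} (h : IsAssociated c E)
    {p : S.Spi} (hp : p ∈ c.source) : c =ᶠ[𝓝 p] E.spiChart := by
  filter_upwards [c.open_source.mem_nhds hp] with q hq using h.eq_spiCoord hq

theorem IsAssociated.chartDeriv_eq {E : S.BeigSchmidtChart}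
    {c : OpenPartialHomeomorph S.Spi (ℝ × EuclideanSpace ℝ (Fin n))} (h : IsAssociated c E)
    {p : S.Spi} (hp : p ∈ c.source) : chartDeriv c p = chartDeriv E.spiChart p :=
  mvfderiv_eq ((hasMFDerivAt_chart E.spiChart_mem_maximalAtlas
    (h.mem_source p hp)).congr_of_eventuallyEq (h.eventuallyEq hp))

theorem hasCoefficients_connection (hS : S.IsAsymptoticallyFlat) {E : S.BeigSchmidtChart}
    {c : OpenPartialHomeomorph S.Spi (ℝ × EuclideanSpace ℝ (Fin n))} (h : IsAssociated c E) :
    HasCoefficients (spiAtlas hS).connection c (carrollCoefficients E.h E.C) := by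
  intro p hp X Y hY
  have hp' := h.mem_source p hp
  have h1 := chartDeriv_spiAtlas_connection hS E hp' hY X
  have hV : chartVec c Y =ᶠ[𝓝 p] chartVec E.spiChart Y := by
    filter_upwards [c.open_source.mem_nhds hp] with q hq
    exact congrArg (fun L : TangentSpace 𝓘(ℝ, ℝ × EuclideanSpace ℝ (Fin n)) q →L[ℝ]
      ℝ × EuclideanSpace ℝ (Fin n) => L (Y q)) (h.chartDeriv_eq hq)
  have hVd : mvfderiv 𝓘(ℝ, ℝ × EuclideanSpace ℝ (Fin n)) (chartVec c Y) p
      = mvfderiv 𝓘(ℝ, ℝ × EuclideanSpace ℝ (Fin n)) (chartVec E.spiChart Y) p :=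
    mvfderiv_eq ((hasMFDerivAt_mvfderiv (mdifferentiableAt_chartVec E.spiChart_mem_maximalAtlas
      (show p ∈ E.spiChart.source from hp') hY)).congr_of_eventuallyEq hV)
  change chartDeriv c p ((spiAtlas hS).connection Y p X)
    = mvfderiv 𝓘(ℝ, ℝ × EuclideanSpace ℝ (Fin n)) (chartVec c Y) p X
      + carrollCoefficients E.h E.C (c p) (chartDeriv c p X) (chartVec c Y p)
  rw [h.chartDeriv_eq hp, hVd, hV.self_of_nhds, (h.eventuallyEq hp).self_of_nhds, h1,
    connForm_eq_carrollCoefficients]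

theorem HasCoefficients.eq (hS : S.IsAsymptoticallyFlat) {D D' : S.SpiConnection}
    (hD : ∀ (c : OpenPartialHomeomorph S.Spi (ℝ × EuclideanSpace ℝ (Fin n)))
      (E : S.BeigSchmidtChart), IsAssociated c E →
      HasCoefficients D c (carrollCoefficients E.h E.C))
    (hD' : ∀ (c : OpenPartialHomeomorph S.Spi (ℝ × EuclideanSpace ℝ (Fin n)))
      (E : S.BeigSchmidtChart), IsAssociated c E →
      HasCoefficients D' c (carrollCoefficients E.h E.C))
    {Y : ∀ q : S.Spi, TangentSpace 𝓘(ℝ, ℝ × EuclideanSpace ℝ (Fin n)) q} {p : S.Spi}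
    (hY : S.VecDiffAt Y p) : D' Y p = D Y p := by
  obtain ⟨E, hp⟩ := hS p.base
  have hp' : p ∈ E.spiChart.source := hp
  ext X
  apply chartDeriv_injective E.spiChart_mem_maximalAtlas hp'
  exact (hD' _ E E.isAssociated_spiChart p hp' X Y hY).trans
    (hD _ E E.isAssociated_spiChart p hp' X Y hY).symm

end InfinityData

end

/-! ### The empty boundary and the conclusion. -/

/-- The atlas without charts of an empty manifold. -/
def ChartConnection.emptyAtlas (N Q : Type*) [NormedAddCommGroup N] [NormedSpace ℝ N]
    [TopologicalSpace Q] [ChartedSpace N Q] [IsEmpty Q] : ChartConnection.Atlas N Q Empty where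
  chart := Empty.elim
  mem_maximalAtlas i := i.elim
  exists_mem_source := isEmptyElim
  Γ := Empty.elim
  contDiffOn_Γ i := i.elim
  φ := Empty.elim
  contDiffAt_φ i := i.elim
  φ_eq i := i.elim
  compatible i := i.elim

theorem mainTheorem3 {n : ℕ} (hn : 1 < n) {M B : Type*}
    [TopologicalSpace M] [ChartedSpace (EuclideanHalfSpace (n + 1)) M]
    [IsManifold (𝓡∂ (n + 1)) ∞ M]
    [TopologicalSpace B] [ChartedSpace (EuclideanSpace ℝ (Fin n)) B]
    [IsManifold (𝓡 n) ∞ B]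
    (S : InfinityData n M B) (hS : S.IsAsymptoticallyFlat) :
    ∃ D : S.SpiConnection,
      S.IsCarrollian D ∧
      (∀ (c : OpenPartialHomeomorph S.Spi (ℝ × EuclideanSpace ℝ (Fin n)))
        (E : S.BeigSchmidtChart), InfinityData.IsAssociated c E →
        InfinityData.HasCoefficients D c (InfinityData.carrollCoefficients E.h E.C)) ∧
      ∀ D' : S.SpiConnection,
        (∀ (c : OpenPartialHomeomorph S.Spi (ℝ × EuclideanSpace ℝ (Fin n)))
          (E : S.BeigSchmidtChart), InfinityData.IsAssociated c E →
          InfinityData.HasCoefficients D' c (InfinityData.carrollCoefficients E.h E.C)) →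
        ∀ Y p, S.VecDiffAt Y p → D' Y p = D Y p := by
  cases isEmpty_or_nonempty B with
  -- The inverse boundary charts rely on `Function.invFun`, which needs a point of `B`; when `B` is
  -- empty so is Ti/Spi, and every pointwise condition is vacuous.
  | inl hB =>
    have : IsEmpty S.Spi := ⟨fun p => hB.elim p.base⟩
    let A := ChartConnection.emptyAtlas (ℝ × EuclideanSpace ℝ (Fin n)) S.Spi
    exact ⟨A.connection,
      { smooth := A.contMDiffCovariantDerivative_connection
        torsion_eq_zero := A.torsion_connection fun i => i.elim
        metric := isEmptyElim
        vectorField := isEmptyElim },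
      fun _ _ _ => isEmptyElim, fun _ _ _ => isEmptyElim⟩
  | inr hB =>
    have h := fun c E => InfinityData.hasCoefficients_connection (c := c) (E := E) hS
    exact ⟨(InfinityData.spiAtlas hS).connection, InfinityData.isCarrollian_connection hS, h,
      fun _ hD' _ _ hY => InfinityData.HasCoefficients.eq hS h hD' hY⟩
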